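/- Let $D=D_1\cup D_2$ be a diagram in the plane $\mathbb{R}^2$ of an oriented link with two components: a smooth closed embedded curve system in $\mathbb{R}^3$ whose projection is an immersion with only transverse double points, with over/under information; $D_i$ is the projection of the $i$-th component. Assume that the projection image of $D$ is connected, and let $x_1,\dots,x_n$ be its crossings. The regions of $D$ are the connected components of the complement of the projection image. For a crossing $x$ and a region $R$ put * $a^{(d1)}_{xR}=1$ if $x\in\partial R$ and $0$ otherwise; $a^{(d2)}_{xR}=2$ if $R$ touches $x$ at two corners, and $a^{(d2)}_{xR}=a^{(d1)}_{xR}$ otherwise; * $a^{(a1)}_{xR}=1$ (resp. $-1$) if $R$ touches $x$ at a corner that is swept by turning the underpass counterclockwise (resp. clockwise) to the overpass, and $0$ if $R$ does not touch $x$; $a^{(a2)}_{xR}=2a^{(a1)}_{xR}$ if $R$ touches $x$ at two corners, and $a^{(a2)}_{xR}=a^{(a1)}_{xR}$ otherwise. Let $A_{d1},A_{d2},A_{a1},A_{a2}$ be the corresponding integer matrices, with rows indexed by the crossings and columns by the regions, and let $\varepsilon_x=\pm1$ be the sign of the crossing $x$. A checkerboard coloring assigns to each region an element of $\mathbb{Z}/2$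 such that the regions on the left and on the right of each arc have different colors. There is a crossing at which $D_2$ crosses $D_1$ from the right to the left. Let $x_m$ be any such crossing. (After relabelling one may take $m=n$, with the self-crossings of $D_1$ and of $D_2$ listed first as $x_1,\dots,x_k$.) For each $i\ne m$ such that $x_i$ is a crossing of $D_1$ with $D_2$, let $\mathbf e_i\in\mathbb{Z}^n$ be the vector whose $m$-th component is $\varepsilon_{x_m}$, whose $i$-th component is $\varepsilon_{x_i}$ (resp. $-\varepsilon_{x_i}$) if $D_2$ crosses $D_1$ at $x_i$ from the left to the right (resp. from the right to the left), and whose other components are $0$. For each self-crossing $x_i$ let $\mathbf e_i$ be the $i$-th unit vector. Then: 1. There is a checkerboard coloring such that the corners at $x_m$ lying on the left of both oriented arcs, or on the right of both, belong to regions of color $0$; and for each $i\neq m$ such that $x_i$ is a crossing of $D_1$ with $D_2$ there is an integer vector $\mathbf v_i$, indexed by the regions, with $A_{a2}\mathbf v_i=\mathbf e_i$. 2. For any such coloring and any such $\mathbf v_i$, let $\bar{\mathbf v}_i$ be obtained from $\mathbf v_i$ by multiplying the components at the regions of color $1$ by $-1$, and let $\bar{\mathbf e}_i=A_{d2}\bar{\mathbf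 v}_i$. Then the $m$-th component of $\bar{\mathbf e}_i$ is $1$, its $i$-th component is $1$ or $-1$, and its other components are $0$. 3. The vectors $\mathbf e_i$ ($x_i$ a self-crossing) together with the vectors $\bar{\mathbf e}_i$ ($i\ne m$, $x_i$ a crossing of $D_1$ with $D_2$) are linearly independent over $\mathbb{Z}$, and their integer span is the image of $\mathbf u\mapsto A_{d1}\mathbf u$ and also the image of $\mathbf w\mapsto A_{d2}\mathbf w$, where $\mathbf u,\mathbf w$ range over the integer vectors indexed by the regions. 4. Consequently, for $\mathbf c\in\mathbb{Z}^n$, each of the systems $A_{d1}\mathbf u+\mathbf c=\mathbf 0$ and $A_{d2}\mathbf w+\mathbf c=\mathbf 0$ has an integer solution if and only if $\mathbf c$ is an integer linear combination of these vectors. -/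

import Mathlib

open scoped ContDiff Topology

/-- The cross product `z.re * w.im - z.im * w.re` of two plane vectors. It is positive
exactly when `w` points to the left of `z`. -/
def planeCross (z w : ℂ) : ℝ := z.re * w.im - z.im * w.re

/-- Points of the disjoint union of `l` oriented circles `ℝ / ℤ`, each given by its
component and its representative in `[0, 1)`. -/
abbrev CirclePoint (l : ℕ) : Type := Fin l × Set.Ico (0 : ℝ) 1

/-- An oriented diagram in the plane `ℂ = ℝ²` of an oriented link with `l` ordered components.
The link is the smoothly embedded closed curve system `t ↦ (curve i t, height i t)` in
`ℂ × ℝ = ℝ³`, and it is projected along the `height` coordinate; the projection is an immersion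
whose only singular points are transverse double points. The over/under information is given by
the heights. -/
structure LinkDiagram (l : ℕ) where
  curve : Fin l → ℝ → ℂ
  height : Fin l → ℝ → ℝ
  contDiff_curve : ∀ i, ContDiff ℝ ∞ (curve i)
  contDiff_height : ∀ i, ContDiff ℝ ∞ (height i)
  periodic_curve : ∀ i, Function.Periodic (curve i) 1
  periodic_height : ∀ i, Function.Periodic (height i) 1
  deriv_curve_ne_zero : ∀ i t, deriv (curve i) t ≠ 0
  embedded : ∀ s t : CirclePoint l, curve s.1 s.2 = curve t.1 t.2 →
    height s.1 s.2 = height t.1 t.2 → s = t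
  no_triple : ∀ s t r : CirclePoint l, curve s.1 s.2 = curve t.1 t.2 →
    curve t.1 t.2 = curve r.1 r.2 → s = t ∨ t = r ∨ s = r
  transverse : ∀ s t : CirclePoint l, s ≠ t → curve s.1 s.2 = curve t.1 t.2 →
    planeCross (deriv (curve s.1) s.2) (deriv (curve t.1) t.2) ≠ 0

namespace LinkDiagram

variable {l : ℕ}

/-- The projected position of a point of the link. -/
def pos (D : LinkDiagram l) (s : CirclePoint l) : ℂ := D.curve s.1 s.2

/-- The tangent vector of the projected oriented curve. -/
noncomputable def tangent (D : LinkDiagram l) (s : CirclePoint l) : ℂ :=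
  deriv (D.curve s.1) s.2

/-- The height above the projection plane. -/
def ht (D : LinkDiagram l) (s : CirclePoint l) : ℝ := D.height s.1 s.2

/-- The projection image of the link. -/
def image (D : LinkDiagram l) : Set ℂ := ⋃ i, Set.range (D.curve i)

/-- A region is a connected component of the complement of the projection image. -/
def Region (D : LinkDiagram l) : Type :=
  {S : Set ℂ // ∃ p ∈ D.imageᶜ, S = connectedComponentIn D.imageᶜ p}

/-- A region as a subset of the plane. -/
def Region.toSet {D : LinkDiagram l} (R : D.Region) : Set ℂ := R.1

/-- A crossing, given by the point of the link on its overpass and the point on its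
underpass. -/
structure Crossing (D : LinkDiagram l) where
  overPt : CirclePoint l
  underPt : CirclePoint l
  pos_eq : D.pos overPt = D.pos underPt
  ht_lt : D.ht underPt < D.ht overPt

namespace Crossing

variable {D : LinkDiagram l}

/-- The double point of the projection at the crossing. -/
def point (c : D.Crossing) : ℂ := D.pos c.overPt

/-- A crossing of arcs of the same link component. -/
def IsSelf (c : D.Crossing) : Prop := c.overPt.1 = c.underPt.1

open Classical in
/-- The sign of a crossing: `1` if the underpass crosses the overpass from the right to the
left (positive crossing), and `-1` otherwise. -/
noncomputable def sign (c : D.Crossing) : ℤ :=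
  if 0 < planeCross (D.tangent c.overPt) (D.tangent c.underPt) then 1 else -1

/-- For a diagram `D₁ ∪ D₂` (components `0` and `1`), the second component crosses the first
from the right to the left at `c`. -/
def CrossesRightToLeft {D : LinkDiagram 2} (c : D.Crossing) : Prop :=
  (c.overPt.1 = 0 ∧ c.underPt.1 = 1 ∧ 0 < planeCross (D.tangent c.overPt) (D.tangent c.underPt)) ∨
  (c.underPt.1 = 0 ∧ c.overPt.1 = 1 ∧ 0 < planeCross (D.tangent c.underPt) (D.tangent c.overPt))

/-- The second component crosses the first from the left to the right at `c`. -/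
def CrossesLeftToRight {D : LinkDiagram 2} (c : D.Crossing) : Prop :=
  (c.overPt.1 = 0 ∧ c.underPt.1 = 1 ∧ planeCross (D.tangent c.overPt) (D.tangent c.underPt) < 0) ∨
  (c.underPt.1 = 0 ∧ c.overPt.1 = 1 ∧ planeCross (D.tangent c.underPt) (D.tangent c.overPt) < 0)

end Crossing

/-- The four corners at a crossing: `(σ, τ)` is the corner between the half-tangent `σ • o` of
the overpass and the half-tangent `τ • w` of the underpass, with `σ, τ = ±1`. -/
abbrev Corner : Type := ℤˣ × ℤˣ

namespace Crossing

variable {D : LinkDiagram l}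

/-- The half-tangent of the overpass that bounds the corner. -/
noncomputable def overRay (c : D.Crossing) (κ : Corner) : ℂ := ((κ.1 : ℤ) : ℂ) * D.tangent c.overPt

/-- The half-tangent of the underpass that bounds the corner. -/
noncomputable def underRay (c : D.Crossing) (κ : Corner) : ℂ :=
  ((κ.2 : ℤ) : ℂ) * D.tangent c.underPt

/-- A direction pointing from the crossing into the corner. -/
noncomputable def cornerDir (c : D.Crossing) (κ : Corner) : ℂ := c.overRay κ + c.underRay κ

/-- The region `R` touches the crossing `c` at the corner `κ`. -/
def TouchesAt (c : D.Crossing) (R : D.Region) (κ : Corner) : Prop :=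
  ∀ᶠ r : ℝ in 𝓝[>] 0, c.point + (r : ℂ) * c.cornerDir κ ∈ R.toSet

/-- The region `R` touches the crossing `c` at two different corners. -/
def TouchesTwice (c : D.Crossing) (R : D.Region) : Prop :=
  ∃ κ κ' : Corner, κ ≠ κ' ∧ c.TouchesAt R κ ∧ c.TouchesAt R κ'

/-- The corner is swept when the underpass is turned counterclockwise to the overpass. -/
def IsCounterclockwise (c : D.Crossing) (κ : Corner) : Prop :=
  0 < planeCross (c.underRay κ) (c.overRay κ)

/-- The corner is swept when the underpass is turned clockwise to the overpass. -/
def IsClockwise (c : D.Crossing) (κ : Corner) : Prop :=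
  planeCross (c.underRay κ) (c.overRay κ) < 0

/-- The corner lies on the left of both oriented arcs at the crossing, or on the right of both
of them. -/
def IsSideCorner (c : D.Crossing) (κ : Corner) : Prop :=
  (0 < planeCross (D.tangent c.overPt) (c.cornerDir κ) ∧
    0 < planeCross (D.tangent c.underPt) (c.cornerDir κ)) ∨
  (planeCross (D.tangent c.overPt) (c.cornerDir κ) < 0 ∧
    planeCross (D.tangent c.underPt) (c.cornerDir κ) < 0)

end Crossing

/-! ### Region choice matrices -/

open Classical in
/-- The definite region choice matrix of the single counting rule. -/
noncomputable def definiteSingle (D : LinkDiagram l) : Matrix D.Crossing D.Region ℤ :=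
  fun c R => if c.point ∈ frontier R.toSet then 1 else 0

open Classical in
/-- The definite region choice matrix of the double counting rule. -/
noncomputable def definiteDouble (D : LinkDiagram l) : Matrix D.Crossing D.Region ℤ :=
  fun c R => if c.TouchesTwice R then 2 else D.definiteSingle c R

open Classical in
/-- The alternating region choice matrix of the single counting rule. -/
noncomputable def alternatingSingle (D : LinkDiagram l) : Matrix D.Crossing D.Region ℤ :=
  fun c R =>
    if ∃ κ, c.TouchesAt R κ ∧ c.IsCounterclockwise κ then 1
    else if ∃ κ, c.TouchesAt R κ ∧ c.IsClockwise κ then -1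
    else 0

open Classical in
/-- The alternating region choice matrix of the double counting rule. -/
noncomputable def alternatingDouble (D : LinkDiagram l) : Matrix D.Crossing D.Region ℤ :=
  fun c R => if c.TouchesTwice R then 2 * D.alternatingSingle c R else D.alternatingSingle c R

/-- The map `u ↦ A u` induced by a region choice matrix, for crossings labelled
`x₁, …, xₙ`. At most four regions touch a crossing, so the sums are finite. -/
noncomputable def choiceMap {D : LinkDiagram l} {n : ℕ} (x : Fin n ≃ D.Crossing)
    (A : Matrix D.Crossing D.Region ℤ) (u : D.Region → ℤ) : Fin n → ℤ :=
  fun i => ∑ᶠ R : D.Region, A (x i) R * u R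

/-! ### Alexander numberings and checkerboard colorings -/

/-- The point `s` of the link is not on a crossing. -/
def IsSimplePoint (D : LinkDiagram l) (s : CirclePoint l) : Prop :=
  ∀ t, D.pos t = D.pos s → t = s

/-- The region `R` is the left region along the oriented arc at `s`. -/
def IsLeftRegion (D : LinkDiagram l) (R : D.Region) (s : CirclePoint l) : Prop :=
  ∀ᶠ r : ℝ in 𝓝[>] 0, D.pos s + (r : ℂ) * (Complex.I * D.tangent s) ∈ R.toSet

/-- The region `R` is the right region along the oriented arc at `s`. -/
def IsRightRegion (D : LinkDiagram l) (R : D.Region) (s : CirclePoint l) : Prop :=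
  ∀ᶠ r : ℝ in 𝓝[>] 0, D.pos s - (r : ℂ) * (Complex.I * D.tangent s) ∈ R.toSet

/-- An Alexander numbering with values in a ring `A`: along every oriented arc, the index of the
left region is larger by one than the index of the right region. -/
def IsAlexanderNumbering (D : LinkDiagram l) {A : Type*} [Ring A] (a : D.Region → A) : Prop :=
  ∀ s, D.IsSimplePoint s → ∀ R R' : D.Region,
    D.IsLeftRegion R s → D.IsRightRegion R' s → a R = a R' + 1

/-- A checkerboard coloring is an Alexander numbering modulo `2`. -/
def IsCheckerboardColoring (D : LinkDiagram l) (χ : D.Region → ZMod 2) : Prop :=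
  D.IsAlexanderNumbering χ

/-- A checkerboard coloring that is `0` on the regions on the left of both oriented arcs and on
the right of both oriented arcs at the crossing `c`. -/
def IsCheckerboardColoringAt (D : LinkDiagram l) (c : D.Crossing) (χ : D.Region → ZMod 2) :
    Prop :=
  D.IsCheckerboardColoring χ ∧ ∀ R κ, c.TouchesAt R κ → c.IsSideCorner κ → χ R = 0

open Classical in
/-- Multiply the components at the regions of color `1` by `-1`. -/
noncomputable def checkerboardTwist {D : LinkDiagram l} (χ : D.Region → ZMod 2)
    (u : D.Region → ℤ) : D.Region → ℤ :=
  fun R => if χ R = 1 then -u R else u R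

/-! ### The vectors `eᵢ` and `ēᵢ` for a two-component diagram -/

open Classical in
/-- The vector `eᵢ` of the alternating problem for a crossing `xᵢ ≠ xₘ` of the two components:
its component at `xₘ` is the sign of `xₘ`, its component at `xᵢ` is the sign of `xᵢ` if `D₂`
crosses `D₁` there from the left to the right and minus that sign if from the right to the left,
and all others are `0`. -/
noncomputable def alternatingVector {D : LinkDiagram 2} {n : ℕ} (x : Fin n ≃ D.Crossing)
    (m i : Fin n) : Fin n → ℤ :=
  fun j =>
    if j = m then (x m).sign
    else if j = i then (if (x i).CrossesLeftToRight then (x i).sign else -(x i).sign)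
    else 0

/-- The vector `ēᵢ` obtained from a choice `v` for the alternating problem. -/
noncomputable def definiteVector {D : LinkDiagram l} {n : ℕ} (x : Fin n ≃ D.Crossing)
    (χ : D.Region → ZMod 2) (v : D.Region → ℤ) : Fin n → ℤ :=
  choiceMap x D.definiteDouble (checkerboardTwist χ v)

open Classical in
/-- The family of the vectors for all `i ≠ m`: the unit vector `eᵢ` if `xᵢ` is a self-crossing
of a component, and `ēᵢ` if `xᵢ` is a crossing of the two components. -/
noncomputable def definiteFamily {D : LinkDiagram 2} {n : ℕ} (x : Fin n ≃ D.Crossing)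
    (m : Fin n) (χ : D.Region → ZMod 2) (v : Fin n → D.Region → ℤ) :
    {i : Fin n // i ≠ m} → (Fin n → ℤ) :=
  fun i => if (x i).IsSelf then Pi.single (i : Fin n) 1 else definiteVector x χ (v i)

end LinkDiagram

/-! For a function `u` on the regions, let `cornerSum` at a crossing be the sum of `u` over the four
corners, and `altSum` the same sum in which the corners on the same side of both arcs count
positively and the other two negatively. Adjacent corners always lie in different regions, so the
entries of `A_{d2} u` are the corner sums, those of `A_{a2} u` are the alternating sums times the
crossing signs, and those of `A_{d1} u` are the corner sums minus the values at the regions touching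
twice. A checkerboard coloring alternates around every crossing, so twisting by it exchanges the two
kinds of sums up to one sign per crossing (`Crossing.cornerSum_twist`). This gives the values of the
vectors `ēᵢ`.

Upper bound for the images: along a component, the value of `u` on the left minus that on the right
is a periodic step function whose jump at a crossing is, up to sign, the alternating sum. The jumps
over one period add up to zero (`sum_jumps_eq_zero`). Each self-crossing is passed twice with
opposite signs, so one linear relation among the crossings of the two components remains
(`sum_zeroEps_mul_altSum_eq_zero`).

Lower bound: take for `u` the winding number of a cycle made of arcs of the diagram. Its alternating
sum can be nonzero only where arcs of the cycle start or end (`eps_mul_altSum_regionWinding`). A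
loop at a self-crossing yields a unit vector up to sign; a cycle going from `xₘ` to `xᵢ` along `D₁`
and back along `D₂` yields `eᵢ`. Winding numbers are integrals of `dz / (z - p)`: over a closed
cycle they lie in `2πiℤ`, and they jump by `2πi` across an arc. The product of the winding numbers
of the two components has alternating sum one at every mixed crossing, so the relation says that
mixed crossings in the two directions are equally many. Connectedness supplies at least one, hence
one from right to left.

The family is triangular away from the coordinate `m`, and the relation has a nonzero coefficient at
`m`, so its span is exactly the kernel of the relation. Everything follows from the chain: span ≤
image of `A_{d2}` ≤ image of `A_{d1}` ≤ kernel = span. The delicate inclusion is the middle one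
(`range_doubleMap_le`). If a region touches a self-crossing twice, the loop there is disjoint from
the rest of the diagram, so its winding number, normalised to vanish along the rest, disturbs the
single counting rule only at crossings strictly inside the loop; a minimal loop then ends the
argument. -/

/-! ### Plane curves crossing transversally -/

/-- The coordinates with respect to a basis of the plane. -/
noncomputable def planeFrame (u v : ℂ) (h : planeCross u v ≠ 0) : (ℝ × ℝ) ≃L[ℝ] ℂ :=
  LinearEquiv.toContinuousLinearEquiv
    { toFun := fun z => z.1 • u + z.2 • v
      map_add' := fun z w => by simp only [Prod.fst_add, Prod.snd_add, add_smul]; abel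
      map_smul' := fun r z => by
        simp only [Prod.smul_fst, Prod.smul_snd, smul_eq_mul, mul_smul, smul_add, RingHom.id_apply]
      invFun := fun w => (planeCross w v / planeCross u v, planeCross u w / planeCross u v)
      left_inv := fun z => by
        ext
        · simp only [div_eq_iff h]; simp [planeCross]; ring
        · simp only [div_eq_iff h]; simp [planeCross]; ring
      right_inv := fun w => by
        simp only [div_eq_inv_mul]
        apply Complex.ext
        · simp
          field_simp
          simp [planeCross]; ring
        · simp
          field_simp
          simp [planeCross]; ring }

theorem planeFrame_apply (u v : ℂ) (h : planeCross u v ≠ 0) (z : ℝ × ℝ) :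
    planeFrame u v h z = z.1 * u + z.2 * v := by
  change z.1 • u + z.2 • v = _
  simp

theorem hasStrictFDerivAt_sum_curves {γ δ : ℝ → ℂ} (hγ : ContDiff ℝ 1 γ) (hδ : ContDiff ℝ 1 δ)
    (t s : ℝ) (z : ℝ × ℝ)
    (h : planeCross (deriv γ (t + z.1)) (deriv δ (s + z.2)) ≠ 0) :
    HasStrictFDerivAt (fun z : ℝ × ℝ => γ (t + z.1) + (δ (s + z.2) - δ s))
      (planeFrame (deriv γ (t + z.1)) (deriv δ (s + z.2)) h : (ℝ × ℝ) →L[ℝ] ℂ) z := by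
  have h1 := (hγ.contDiffAt.hasStrictDerivAt (x := t + z.1) one_ne_zero).hasStrictFDerivAt.comp z
    ((hasStrictFDerivAt_fst (𝕜 := ℝ) (p := z)).const_add t)
  have h2 := (hδ.contDiffAt.hasStrictDerivAt (x := s + z.2) one_ne_zero).hasStrictFDerivAt.comp z
    ((hasStrictFDerivAt_snd (𝕜 := ℝ) (p := z)).const_add s)
  have h3 := h1.add (h2.sub_const (δ s))
  refine h3.congr_fderiv ?_
  ext <;> simp [planeFrame_apply]

/-- Inverse function theorem for the sum of the two curves. When the curves meet at the base
parameters, the coordinate axes become the curves themselves. The last clause turns the direction of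
a ray in the plane into its initial velocity in the chart. -/
theorem exists_curve_chart {γ δ : ℝ → ℂ} (hγ : ContDiff ℝ 1 γ) (hδ : ContDiff ℝ 1 δ) (t s : ℝ)
    (h : planeCross (deriv γ t) (deriv δ s) ≠ 0) :
    ∃ e : OpenPartialHomeomorph (ℝ × ℝ) ℂ, (0, 0) ∈ e.source ∧
      (∀ z, e z = γ (t + z.1) + (δ (s + z.2) - δ s)) ∧
      (∀ z ∈ e.source, 0 < planeCross (deriv γ (t + z.1)) (deriv δ (s + z.2)) *
        planeCross (deriv γ t) (deriv δ s)) ∧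
      ∀ z ∈ e.source, ∀ a b : ℝ,
        HasDerivAt (fun r : ℝ => e.symm (e z + (r : ℂ) *
          (a * deriv γ (t + z.1) + b * deriv δ (s + z.2)))) (a, b) 0 := by
  have hf := hasStrictFDerivAt_sum_curves hγ hδ t s (0, 0) (by simpa using h)
  have cγ : Continuous (deriv γ) := hγ.continuous_deriv le_rfl
  have cδ : Continuous (deriv δ) := hδ.continuous_deriv le_rfl
  have hopen : IsOpen {z : ℝ × ℝ | 0 < planeCross (deriv γ (t + z.1)) (deriv δ (s + z.2)) *
        planeCross (deriv γ t) (deriv δ s)} := by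
    apply isOpen_lt continuous_const
    unfold planeCross
    have c1 : Continuous fun z : ℝ × ℝ => deriv γ (t + z.1) := cγ.comp (by fun_prop)
    have c2 : Continuous fun z : ℝ × ℝ => deriv δ (s + z.2) := cδ.comp (by fun_prop)
    have := Complex.continuous_re.comp c1
    have := Complex.continuous_re.comp c2
    have := Complex.continuous_im.comp c1
    have := Complex.continuous_im.comp c2
    simp only [Function.comp_def] at *
    fun_prop
  -- Where the orientation is that of the base point the derivative is invertible, so the inverse
  -- chart can be differentiated at every point of the source and not only at the origin.
  refine ⟨(hf.toOpenPartialHomeomorph _).restrOpen _ hopen, ?_, ?_, ?_, ?_⟩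
  · refine ⟨hf.mem_toOpenPartialHomeomorph_source, ?_⟩
    simpa using mul_self_pos.2 h
  · intro z; rfl
  · intro z hz; exact hz.2
  · intro z hz a b
    set e := (hf.toOpenPartialHomeomorph _).restrOpen _ hopen with he
    have hz' : planeCross (deriv γ (t + z.1)) (deriv δ (s + z.2)) ≠ 0 := by
      intro h0
      have := hz.2
      simp [h0] at this
    have hfz := (hasStrictFDerivAt_sum_curves hγ hδ t s z hz').hasFDerivAt
    have hsz : e.symm (e z) = z := e.left_inv hz
    have hd : HasFDerivAt e.symm ((planeFrame _ _ hz').symm : ℂ →L[ℝ] ℝ × ℝ) (e z) := by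
      apply e.hasFDerivAt_symm (e.map_source hz)
      rw [hsz]
      exact hfz
    have hl : HasDerivAt (fun r : ℝ => e z + (r : ℂ) *
        (a * deriv γ (t + z.1) + b * deriv δ (s + z.2)))
        (a * deriv γ (t + z.1) + b * deriv δ (s + z.2)) 0 := by
      have h1 : HasDerivAt (fun r : ℝ => (r : ℂ)) 1 (0 : ℝ) := Complex.ofRealCLM.hasDerivAt
      simpa using (h1.mul_const (a * deriv γ (t + z.1) + b * deriv δ (s + z.2))).const_add (e z)
    have hd' : HasFDerivAt e.symm ((planeFrame _ _ hz').symm : ℂ →L[ℝ] ℝ × ℝ)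
        (e z + ((0 : ℝ) : ℂ) * (a * deriv γ (t + z.1) + b * deriv δ (s + z.2))) := by
      simpa using hd
    have h3 := hd'.comp_hasDerivAt (0 : ℝ) hl
    have hv : (planeFrame _ _ hz').symm (a * deriv γ (t + z.1) + b * deriv δ (s + z.2)) = (a, b) := by
      rw [ContinuousLinearEquiv.symm_apply_eq, planeFrame_apply]
    rw [ContinuousLinearEquiv.coe_coe, hv] at h3
    exact h3

theorem eventually_pos_right {g : ℝ → ℝ} {g' : ℝ} (hg : HasDerivAt g g' 0)
    (h : 0 < g 0 ∨ g 0 = 0 ∧ 0 < g') : ∀ᶠ r : ℝ in 𝓝[>] 0, 0 < g r := by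
  rcases h with h | ⟨h0, h1⟩
  · exact (hg.continuousAt.eventually (lt_mem_nhds h)).filter_mono nhdsWithin_le_nhds
  · have := eventually_nhdsWithin_sign_eq_of_deriv_pos (f := g) (x₀ := 0)
      (by rw [hg.deriv]; exact h1) h0
    have h2 : ∀ᶠ r : ℝ in 𝓝[>] 0, SignType.sign (g r) = SignType.sign (r - 0) :=
      this.filter_mono nhdsWithin_le_nhds
    filter_upwards [h2, self_mem_nhdsWithin] with r hr hr0
    have hr0 : 0 < r := hr0
    rw [sub_zero, sign_pos hr0] at hr
    exact sign_eq_one_iff.1 hr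

theorem planeFrame_decomposition {u v : ℂ} (h : planeCross u v ≠ 0) (w : ℂ) :
    w = ((planeCross w v / planeCross u v : ℝ) : ℂ) * u +
      ((planeCross u w / planeCross u v : ℝ) : ℂ) * v := by
  rw [← planeFrame_apply u v h (planeCross w v / planeCross u v, planeCross u w / planeCross u v)]
  exact ((planeFrame u v h).apply_symm_apply w).symm

/-! ### Which side of the coordinate axes a ray enters, read in a chart -/

section ChartRay

variable {e : OpenPartialHomeomorph (ℝ × ℝ) ℂ} {z : ℝ × ℝ} {v : ℂ} {a b : ℝ}

theorem chart_ray_mem_target (hz : z ∈ e.source) :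
    ∀ᶠ r : ℝ in 𝓝[>] 0, e z + (r : ℂ) * v ∈ e.target := by
  have hc : Continuous fun r : ℝ => e z + (r : ℂ) * v := by fun_prop
  refine (hc.continuousAt.eventually (e.open_target.mem_nhds ?_)).filter_mono nhdsWithin_le_nhds
  simpa using e.map_source hz

theorem chart_ray_mem_open (hz : z ∈ e.source)
    (hd : HasDerivAt (fun r : ℝ => e.symm (e z + (r : ℂ) * v)) (a, b) 0) {O : Set (ℝ × ℝ)}
    (hO : IsOpen O) (hzO : z ∈ O) :
    ∀ᶠ r : ℝ in 𝓝[>] 0, e.symm (e z + (r : ℂ) * v) ∈ O := by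
  refine (hd.continuousAt.eventually (hO.mem_nhds ?_)).filter_mono nhdsWithin_le_nhds
  simpa [e.left_inv hz] using hzO

theorem chart_ray_fst_pos (hz : z ∈ e.source)
    (hd : HasDerivAt (fun r : ℝ => e.symm (e z + (r : ℂ) * v)) (a, b) 0) {σ : ℝ}
    (h : 0 < σ * z.1 ∨ z.1 = 0 ∧ 0 < σ * a) :
    ∀ᶠ r : ℝ in 𝓝[>] 0, 0 < σ * (e.symm (e z + (r : ℂ) * v)).1 := by
  have h1 : HasDerivAt (fun r : ℝ => (e.symm (e z + (r : ℂ) * v)).1) a 0 :=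
    (ContinuousLinearMap.fst ℝ ℝ ℝ).hasFDerivAt.comp_hasDerivAt (0 : ℝ) hd
  apply eventually_pos_right (h1.const_mul σ)
  simp only [Complex.ofReal_zero, zero_mul, add_zero, e.left_inv hz]
  rcases h with h | ⟨h, h'⟩
  · exact Or.inl h
  · exact Or.inr ⟨by rw [h, mul_zero], h'⟩

theorem chart_ray_snd_pos (hz : z ∈ e.source)
    (hd : HasDerivAt (fun r : ℝ => e.symm (e z + (r : ℂ) * v)) (a, b) 0) {τ : ℝ}
    (h : 0 < τ * z.2 ∨ z.2 = 0 ∧ 0 < τ * b) :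
    ∀ᶠ r : ℝ in 𝓝[>] 0, 0 < τ * (e.symm (e z + (r : ℂ) * v)).2 := by
  have h1 : HasDerivAt (fun r : ℝ => (e.symm (e z + (r : ℂ) * v)).2) b 0 :=
    (ContinuousLinearMap.snd ℝ ℝ ℝ).hasFDerivAt.comp_hasDerivAt (0 : ℝ) hd
  apply eventually_pos_right (h1.const_mul τ)
  simp only [Complex.ofReal_zero, zero_mul, add_zero, e.left_inv hz]
  rcases h with h | ⟨h, h'⟩
  · exact Or.inl h
  · exact Or.inr ⟨by rw [h, mul_zero], h'⟩

end ChartRay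

namespace LinkDiagram

variable {l : ℕ} (D : LinkDiagram l)

/-! ### Points of the link with real parameters -/

/-- The point of the link with an arbitrary real parameter. -/
noncomputable def pt (_ : LinkDiagram l) (i : Fin l) (t : ℝ) : CirclePoint l :=
  (i, ⟨Int.fract t, Int.fract_nonneg t, Int.fract_lt_one t⟩)

variable {D}

theorem pt_eq_iff {i j : Fin l} {t s : ℝ} :
    D.pt i t = D.pt j s ↔ i = j ∧ ∃ n : ℤ, t = s + n := by
  rw [pt, pt, Prod.mk.injEq]
  refine and_congr_right fun _ => Subtype.ext_iff.trans <|
    Int.fract_eq_fract.trans <| exists_congr fun n => ?_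
  constructor <;> intro h <;> linarith

theorem pt_add_int (i : Fin l) (t : ℝ) (n : ℤ) : D.pt i (t + n) = D.pt i t :=
  pt_eq_iff.2 ⟨rfl, n, rfl⟩

theorem pt_add_one (i : Fin l) (t : ℝ) : D.pt i (t + 1) = D.pt i t :=
  pt_eq_iff.2 ⟨rfl, 1, by simp⟩

theorem pt_coe (s : CirclePoint l) : D.pt s.1 s.2 = s := by
  obtain ⟨i, t, h0, h1⟩ := s
  simp [pt, Int.fract_eq_self.2 ⟨h0, h1⟩]

theorem pt_add_eq {i j : Fin l} {t s : ℝ} (h : D.pt i t = D.pt j s) (r : ℝ) :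
    D.pt i (t + r) = D.pt j (s + r) := by
  obtain ⟨rfl, n, hn⟩ := pt_eq_iff.1 h
  exact pt_eq_iff.2 ⟨rfl, n, by linarith⟩

theorem curve_add_int (i : Fin l) (t : ℝ) (n : ℤ) : D.curve i (t + n) = D.curve i t := by
  simpa using (D.periodic_curve i).int_mul n t

theorem pos_pt (i : Fin l) (t : ℝ) : D.pos (D.pt i t) = D.curve i t := by
  have := D.curve_add_int i (Int.fract t) ⌊t⌋
  rw [Int.fract_add_floor] at this
  exact this.symm

theorem curve_eq_of_pt_eq {i j : Fin l} {t s : ℝ} (h : D.pt i t = D.pt j s) :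
    D.curve i t = D.curve j s := by
  rw [← pos_pt, h, pos_pt]

theorem tangent_pt (i : Fin l) (t : ℝ) : D.tangent (D.pt i t) = deriv (D.curve i) t := by
  have h : (fun s => D.curve i (s + (⌊t⌋ : ℤ))) = D.curve i :=
    funext fun s => D.curve_add_int i s ⌊t⌋
  have h1 := deriv_comp_add_const (f := D.curve i) (a := ((⌊t⌋ : ℤ) : ℝ)) (x := Int.fract t)
  rw [h, Int.fract_add_floor] at h1
  exact h1

theorem contDiff_one (i : Fin l) : ContDiff ℝ 1 (D.curve i) :=
  (D.contDiff_curve i).of_le (by exact_mod_cast le_top)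

theorem continuous_curve (i : Fin l) : Continuous (D.curve i) := (D.contDiff_curve i).continuous

theorem curve_mem_image (i : Fin l) (t : ℝ) : D.curve i t ∈ D.image :=
  Set.mem_iUnion.2 ⟨i, t, rfl⟩

theorem no_triple_pt {a b c : CirclePoint l} (h1 : D.pos a = D.pos b) (h2 : D.pos b = D.pos c) :
    a = b ∨ b = c ∨ a = c :=
  D.no_triple a b c h1 h2

theorem isCompact_range_curve (i : Fin l) : IsCompact (Set.range (D.curve i)) :=
  (D.periodic_curve i).compact_of_continuous one_ne_zero (D.continuous_curve i)

/-! ### Regions faced by a ray -/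

/-- The ray from `p` in the direction `d` starts in the region `R`. -/
def Region.Faces (R : D.Region) (p d : ℂ) : Prop :=
  ∀ᶠ r : ℝ in 𝓝[>] 0, p + (r : ℂ) * d ∈ R.toSet

theorem Region.subset_compl (R : D.Region) : R.toSet ⊆ D.imageᶜ := by
  obtain ⟨S, p, hp, rfl⟩ := R
  exact connectedComponentIn_subset _ _

theorem Region.isPreconnected (R : D.Region) : IsPreconnected R.toSet := by
  obtain ⟨S, p, hp, rfl⟩ := R
  exact isPreconnected_connectedComponentIn

theorem Region.eq_of_mem {R R' : D.Region} {p : ℂ} (h : p ∈ R.toSet) (h' : p ∈ R'.toSet) :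
    R = R' := by
  obtain ⟨S, q, hq, rfl⟩ := R
  obtain ⟨S', q', hq', rfl⟩ := R'
  apply Subtype.ext
  change connectedComponentIn _ _ = connectedComponentIn _ _
  rw [connectedComponentIn_eq h, connectedComponentIn_eq h']

theorem exists_region_of_isPreconnected {S : Set ℂ} (hS : IsPreconnected S) (hne : S.Nonempty)
    (hsub : S ⊆ D.imageᶜ) : ∃ R : D.Region, S ⊆ R.toSet := by
  obtain ⟨p, hp⟩ := hne
  exact ⟨⟨_, p, hsub hp, rfl⟩, hS.subset_connectedComponentIn hp hsub⟩

theorem Region.Faces.unique {R R' : D.Region} {p d : ℂ} (h : R.Faces p d) (h' : R'.Faces p d) :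
    R = R' := by
  obtain ⟨r, h1, h2⟩ := (h.and h').exists
  exact Region.eq_of_mem h1 h2

theorem Region.Faces.mem_closure {R : D.Region} {p d : ℂ} (h : R.Faces p d) :
    p ∈ closure R.toSet := by
  have hc : Continuous fun r : ℝ => p + (r : ℂ) * d := by fun_prop
  have : Filter.Tendsto (fun r : ℝ => p + (r : ℂ) * d) (𝓝[>] 0) (𝓝 p) := by
    simpa using (hc.tendsto 0).mono_left nhdsWithin_le_nhds
  exact mem_closure_of_tendsto this h

/-! ### Charts of the diagram -/

/-- Compactness: the parameters in `[0, 1]` at distance at least `η` from the fibre over `p` have a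
compact image that misses `p`. The fibre is invariant under integer translations, so one period
suffices. -/
theorem exists_nhds_params (p : ℂ) {η : ℝ} (hη : 0 < η) :
    ∃ U ∈ 𝓝 p, ∀ k x, D.curve k x ∈ U → ∃ x₀, D.curve k x₀ = p ∧ |x - x₀| < η := by
  have key : ∀ k, ∃ U ∈ 𝓝 p, ∀ x, D.curve k x ∈ U → ∃ x₀, D.curve k x₀ = p ∧ |x - x₀| < η := by
    intro k
    let K : Set ℝ := Set.Icc 0 1 ∩ ⋂ x₀ ∈ {x₀ | D.curve k x₀ = p}, {x | η ≤ |x - x₀|}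
    have hK : IsCompact K := isCompact_Icc.inter_right <|
      isClosed_biInter fun x₀ _ => isClosed_le continuous_const (by fun_prop)
    refine ⟨(D.curve k '' K)ᶜ, (hK.image (D.continuous_curve k)).isClosed.isOpen_compl.mem_nhds ?_,
      fun x hx => ?_⟩
    · rintro ⟨x, hx, hxp⟩
      have := Set.mem_iInter₂.1 hx.2 x hxp
      simp only [Set.mem_ofPred_eq, sub_self, abs_zero] at this
      linarith
    · by_contra! hcon
      apply hx
      refine ⟨Int.fract x, ⟨⟨Int.fract_nonneg x, (Int.fract_lt_one x).le⟩, ?_⟩, ?_⟩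
      · refine Set.mem_iInter₂.2 fun x₀ hx₀ => ?_
        have h1 := hcon (x₀ + ⌊x⌋) ((D.curve_add_int k x₀ ⌊x⌋).trans hx₀)
        have h2 : x - (x₀ + ⌊x⌋) = Int.fract x - x₀ := by
          have := Int.self_sub_floor x
          linarith
        rwa [h2] at h1
      · have := D.curve_add_int k (Int.fract x) ⌊x⌋
        rw [Int.fract_add_floor] at this
        exact this.symm
  choose U hU h using key
  exact ⟨⋂ k, U k, Filter.iInter_mem.2 hU, fun k x hx => h k x (Set.mem_iInter.1 hx k)⟩

/-- The last clause says that near the crossing the diagram consists of the two axes only. A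
parameter landing close to the crossing is close to one landing exactly on it, which belongs to one
of the two strands since there are no triple points; injectivity of the chart does the rest. -/
theorem exists_crossing_chart {i j : Fin l} {t s : ℝ} (hp : D.curve i t = D.curve j s)
    (hne : D.pt i t ≠ D.pt j s) :
    ∃ (e : OpenPartialHomeomorph (ℝ × ℝ) ℂ) (ε : ℝ), 0 < ε ∧ Metric.ball 0 ε ⊆ e.source ∧
      (∀ z, e z = D.curve i (t + z.1) + (D.curve j (s + z.2) - D.curve j s)) ∧
      (∀ z ∈ e.source, 0 < planeCross (deriv (D.curve i) (t + z.1)) (deriv (D.curve j) (s + z.2)) *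
        planeCross (deriv (D.curve i) t) (deriv (D.curve j) s)) ∧
      (∀ z ∈ e.source, ∀ a b : ℝ,
        HasDerivAt (fun r : ℝ => e.symm (e z + (r : ℂ) *
          (a * deriv (D.curve i) (t + z.1) + b * deriv (D.curve j) (s + z.2)))) (a, b) 0) ∧
      ∀ z ∈ Metric.ball (0 : ℝ × ℝ) ε, ∀ k x, D.curve k x = e z →
        (z.2 = 0 ∧ D.pt k x = D.pt i (t + z.1)) ∨ (z.1 = 0 ∧ D.pt k x = D.pt j (s + z.2)) := by
  have htr : planeCross (deriv (D.curve i) t) (deriv (D.curve j) s) ≠ 0 := by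
    have := D.transverse (D.pt i t) (D.pt j s) hne
      (by have := pos_pt (D := D) i t; have := pos_pt (D := D) j s; simp_all [pos])
    have h1 := tangent_pt (D := D) i t
    have h2 := tangent_pt (D := D) j s
    simp only [tangent] at h1 h2
    rwa [h1, h2] at this
  obtain ⟨e, h0, he, hcross, hder⟩ :=
    exists_curve_chart (D.contDiff_one i) (D.contDiff_one j) t s htr
  obtain ⟨η, hη, hηs⟩ := Metric.isOpen_iff.1 e.open_source 0 h0
  obtain ⟨U, hU, hUp⟩ := exists_nhds_params (D := D) (D.curve i t) hη
  have he0 : e 0 = D.curve i t := by simp [he]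
  have hcont : ContinuousAt e 0 := e.continuousAt h0
  obtain ⟨ε, hε, hεU⟩ := Metric.mem_nhds_iff.1 (hcont.preimage_mem_nhds (by rwa [he0]))
  refine ⟨e, min ε η, lt_min hε hη,
    (Metric.ball_subset_ball (min_le_right _ _)).trans hηs, he, hcross, hder, ?_⟩
  intro z hz k x hx
  have hzs : z ∈ e.source := hηs (Metric.ball_subset_ball (min_le_right _ _) hz)
  have hzU : e z ∈ U := hεU (Metric.ball_subset_ball (min_le_left _ _) hz)
  obtain ⟨x₀, hx₀, hxx⟩ := hUp k x (hx ▸ hzU)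
  have h3 : D.pt k x₀ = D.pt i t ∨ D.pt k x₀ = D.pt j s := by
    rcases D.no_triple_pt (a := D.pt k x₀) (b := D.pt i t) (c := D.pt j s)
      (by rw [pos_pt, pos_pt, hx₀]) (by rw [pos_pt, pos_pt, hp]) with h | h | h
    · exact Or.inl h
    · exact absurd h hne
    · exact Or.inr h
  have hsm : |x - x₀| < η := hxx
  rcases h3 with h3 | h3
  · have h4 := pt_add_eq h3 (x - x₀)
    rw [add_sub_cancel] at h4
    have h5 : e (x - x₀, 0) = e z := by
      rw [← hx, he, curve_eq_of_pt_eq h4]; simp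
    have h6 := e.injOn (hηs (by simpa [Prod.norm_def, hη] using hsm)) hzs h5
    left
    rw [← h6]
    exact ⟨rfl, h4⟩
  · have h4 := pt_add_eq h3 (x - x₀)
    rw [add_sub_cancel] at h4
    have h5 : e (0, x - x₀) = e z := by
      rw [← hx, he, curve_eq_of_pt_eq h4]; simp [hp]
    have h6 := e.injOn (hηs (by simpa [Prod.norm_def, hη] using hsm)) hzs h5
    right
    rw [← h6]
    exact ⟨rfl, h4⟩

theorem isSimplePoint_pt_iff {i : Fin l} {t : ℝ} :
    D.IsSimplePoint (D.pt i t) ↔ ∀ k x, D.curve k x = D.curve i t → D.pt k x = D.pt i t := by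
  constructor
  · intro h k x hx
    exact h _ (by rw [pos_pt, pos_pt, hx])
  · intro h s hs
    have := h s.1 s.2 (by rw [pos_pt] at hs; exact hs)
    rwa [pt_coe] at this

/-- The straight normal line to a component. -/
noncomputable def normalLine (D : LinkDiagram l) (i : Fin l) (t : ℝ) (u : ℝ) : ℂ :=
  D.curve i t + u * (Complex.I * deriv (D.curve i) t)

theorem deriv_normalLine (i : Fin l) (t u : ℝ) :
    deriv (D.normalLine i t) u = Complex.I * deriv (D.curve i) t := by
  have h1 : HasDerivAt (fun r : ℝ => (r : ℂ)) 1 u := Complex.ofRealCLM.hasDerivAt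
  have h2 := ((h1.mul_const (Complex.I * deriv (D.curve i) t)).const_add (D.curve i t)).deriv
  rw [one_mul] at h2
  exact h2

theorem contDiff_normalLine (i : Fin l) (t : ℝ) : ContDiff ℝ 1 (D.normalLine i t) := by
  unfold normalLine
  exact contDiff_const.add (Complex.ofRealCLM.contDiff.mul contDiff_const)

theorem planeCross_I_mul_self (z : ℂ) : planeCross z (Complex.I * z) = z.re ^ 2 + z.im ^ 2 := by
  simp [planeCross]; ring

theorem planeCross_I_mul_self_pos {z : ℂ} (hz : z ≠ 0) : 0 < planeCross z (Complex.I * z) := by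
  rw [planeCross_I_mul_self]
  have : z.re ≠ 0 ∨ z.im ≠ 0 := by
    by_contra! h
    exact hz (Complex.ext h.1 h.2)
  rcases this with h | h <;> positivity

/-- The crossing chart with the second strand replaced by the straight normal line, which is not
part of the diagram; only the first axis lies on the image. -/
theorem exists_arc_chart {i : Fin l} {t : ℝ} (hs : D.IsSimplePoint (D.pt i t)) :
    ∃ (e : OpenPartialHomeomorph (ℝ × ℝ) ℂ) (ε : ℝ), 0 < ε ∧ Metric.ball 0 ε ⊆ e.source ∧
      (∀ z, e z = D.curve i (t + z.1) + (D.normalLine i t z.2 - D.curve i t)) ∧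
      (∀ z ∈ e.source, 0 < planeCross (deriv (D.curve i) (t + z.1))
        (Complex.I * deriv (D.curve i) t)) ∧
      (∀ z ∈ e.source, ∀ a b : ℝ,
        HasDerivAt (fun r : ℝ => e.symm (e z + (r : ℂ) *
          (a * deriv (D.curve i) (t + z.1) + b * (Complex.I * deriv (D.curve i) t)))) (a, b) 0) ∧
      ∀ z ∈ Metric.ball (0 : ℝ × ℝ) ε, ∀ k x, D.curve k x = e z →
        z.2 = 0 ∧ D.pt k x = D.pt i (t + z.1) := by
  have htr : 0 < planeCross (deriv (D.curve i) t) (deriv (D.normalLine i t) 0) := by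
    rw [deriv_normalLine]
    exact planeCross_I_mul_self_pos (D.deriv_curve_ne_zero i t)
  obtain ⟨e, h0, he, hcross, hder⟩ :=
    exists_curve_chart (D.contDiff_one i) (D.contDiff_normalLine i t) t 0 htr.ne'
  have hn0 : D.normalLine i t 0 = D.curve i t := by simp [normalLine]
  simp only [zero_add, hn0] at he
  simp only [deriv_normalLine] at hder hcross htr
  obtain ⟨η, hη, hηs⟩ := Metric.isOpen_iff.1 e.open_source 0 h0
  obtain ⟨U, hU, hUp⟩ := exists_nhds_params (D := D) (D.curve i t) hη
  have he0 : e 0 = D.curve i t := by simp [he, hn0]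
  have hcont : ContinuousAt e 0 := e.continuousAt h0
  obtain ⟨ε, hε, hεU⟩ := Metric.mem_nhds_iff.1 (hcont.preimage_mem_nhds (by rwa [he0]))
  refine ⟨e, min ε η, lt_min hε hη,
    (Metric.ball_subset_ball (min_le_right _ _)).trans hηs, he,
    fun z hz => (pos_iff_pos_of_mul_pos (hcross z hz)).2 htr, hder, ?_⟩
  intro z hz k x hx
  have hzs : z ∈ e.source := hηs (Metric.ball_subset_ball (min_le_right _ _) hz)
  have hzU : e z ∈ U := hεU (Metric.ball_subset_ball (min_le_left _ _) hz)
  obtain ⟨x₀, hx₀, hsm⟩ := hUp k x (hx ▸ hzU)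
  have h3 := isSimplePoint_pt_iff.1 hs k x₀ hx₀
  have h4 := pt_add_eq h3 (x - x₀)
  rw [add_sub_cancel] at h4
  have h5 : e (x - x₀, 0) = e z := by
    rw [← hx, he, curve_eq_of_pt_eq h4]; simp [hn0]
  have h6 := e.injOn (hηs (by simpa [Prod.norm_def, hη] using hsm)) hzs h5
  rw [← h6]
  exact ⟨rfl, h4⟩

end LinkDiagram

namespace LinkDiagram

variable {l : ℕ} {D : LinkDiagram l}

/-! ### Regions near a crossing and near a simple point -/

theorem unitsInt_real_mul_self (σ : ℤˣ) : ((σ : ℤ) : ℝ) * ((σ : ℤ) : ℝ) = 1 := by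
  rcases Int.units_eq_one_or σ with rfl | rfl <;> norm_num

theorem abs_unitsInt_real_mul (σ : ℤˣ) (h : ℝ) : |((σ : ℤ) : ℝ) * h| = |h| := by
  rcases Int.units_eq_one_or σ with rfl | rfl <;> simp

theorem exists_unitsInt_mul_pos {x : ℝ} (hx : x ≠ 0) : ∃ σ : ℤˣ, 0 < ((σ : ℤ) : ℝ) * x := by
  rcases lt_or_gt_of_ne hx with h | h
  · exact ⟨-1, by simpa using h⟩
  · exact ⟨1, by simpa using h⟩

theorem convex_quadrant (ε σ τ : ℝ) :
    Convex ℝ (Metric.ball (0 : ℝ × ℝ) ε ∩ ({z | 0 < σ * z.1} ∩ {z | 0 < τ * z.2})) := by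
  refine (convex_ball _ _).inter ((convex_halfSpace_gt ?_ 0).inter (convex_halfSpace_gt ?_ 0))
  · exact (σ • LinearMap.fst ℝ ℝ ℝ).isLinear
  · exact (τ • LinearMap.snd ℝ ℝ ℝ).isLinear

/-- Each open quadrant of the chart avoids the diagram and is convex, so its image lies in one
region. Everything is then a question of which quadrant a ray enters. The sign `sg` translates sides
into quadrants: the left side of the first strand is the half-plane towards which `sg` times the
second tangent points. -/
theorem exists_corner_regions {i j : Fin l} {t s : ℝ} (hp : D.curve i t = D.curve j s)
    (hne : D.pt i t ≠ D.pt j s) {sg : ℤˣ}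
    (hsg : 0 < ((sg : ℤ) : ℝ) * planeCross (deriv (D.curve i) t) (deriv (D.curve j) s)) :
    ∃ reg : ℤˣ → ℤˣ → D.Region,
      (∀ σ τ, (reg σ τ).Faces (D.curve i t) (((σ : ℤ) : ℂ) * deriv (D.curve i) t +
        ((τ : ℤ) : ℂ) * deriv (D.curve j) s)) ∧
      (∃ ε > 0, ∀ (σ : ℤˣ) (h : ℝ), 0 < h → h < ε →
        D.IsSimplePoint (D.pt i (t + (σ : ℤ) * h)) ∧ ∀ ρ : ℤˣ,
        (reg σ (ρ * sg)).Faces (D.curve i (t + (σ : ℤ) * h))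
          (((ρ : ℤ) : ℂ) * (Complex.I * deriv (D.curve i) (t + (σ : ℤ) * h)))) ∧
      ∀ R : D.Region, D.curve i t ∈ frontier R.toSet ↔ ∃ σ τ, R = reg σ τ := by
  obtain ⟨e, ε, hε, hball, he, hcross, hder, hax⟩ := exists_crossing_chart hp hne
  let Q : ℤˣ → ℤˣ → Set (ℝ × ℝ) := fun σ τ =>
    Metric.ball 0 ε ∩ ({z | 0 < ((σ : ℤ) : ℝ) * z.1} ∩ {z | 0 < ((τ : ℤ) : ℝ) * z.2})
  have he0 : e 0 = D.curve i t := by simp [he]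
  have himage : ∀ z ∈ Metric.ball (0 : ℝ × ℝ) ε, e z ∈ D.image → z.1 = 0 ∨ z.2 = 0 := by
    intro z hz hzi
    obtain ⟨k, x, hx⟩ := Set.mem_iUnion.1 hzi
    rcases hax z hz k x hx with h | h
    · exact Or.inr h.1
    · exact Or.inl h.1
  have hreg : ∀ σ τ, ∃ R : D.Region, e '' Q σ τ ⊆ R.toSet := by
    intro σ τ
    apply exists_region_of_isPreconnected
    · exact (convex_quadrant ε _ _).isPreconnected.image _
        (e.continuousOn.mono (Set.inter_subset_left.trans hball))
    · refine Set.Nonempty.image _ ⟨(((σ : ℤ) : ℝ) * (ε / 2), ((τ : ℤ) : ℝ) * (ε / 2)), ?_, ?_, ?_⟩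
      · simp only [mem_ball_zero_iff, Prod.norm_def, Real.norm_eq_abs, abs_unitsInt_real_mul,
          abs_of_pos (half_pos hε), max_self]
        linarith
      · change 0 < ((σ : ℤ) : ℝ) * (((σ : ℤ) : ℝ) * (ε / 2))
        rw [← mul_assoc, unitsInt_real_mul_self]; linarith
      · change 0 < ((τ : ℤ) : ℝ) * (((τ : ℤ) : ℝ) * (ε / 2))
        rw [← mul_assoc, unitsInt_real_mul_self]; linarith
    · rintro _ ⟨z, ⟨hz, h1, h2⟩, rfl⟩ hzi
      change 0 < _ * z.1 at h1
      change 0 < _ * z.2 at h2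
      rcases himage z hz hzi with h | h
      · rw [h, mul_zero] at h1; exact lt_irrefl _ h1
      · rw [h, mul_zero] at h2; exact lt_irrefl _ h2
  choose reg hreg using hreg
  have hray : ∀ (z : ℝ × ℝ) (a b : ℝ) (σ τ : ℤˣ), z ∈ Metric.ball (0 : ℝ × ℝ) ε →
      (0 < ((σ : ℤ) : ℝ) * z.1 ∨ z.1 = 0 ∧ 0 < ((σ : ℤ) : ℝ) * a) →
      (0 < ((τ : ℤ) : ℝ) * z.2 ∨ z.2 = 0 ∧ 0 < ((τ : ℤ) : ℝ) * b) →
      (reg σ τ).Faces (e z) (a * deriv (D.curve i) (t + z.1) + b * deriv (D.curve j) (s + z.2)) := by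
    intro z a b σ τ hz h1 h2
    have hzs := hball hz
    have hd := hder z hzs a b
    filter_upwards [chart_ray_mem_target hzs, chart_ray_mem_open hzs hd Metric.isOpen_ball hz,
      chart_ray_fst_pos hzs hd h1, chart_ray_snd_pos hzs hd h2] with r k1 k2 k3 k4
    exact hreg σ τ ⟨_, ⟨k2, k3, k4⟩, e.right_inv k1⟩
  have hface : ∀ σ τ, (reg σ τ).Faces (D.curve i t) (((σ : ℤ) : ℂ) * deriv (D.curve i) t +
        ((τ : ℤ) : ℂ) * deriv (D.curve j) s) := by
    intro σ τ
    have := hray 0 ((σ : ℤ) : ℝ) ((τ : ℤ) : ℝ) σ τ (by simpa using hε)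
      (Or.inr ⟨rfl, by rw [unitsInt_real_mul_self]; exact one_pos⟩)
      (Or.inr ⟨rfl, by rw [unitsInt_real_mul_self]; exact one_pos⟩)
    simpa [he0] using this
  refine ⟨reg, hface, ⟨ε, hε, fun σ h h0 h1 => ?_⟩, fun R => ⟨fun hR => ?_, ?_⟩⟩
  · set x : ℝ := ((σ : ℤ) : ℝ) * h with hx
    have hxa : |x| < ε := by rw [hx, abs_unitsInt_real_mul, abs_of_pos h0]; exact h1
    have hσx : 0 < ((σ : ℤ) : ℝ) * x := by
      rw [hx, ← mul_assoc, unitsInt_real_mul_self, one_mul]; exact h0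
    have hx0 : x ≠ 0 := by rintro h; rw [h, mul_zero] at hσx; exact lt_irrefl _ hσx
    have hz : ((x, 0) : ℝ × ℝ) ∈ Metric.ball (0 : ℝ × ℝ) ε := by
      simpa [Prod.norm_def, hε] using hxa
    have hez : e (x, 0) = D.curve i (t + x) := by simp [he]
    refine ⟨isSimplePoint_pt_iff.2 fun k y hy => ?_, fun ρ => ?_⟩
    · rcases hax _ hz k y (hy.trans hez.symm) with h | h
      · exact h.2
      · exact absurd h.1 hx0
    · have hc : 0 < ((sg : ℤ) : ℝ) *
          planeCross (deriv (D.curve i) (t + x)) (deriv (D.curve j) s) := by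
        have := hcross _ (hball hz)
        simp only [add_zero] at this
        have h2 := mul_pos this hsg
        have h3 := hsg.ne'
        have h4 : planeCross (deriv (D.curve i) t) (deriv (D.curve j) s) ≠ 0 := right_ne_zero_of_mul h3
        have h5 : 0 < planeCross (deriv (D.curve i) t) (deriv (D.curve j) s) ^ 2 := by positivity
        nlinarith
      have hc0 := right_ne_zero_of_mul hc.ne'
      set w : ℂ := ((ρ : ℤ) : ℂ) * (Complex.I * deriv (D.curve i) (t + x)) with hw
      have hdec := planeFrame_decomposition hc0 w
      have hcw : planeCross (deriv (D.curve i) (t + x)) w = ((ρ : ℤ) : ℝ) *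
          planeCross (deriv (D.curve i) (t + x)) (Complex.I * deriv (D.curve i) (t + x)) := by
        rw [hw]; simp [planeCross]; ring
      -- The normal to the first strand is expanded in the frame of the two tangents. The base point
      -- lies on the axis, so the second coefficient alone selects the quadrant, and its sign is `ρ
      -- * sg`.
      have := hray (x, 0)
        (planeCross w (deriv (D.curve j) s) /
          planeCross (deriv (D.curve i) (t + x)) (deriv (D.curve j) s))
        (planeCross (deriv (D.curve i) (t + x)) w /
          planeCross (deriv (D.curve i) (t + x)) (deriv (D.curve j) s))
        σ (ρ * sg) hz (Or.inl hσx) (Or.inr ⟨rfl, ?_⟩)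
      · simp only [add_zero] at this
        rwa [← hdec, hez] at this
      · rw [hcw]
        have hpos := planeCross_I_mul_self_pos (D.deriv_curve_ne_zero i (t + x))
        set A := planeCross (deriv (D.curve i) (t + x)) (Complex.I * deriv (D.curve i) (t + x))
        set B := planeCross (deriv (D.curve i) (t + x)) (deriv (D.curve j) s)
        have : (((ρ * sg : ℤˣ) : ℤ) : ℝ) * (((ρ : ℤ) : ℝ) * A / B) =
            A * (((sg : ℤ) : ℝ) * B) / B ^ 2 * (((ρ : ℤ) : ℝ) * ((ρ : ℤ) : ℝ)) := by
          push_cast; field_simp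
        rw [this, unitsInt_real_mul_self, mul_one]
        have : 0 < B ^ 2 := by positivity
        positivity
  -- A region with the crossing in its closure meets the chart. It avoids both axes, hence meets a
  -- quadrant and is the region of that quadrant.
  · have hcl : D.curve i t ∈ closure R.toSet := frontier_subset_closure hR
    have hopen : IsOpen (e '' Metric.ball 0 ε) :=
      e.isOpen_image_of_subset_source Metric.isOpen_ball hball
    obtain ⟨_, ⟨z, hz, rfl⟩, hzR⟩ := mem_closure_iff.1 hcl _ hopen
      ⟨0, by simpa using hε, he0⟩
    have h1 : z.1 ≠ 0 := by
      intro h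
      refine R.subset_compl hzR ?_
      have : e z = D.curve j (s + z.2) := by rw [he, h, add_zero, hp]; ring
      rw [this]; exact curve_mem_image _ _
    have h2 : z.2 ≠ 0 := by
      intro h
      refine R.subset_compl hzR ?_
      have : e z = D.curve i (t + z.1) := by rw [he, h, add_zero]; ring
      rw [this]; exact curve_mem_image _ _
    obtain ⟨σ, hσ⟩ := exists_unitsInt_mul_pos h1
    obtain ⟨τ, hτ⟩ := exists_unitsInt_mul_pos h2
    exact ⟨σ, τ, Region.eq_of_mem hzR (hreg σ τ ⟨z, ⟨hz, hσ, hτ⟩, rfl⟩)⟩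
  · rintro ⟨σ, τ, rfl⟩
    exact ⟨(hface σ τ).mem_closure, fun h =>
      (reg σ τ).subset_compl (interior_subset h) (curve_mem_image _ _)⟩

/-- The two half-discs of an arc chart give regions that do not change along a short piece of the
arc. This makes side differences locally constant away from the crossings. -/
theorem exists_side_regions {i : Fin l} {t : ℝ} (hs : D.IsSimplePoint (D.pt i t)) :
    ∃ (reg : ℤˣ → D.Region) (ε : ℝ), 0 < ε ∧ ∀ h : ℝ, |h| < ε →
      D.IsSimplePoint (D.pt i (t + h)) ∧ ∀ ρ : ℤˣ,
        (reg ρ).Faces (D.curve i (t + h))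
          (((ρ : ℤ) : ℂ) * (Complex.I * deriv (D.curve i) (t + h))) := by
  obtain ⟨e, ε, hε, hball, he, hcross, hder, hax⟩ := exists_arc_chart hs
  let Q : ℤˣ → Set (ℝ × ℝ) := fun τ => Metric.ball 0 ε ∩ {z | 0 < ((τ : ℤ) : ℝ) * z.2}
  have hn0 : D.normalLine i t 0 = D.curve i t := by simp [normalLine]
  have hreg : ∀ τ, ∃ R : D.Region, e '' Q τ ⊆ R.toSet := by
    intro τ
    apply exists_region_of_isPreconnected
    · refine Convex.isPreconnected ?_ |>.image _
        (e.continuousOn.mono (Set.inter_subset_left.trans hball))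
      exact (convex_ball _ _).inter
        (convex_halfSpace_gt (((τ : ℤ) : ℝ) • LinearMap.snd ℝ ℝ ℝ).isLinear 0)
    · refine Set.Nonempty.image _ ⟨(0, ((τ : ℤ) : ℝ) * (ε / 2)), ?_, ?_⟩
      · simp only [mem_ball_zero_iff, Prod.norm_def, Real.norm_eq_abs, abs_unitsInt_real_mul,
          abs_of_pos (half_pos hε), abs_zero]
        exact max_lt hε (by linarith)
      · change 0 < ((τ : ℤ) : ℝ) * (((τ : ℤ) : ℝ) * (ε / 2))
        rw [← mul_assoc, unitsInt_real_mul_self]; linarith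
    · rintro _ ⟨z, ⟨hz, h2⟩, rfl⟩ hzi
      change 0 < _ * z.2 at h2
      obtain ⟨k, x, hx⟩ := Set.mem_iUnion.1 hzi
      rw [(hax z hz k x hx).1, mul_zero] at h2
      exact lt_irrefl _ h2
  choose reg hreg using hreg
  refine ⟨reg, ε, hε, fun h hh => ?_⟩
  have hz : ((h, 0) : ℝ × ℝ) ∈ Metric.ball (0 : ℝ × ℝ) ε := by
    simpa [Prod.norm_def, hε] using hh
  have hez : e (h, 0) = D.curve i (t + h) := by simp [he, hn0]
  refine ⟨isSimplePoint_pt_iff.2 fun k y hy => (hax _ hz k y (hy.trans hez.symm)).2, fun ρ => ?_⟩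
  have hzs := hball hz
  have hc := hcross _ hzs
  set w : ℂ := ((ρ : ℤ) : ℂ) * (Complex.I * deriv (D.curve i) (t + h)) with hw
  have hcw : planeCross (deriv (D.curve i) (t + h)) w = ((ρ : ℤ) : ℝ) *
      planeCross (deriv (D.curve i) (t + h)) (Complex.I * deriv (D.curve i) (t + h)) := by
    rw [hw]; simp [planeCross]; ring
  have hdec := planeFrame_decomposition hc.ne' w
  have hd := hder _ hzs
    (planeCross w (Complex.I * deriv (D.curve i) t) /
      planeCross (deriv (D.curve i) (t + h)) (Complex.I * deriv (D.curve i) t))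
    (planeCross (deriv (D.curve i) (t + h)) w /
      planeCross (deriv (D.curve i) (t + h)) (Complex.I * deriv (D.curve i) t))
  rw [← hdec] at hd
  have h2 := chart_ray_snd_pos hzs hd (τ := ((ρ : ℤ) : ℝ)) (Or.inr ⟨rfl, by
    have hpos := planeCross_I_mul_self_pos (D.deriv_curve_ne_zero i (t + h))
    simp only at hc
    rw [hcw, mul_div_assoc, ← mul_assoc, unitsInt_real_mul_self, one_mul]
    positivity⟩)
  filter_upwards [chart_ray_mem_target (v := w) hzs,
    chart_ray_mem_open hzs hd Metric.isOpen_ball hz, h2] with r k1 k2 k3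
  rw [← hez]
  exact hreg ρ ⟨_, ⟨k2, k3⟩, e.right_inv k1⟩

end LinkDiagram

/-! ### Cauchy integrals along plane curves -/

/-- The integral of `dz / (z - p)` along the curve. -/
noncomputable def cauchyKernelIntegral (γ : ℝ → ℂ) (a b : ℝ) (p : ℂ) : ℂ :=
  ∫ t in a..b, deriv γ t / (γ t - p)

section CauchyKernel

variable {γ : ℝ → ℂ} {a b : ℝ} {p : ℂ}

theorem continuousOn_cauchyKernel (hγ : ContDiff ℝ 1 γ) (hp : p ∉ γ '' Set.Icc a b) :
    ContinuousOn (fun t => deriv γ t / (γ t - p)) (Set.Icc a b) :=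
  (hγ.continuous_deriv le_rfl).continuousOn.div (hγ.continuous.sub continuous_const).continuousOn
    fun t ht h => hp ⟨t, ht, sub_eq_zero.1 h⟩

theorem intervalIntegrable_cauchyKernel (hγ : ContDiff ℝ 1 γ) (hab : a ≤ b)
    (hp : p ∉ γ '' Set.Icc a b) :
    IntervalIntegrable (fun t => deriv γ t / (γ t - p)) MeasureTheory.volume a b := by
  apply ContinuousOn.intervalIntegrable
  rw [Set.uIcc_of_le hab]
  exact continuousOn_cauchyKernel hγ hp

/-- The function `exp(-∫) * (γ - p)` has derivative zero, so it takes the same value at both ends.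
No branch of the logarithm is needed. -/
theorem exp_cauchyKernelIntegral (hγ : ContDiff ℝ 1 γ) (hab : a ≤ b) (hp : p ∉ γ '' Set.Icc a b) :
    Complex.exp (cauchyKernelIntegral γ a b p) = (γ b - p) / (γ a - p) := by
  have hne : ∀ t ∈ Set.Icc a b, γ t - p ≠ 0 := fun t ht h => hp ⟨t, ht, sub_eq_zero.1 h⟩
  -- The curve may pass through `p` outside `[a, b]`; the constant extension of the integrand is
  -- continuous on the whole line, so its primitive is differentiable also at the endpoints.
  let g : ℝ → ℂ := Set.IccExtend hab ((Set.Icc a b).domRestrict fun t => deriv γ t / (γ t - p))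
  have hg : Continuous g := (continuousOn_cauchyKernel hγ hp).domRestrict.Icc_extend'
  have hgt : ∀ t ∈ Set.Icc a b, g t = deriv γ t / (γ t - p) := fun t ht =>
    Set.IccExtend_of_mem hab _ ht
  have hG : ∀ x, HasDerivAt (fun u => ∫ t in a..u, g t) (g x) x := fun x =>
    (hg.integral_hasStrictDerivAt a x).hasDerivAt
  let F : ℝ → ℂ := fun x => Complex.exp (-∫ t in a..x, g t) * (γ x - p)
  have hF : ∀ x, HasDerivAt F (Complex.exp (-∫ t in a..x, g t) * (-g x) * (γ x - p) +
      Complex.exp (-∫ t in a..x, g t) * deriv γ x) x := fun x =>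
    ((hG x).neg.cexp).mul (((hγ.differentiable one_ne_zero) x).hasDerivAt.sub_const p)
  have hconst := constant_of_has_deriv_right_zero (f := F) (a := a) (b := b)
    (fun x _ => (hF x).continuousAt.continuousWithinAt) (fun x hx => by
      have hx' := Set.Ico_subset_Icc_self hx
      have h0 : Complex.exp (-∫ t in a..x, g t) * (-g x) * (γ x - p) +
          Complex.exp (-∫ t in a..x, g t) * deriv γ x = 0 := by
        rw [hgt x hx']
        have := hne x hx'
        field_simp
        ring
      have := hF x
      rw [h0] at this
      exact this.hasDerivWithinAt)
  have hb := hconst b ⟨hab, le_rfl⟩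
  have hint : cauchyKernelIntegral γ a b p = ∫ t in a..b, g t :=
    intervalIntegral.integral_congr fun t ht => by
      rw [Set.uIcc_of_le hab] at ht
      exact (hgt t ht).symm
  simp only [F, intervalIntegral.integral_same, Complex.exp_zero, one_mul, inv_one,
    Complex.exp_neg] at hb
  rw [hint, eq_div_iff (hne a ⟨le_rfl, hab⟩), ← hb, ← mul_assoc,
    mul_inv_cancel₀ (Complex.exp_ne_zero _), one_mul]

theorem continuousAt_cauchyKernelIntegral (hγ : ContDiff ℝ 1 γ) (hab : a ≤ b)
    (hp : p ∉ γ '' Set.Icc a b) : ContinuousAt (cauchyKernelIntegral γ a b) p := by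
  have hK : IsCompact (γ '' Set.Icc a b) := isCompact_Icc.image hγ.continuous
  obtain ⟨δ, hδ, hball⟩ := Metric.isOpen_iff.1 hK.isClosed.isOpen_compl p hp
  have hcd : Continuous (deriv γ) := hγ.continuous_deriv le_rfl
  obtain ⟨M, hM⟩ := (isCompact_Icc (a := a) (b := b)).exists_bound_of_continuousOn hcd.continuousOn
  have hM0 : 0 ≤ M := (norm_nonneg _).trans (hM a ⟨le_rfl, hab⟩)
  have hIoc : ∀ t ∈ Set.uIoc a b, t ∈ Set.Icc a b := fun t ht => by
    rw [Set.uIoc_of_le hab] at ht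
    exact Set.Ioc_subset_Icc_self ht
  refine intervalIntegral.continuousAt_of_dominated_interval (bound := fun _ => M / (δ / 2))
    ?_ ?_ intervalIntegrable_const ?_
  · filter_upwards [Metric.ball_mem_nhds p hδ] with q hq
    exact (intervalIntegrable_cauchyKernel hγ hab (hball hq)).def'.aestronglyMeasurable
  · filter_upwards [Metric.ball_mem_nhds p (half_pos hδ)] with q hq
    refine Filter.Eventually.of_forall fun t ht => ?_
    have ht' := hIoc t ht
    rw [norm_div]
    refine div_le_div₀ hM0 (hM t ht') (half_pos hδ) ?_
    by_contra! hlt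
    have : γ t ∈ Metric.ball p δ := by
      rw [Metric.mem_ball] at hq ⊢
      rw [← dist_eq_norm] at hlt
      have := dist_triangle (γ t) q p
      linarith
    exact hball this ⟨t, ht', rfl⟩
  · refine Filter.Eventually.of_forall fun t ht => ?_
    refine continuousAt_const.div (continuousAt_const.sub continuousAt_id) fun h => ?_
    exact hp ⟨t, hIoc t ht, sub_eq_zero.1 h⟩

end CauchyKernel

/-! ### The jump of the Cauchy integral across a curve -/

section Jump

variable {γ : ℝ → ℂ} {t₀ : ℝ}

/-- The derivative of the normalised chord is `1` at `t₀`, so its real part is strictly increasing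
nearby. -/
theorem exists_re_chord_pos (hγ : ContDiff ℝ 1 γ) (h0 : deriv γ t₀ ≠ 0) :
    ∃ δ > 0, ∀ t, |t - t₀| < δ → (t₀ < t → 0 < ((γ t - γ t₀) / deriv γ t₀).re) ∧
      (t < t₀ → ((γ t - γ t₀) / deriv γ t₀).re < 0) := by
  have hcd : Continuous (deriv γ) := hγ.continuous_deriv le_rfl
  have hc : Continuous fun t => (deriv γ t / deriv γ t₀).re :=
    Complex.continuous_re.comp (hcd.div_const _)
  have hpos : 0 < (deriv γ t₀ / deriv γ t₀).re := by rw [div_self h0]; simp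
  obtain ⟨δ, hδ, hball⟩ := Metric.mem_nhds_iff.1 (hc.continuousAt.eventually (lt_mem_nhds hpos))
  have hd : ∀ t, HasDerivAt (fun t => ((γ t - γ t₀) / deriv γ t₀).re)
      (deriv γ t / deriv γ t₀).re t := fun t => by
    have h1 : HasDerivAt (fun t => (γ t - γ t₀) / deriv γ t₀) (deriv γ t / deriv γ t₀) t :=
      ((hγ.differentiable one_ne_zero t).hasDerivAt.sub_const _).div_const _
    exact Complex.reCLM.hasFDerivAt.comp_hasDerivAt t h1
  have hmono : StrictMonoOn (fun t => ((γ t - γ t₀) / deriv γ t₀).re) (Metric.ball t₀ δ) := by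
    refine strictMonoOn_of_deriv_pos (convex_ball _ _)
      (fun t _ => (hd t).continuousAt.continuousWithinAt) fun t ht => ?_
    rw [(hd t).deriv]
    exact hball (interior_subset ht)
  refine ⟨δ, hδ, fun t ht => ⟨fun hlt => ?_, fun hlt => ?_⟩⟩
  · simpa using hmono (Metric.mem_ball_self hδ) (show t ∈ Metric.ball t₀ δ from ht) hlt
  · simpa using hmono (show t ∈ Metric.ball t₀ δ from ht) (Metric.mem_ball_self hδ) hlt

theorem log_I_mul_sub_log_neg_I_mul {B : ℂ} (hB : 0 < B.re) :
    Complex.log (Complex.I * B) - Complex.log (-(Complex.I * B)) = Real.pi * Complex.I := by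
  have him : 0 < (Complex.I * B).im := by simpa using hB
  rw [Complex.log, Complex.log, norm_neg, Complex.arg_neg_eq_arg_sub_pi_of_im_pos him]
  push_cast
  ring

/-- Dividing `γ t - p` by the constant `-c * γ'(t₀)` leaves a quantity with nonzero imaginary part,
except at `t₀` where it equals `r > 0`. It therefore stays in the slit plane, and the principal
logarithm is a primitive of the kernel. -/
theorem cauchyKernelIntegral_eq_log (hγ : ContDiff ℝ 1 γ) (h0 : deriv γ t₀ ≠ 0) {δ : ℝ}
    (hδ : 0 < δ) (hre : ∀ t, |t - t₀| ≤ δ → (t₀ < t → 0 < ((γ t - γ t₀) / deriv γ t₀).re) ∧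
      (t < t₀ → ((γ t - γ t₀) / deriv γ t₀).re < 0)) {c : ℂ} (hc : c = Complex.I ∨ c = -Complex.I)
    {r : ℝ} (hr : 0 < r) :
    cauchyKernelIntegral γ (t₀ - δ) (t₀ + δ) (γ t₀ + r * (c * deriv γ t₀)) =
      Complex.log (-c⁻¹ * ((γ (t₀ + δ) - γ t₀) / deriv γ t₀) + r) -
      Complex.log (-c⁻¹ * ((γ (t₀ - δ) - γ t₀) / deriv γ t₀) + r) := by
  have hc0 : c ≠ 0 := by rcases hc with rfl | rfl <;> simp
  have hicc : ∀ t ∈ Set.Icc (t₀ - δ) (t₀ + δ), |t - t₀| ≤ δ := fun t ht => by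
    rw [abs_le]; constructor <;> linarith [ht.1, ht.2]
  have hslit : ∀ t ∈ Set.Icc (t₀ - δ) (t₀ + δ),
      -c⁻¹ * ((γ t - γ t₀) / deriv γ t₀) + r ∈ Complex.slitPlane := by
    intro t ht
    rw [Complex.mem_slitPlane_iff]
    rcases eq_or_ne t t₀ with rfl | hne
    · left; simpa using hr
    · right
      have : ((γ t - γ t₀) / deriv γ t₀).re ≠ 0 := by
        rcases lt_or_gt_of_ne hne with h | h
        · exact ((hre t (hicc t ht)).2 h).ne
        · exact ((hre t (hicc t ht)).1 h).ne'
      set q := (γ t - γ t₀) / deriv γ t₀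
      rcases hc with rfl | rfl <;> simpa using this
  have hden : ∀ t, γ t - (γ t₀ + r * (c * deriv γ t₀)) =
      -c * deriv γ t₀ * (-c⁻¹ * ((γ t - γ t₀) / deriv γ t₀) + r) := by
    intro t; field_simp; ring
  have hle : t₀ - δ ≤ t₀ + δ := by linarith
  refine intervalIntegral.integral_eq_sub_of_hasDerivAt
    (f := fun t => Complex.log (-c⁻¹ * ((γ t - γ t₀) / deriv γ t₀) + r)) (fun t ht => ?_) ?_
  · rw [Set.uIcc_of_le hle] at ht
    have h1 : HasDerivAt (fun t => -c⁻¹ * ((γ t - γ t₀) / deriv γ t₀) + r)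
        (-c⁻¹ * (deriv γ t / deriv γ t₀)) t :=
      ((((hγ.differentiable one_ne_zero t).hasDerivAt.sub_const _).div_const _).const_mul _).add_const _
    have h2 := h1.clog_real (hslit t ht)
    refine h2.congr_deriv ?_
    rw [hden]
    have h3 := Complex.slitPlane_ne_zero (hslit t ht)
    set X := -c⁻¹ * ((γ t - γ t₀) / deriv γ t₀) + (r : ℂ)
    field_simp
  · refine intervalIntegrable_cauchyKernel hγ hle ?_
    rintro ⟨t, ht, h⟩
    have := hden t
    rw [sub_eq_zero.2 h] at this
    exact mul_ne_zero (mul_ne_zero (neg_ne_zero.2 hc0) h0)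
      (Complex.slitPlane_ne_zero (hslit t ht)) this.symm

/-- By the logarithm formula on either side of the curve, the limit is a difference of logarithms of
opposite numbers at each end of the short arc. Each end contributes `πi`. -/
theorem tendsto_cauchyKernelIntegral_jump (hγ : ContDiff ℝ 1 γ) (h0 : deriv γ t₀ ≠ 0) :
    ∃ δ₀ > 0, ∀ δ, 0 < δ → δ < δ₀ → Filter.Tendsto (fun r : ℝ =>
      cauchyKernelIntegral γ (t₀ - δ) (t₀ + δ) (γ t₀ + r * (Complex.I * deriv γ t₀)) -
      cauchyKernelIntegral γ (t₀ - δ) (t₀ + δ) (γ t₀ - r * (Complex.I * deriv γ t₀)))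
      (𝓝[>] 0) (𝓝 (2 * Real.pi * Complex.I)) := by
  obtain ⟨δ₀, hδ₀, hre⟩ := exists_re_chord_pos hγ h0
  refine ⟨δ₀, hδ₀, fun δ hδ hlt => ?_⟩
  have hre' : ∀ t, |t - t₀| ≤ δ → (t₀ < t → 0 < ((γ t - γ t₀) / deriv γ t₀).re) ∧
      (t < t₀ → ((γ t - γ t₀) / deriv γ t₀).re < 0) := fun t ht => hre t (ht.trans_lt hlt)
  set B := (γ (t₀ + δ) - γ t₀) / deriv γ t₀ with hBdef
  set A := (γ (t₀ - δ) - γ t₀) / deriv γ t₀ with hAdef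
  have hB : 0 < B.re := (hre' _ (by simp [abs_of_pos hδ])).1 (by linarith)
  have hA : A.re < 0 := (hre' _ (by simp [abs_of_pos hδ])).2 (by linarith)
  have hmain : Filter.Tendsto (fun r : ℝ =>
      (Complex.log (Complex.I * B + r) - Complex.log (Complex.I * A + r)) -
      (Complex.log (-(Complex.I * B) + r) - Complex.log (-(Complex.I * A) + r)))
      (𝓝[>] 0) (𝓝 (2 * Real.pi * Complex.I)) := by
    have hlog : ∀ X : ℂ, X.im ≠ 0 →
        Filter.Tendsto (fun r : ℝ => Complex.log (X + r)) (𝓝[>] 0) (𝓝 (Complex.log X)) := by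
      intro X hX
      have hs : X + ((0 : ℝ) : ℂ) ∈ Complex.slitPlane := by
        rw [Complex.mem_slitPlane_iff]; right; simpa using hX
      have hc : ContinuousAt (fun r : ℝ => Complex.log (X + r)) 0 :=
        ContinuousAt.clog (by fun_prop) hs
      have := hc.tendsto
      simp only [Complex.ofReal_zero, add_zero] at this
      exact this.mono_left nhdsWithin_le_nhds
    have e1 := log_I_mul_sub_log_neg_I_mul hB
    have e2 := log_I_mul_sub_log_neg_I_mul (B := -A) (by simpa using hA)
    rw [mul_neg, neg_neg] at e2
    have := ((hlog (Complex.I * B) (by simpa using hB.ne')).sub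
      (hlog (Complex.I * A) (by simpa using hA.ne))).sub
      ((hlog (-(Complex.I * B)) (by simpa using hB.ne')).sub
      (hlog (-(Complex.I * A)) (by simpa using hA.ne)))
    have e3 : Complex.log (Complex.I * B) - Complex.log (Complex.I * A) -
        (Complex.log (-(Complex.I * B)) - Complex.log (-(Complex.I * A))) =
        2 * Real.pi * Complex.I := by
      linear_combination e1 + e2
    rwa [e3] at this
  refine hmain.congr' ?_
  filter_upwards [self_mem_nhdsWithin] with r hr
  have hr : 0 < r := hr
  have h1 := cauchyKernelIntegral_eq_log hγ h0 hδ hre' (Or.inl rfl) hr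
  have h2 := cauchyKernelIntegral_eq_log hγ h0 hδ hre' (Or.inr rfl) hr
  have h3 : γ t₀ + (r : ℂ) * (-Complex.I * deriv γ t₀) = γ t₀ - r * (Complex.I * deriv γ t₀) := by
    ring
  rw [h3] at h2
  rw [h1, h2, ← hBdef, ← hAdef]
  simp [Complex.inv_I]

end Jump

namespace LinkDiagram

variable {l : ℕ}

/-! ### Winding numbers of cycles made of arcs of the diagram -/

/-- An arc of a component, running at most once around it. -/
structure Arc (l : ℕ) where
  comp : Fin l
  start : ℝ
  finish : ℝ
  start_lt : start < finish
  finish_le : finish ≤ start + 1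

namespace Arc

variable (D : LinkDiagram l) (A : Arc l)

/-- The projection of the arc. -/
def track : Set ℂ := D.curve A.comp '' Set.Icc A.start A.finish

open Classical in
/-- The number of times that the arc passes through a point in its interior. -/
noncomputable def mult (j : Fin l) (t : ℝ) : ℤ :=
  if A.comp = j ∧ ∃ n : ℤ, A.start < t + n ∧ t + n < A.finish then 1 else 0

/-- The integral of `dz / (z - p)` along the arc. -/
noncomputable def kernelIntegral (p : ℂ) : ℂ :=
  cauchyKernelIntegral (D.curve A.comp) A.start A.finish p

theorem track_subset_image : A.track D ⊆ D.image := by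
  rintro _ ⟨t, -, rfl⟩
  exact curve_mem_image _ _

variable {D A}

/-- Only a short piece of the arc around the point jumps. The integral over the remaining pieces is
continuous there, because a simple point is visited by a single parameter of the arc. -/
theorem tendsto_kernelIntegral_jump {j : Fin l} {t : ℝ} (hs : D.IsSimplePoint (D.pt j t))
    (h1 : D.pt A.comp A.start ≠ D.pt j t) (h2 : D.pt A.comp A.finish ≠ D.pt j t)
    (hoff : ∀ᶠ r : ℝ in 𝓝[>] 0,
      D.curve j t + (r : ℂ) * (Complex.I * deriv (D.curve j) t) ∉ D.image ∧
      D.curve j t - (r : ℂ) * (Complex.I * deriv (D.curve j) t) ∉ D.image) :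
    Filter.Tendsto (fun r : ℝ =>
      A.kernelIntegral D (D.curve j t + (r : ℂ) * (Complex.I * deriv (D.curve j) t)) -
      A.kernelIntegral D (D.curve j t - (r : ℂ) * (Complex.I * deriv (D.curve j) t)))
      (𝓝[>] 0) (𝓝 ((A.mult j t : ℂ) * (2 * Real.pi * Complex.I))) := by
  have hcont : ∀ a b : ℝ, a ≤ b → D.curve j t ∉ D.curve A.comp '' Set.Icc a b →
      Filter.Tendsto (fun r : ℝ =>
        cauchyKernelIntegral (D.curve A.comp) a b
          (D.curve j t + (r : ℂ) * (Complex.I * deriv (D.curve j) t)) -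
        cauchyKernelIntegral (D.curve A.comp) a b
          (D.curve j t - (r : ℂ) * (Complex.I * deriv (D.curve j) t)))
        (𝓝[>] 0) (𝓝 0) := by
    intro a b hab hn
    have hc := (continuousAt_cauchyKernelIntegral (D.contDiff_one A.comp) hab hn).tendsto
    have k1 : Filter.Tendsto
        (fun r : ℝ => D.curve j t + (r : ℂ) * (Complex.I * deriv (D.curve j) t)) (𝓝[>] 0)
        (𝓝 (D.curve j t)) := by
      have : Continuous
        fun r : ℝ => D.curve j t + (r : ℂ) * (Complex.I * deriv (D.curve j) t) := by fun_prop
      simpa using (this.tendsto 0).mono_left nhdsWithin_le_nhds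
    have k2 : Filter.Tendsto
        (fun r : ℝ => D.curve j t - (r : ℂ) * (Complex.I * deriv (D.curve j) t)) (𝓝[>] 0)
        (𝓝 (D.curve j t)) := by
      have : Continuous
        fun r : ℝ => D.curve j t - (r : ℂ) * (Complex.I * deriv (D.curve j) t) := by fun_prop
      simpa using (this.tendsto 0).mono_left nhdsWithin_le_nhds
    simpa using (hc.comp k1).sub (hc.comp k2)
  have hs' := isSimplePoint_pt_iff.1 hs
  by_cases hm : A.comp = j ∧ ∃ n : ℤ, A.start < t + n ∧ t + n < A.finish
  · obtain ⟨hj, n, hn1, hn2⟩ := id hm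
    have hpt : D.pt j t = D.pt A.comp (t + n) := by rw [hj, pt_add_int]
    have hcurve : D.curve j t = D.curve A.comp (t + n) := curve_eq_of_pt_eq hpt
    have hder : deriv (D.curve j) t = deriv (D.curve A.comp) (t + n) := by
      rw [← tangent_pt, hpt, tangent_pt]
    set s : ℝ := t + n with hsdef
    obtain ⟨δ₀, hδ₀, hjump⟩ := tendsto_cauchyKernelIntegral_jump (D.contDiff_one A.comp)
      (D.deriv_curve_ne_zero A.comp s)
    obtain ⟨δ, hδ, hδlt⟩ : ∃ δ > 0, δ < min δ₀ (min (s - A.start) (A.finish - s)) :=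
      exists_between (lt_min hδ₀ (lt_min (by linarith) (by linarith)))
    rw [lt_min_iff, lt_min_iff] at hδlt
    obtain ⟨hd0, hd1, hd2⟩ := hδlt
    have hle := A.finish_le
    -- Two parameters of the same point differ by an integer. One of them is interior to an interval
    -- of length at most one, so that integer is zero.
    have huniq : ∀ x ∈ Set.Icc A.start A.finish, D.curve A.comp x = D.curve j t → x = s := by
      intro x hx hxe
      obtain ⟨-, k, hk⟩ := pt_eq_iff.1 ((hs' _ _ hxe).trans hpt)
      have a1 : (k : ℝ) < 1 := by linarith [hx.2]
      have a2 : (-1 : ℝ) < k := by linarith [hx.1]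
      have b1 : k < 1 := by exact_mod_cast a1
      have b2 : -1 < k := by exact_mod_cast a2
      have : k = 0 := by omega
      rw [hk, this]; simp
    have t1 := hcont A.start (s - δ) (by linarith) (by
      rintro ⟨x, hx, hxe⟩
      have := huniq x ⟨hx.1, by linarith [hx.2]⟩ hxe
      linarith [hx.2])
    have t3 := hcont (s + δ) A.finish (by linarith) (by
      rintro ⟨x, hx, hxe⟩
      have := huniq x ⟨by linarith [hx.1], hx.2⟩ hxe
      linarith [hx.1])
    have t2 := hjump δ hδ hd0
    rw [← hcurve, ← hder] at t2
    have hsum := (t1.add t2).add t3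
    have hmult : A.mult j t = 1 := if_pos hm
    rw [hmult]
    simp only [zero_add, add_zero] at hsum
    simp only [Int.cast_one, one_mul]
    refine hsum.congr' ?_
    have hsplit : ∀ p : ℂ, p ∉ D.image → A.kernelIntegral D p =
        cauchyKernelIntegral (D.curve A.comp) A.start (s - δ) p +
        cauchyKernelIntegral (D.curve A.comp) (s - δ) (s + δ) p +
        cauchyKernelIntegral (D.curve A.comp) (s + δ) A.finish p := by
      intro p hp
      have hi : ∀ a b : ℝ, a ≤ b → IntervalIntegrable
          (fun t => deriv (D.curve A.comp) t / (D.curve A.comp t - p)) MeasureTheory.volume a b :=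
        fun a b hab => intervalIntegrable_cauchyKernel (D.contDiff_one _) hab (by
          rintro ⟨x, -, rfl⟩; exact hp (curve_mem_image _ _))
      unfold kernelIntegral cauchyKernelIntegral
      rw [intervalIntegral.integral_add_adjacent_intervals (hi _ _ (by linarith))
        (hi _ _ (by linarith)), intervalIntegral.integral_add_adjacent_intervals
        (hi _ _ (by linarith)) (hi _ _ (by linarith))]
    filter_upwards [hoff] with r hr
    rw [hsplit _ hr.1, hsplit _ hr.2]
    ring
  · have hmult : A.mult j t = 0 := if_neg hm
    rw [hmult]
    simp only [Int.cast_zero, zero_mul]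
    refine hcont A.start A.finish A.start_lt.le ?_
    rintro ⟨x, hx, hxe⟩
    have hxp := hs' _ _ hxe
    obtain ⟨hj, k, hk⟩ := pt_eq_iff.1 hxp
    rcases eq_or_lt_of_le hx.1 with h | h
    · exact h1 (h ▸ hxp)
    · rcases eq_or_lt_of_le hx.2 with h' | h'
      · exact h2 (h' ▸ hxp)
      · exact hm ⟨hj, k, hk ▸ h, hk ▸ h'⟩

end Arc

/-- The arcs form a closed cycle. -/
def IsCycle (D : LinkDiagram l) (Z : List (Arc l)) : Prop :=
  ∀ p : ℂ, (∀ A ∈ Z, p ∉ A.track D) →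
    (Z.map fun A => (D.curve A.comp A.finish - p) / (D.curve A.comp A.start - p)).prod = 1

/-- The integral of `dz / (z - p)` along the cycle. -/
noncomputable def cycleIntegral (D : LinkDiagram l) (Z : List (Arc l)) (p : ℂ) : ℂ :=
  (Z.map fun A => A.kernelIntegral D p).sum

/-- The winding number of a cycle about a point, extended by rounding. -/
noncomputable def winding (D : LinkDiagram l) (Z : List (Arc l)) (p : ℂ) : ℤ :=
  round (D.cycleIntegral Z p / (2 * Real.pi * Complex.I)).re

/-- The winding number of a cycle about the points of a region. -/
noncomputable def regionWinding (D : LinkDiagram l) (Z : List (Arc l)) (R : D.Region) : ℤ :=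
  D.winding Z R.2.choose

variable {D : LinkDiagram l} {Z : List (Arc l)}

/-- The product condition in `IsCycle` says exactly that the exponential of the integral is `1`. The
integral is then in `2πiℤ`, and rounding loses nothing. -/
theorem two_pi_I_mul_winding (hZ : D.IsCycle Z) {p : ℂ} (hp : ∀ A ∈ Z, p ∉ A.track D) :
    (D.winding Z p : ℂ) * (2 * Real.pi * Complex.I) = D.cycleIntegral Z p := by
  have h1 : Complex.exp (D.cycleIntegral Z p) = 1 := by
    rw [← hZ p hp, cycleIntegral, Complex.exp_list_sum, List.map_map]
    congr 1
    refine List.map_congr_left fun A hA => ?_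
    exact exp_cauchyKernelIntegral (D.contDiff_one _) A.start_lt.le (hp A hA)
  obtain ⟨n, hn⟩ := Complex.exp_eq_one_iff.1 h1
  have h2 : D.winding Z p = n := by
    rw [winding, hn, mul_div_cancel_right₀ _ Complex.two_pi_I_ne_zero, Complex.intCast_re,
      round_intCast]
  rw [h2, hn]

theorem continuousAt_cycleIntegral {p : ℂ} (hp : ∀ A ∈ Z, p ∉ A.track D) :
    ContinuousAt (D.cycleIntegral Z) p := by
  induction Z with
  | nil => exact continuousAt_const
  | cons A Z ih =>
    have h1 : ContinuousAt (A.kernelIntegral D) p :=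
      continuousAt_cauchyKernelIntegral (D.contDiff_one _) A.start_lt.le (hp A (by simp))
    have h2 := ih fun B hB => hp B (by simp [hB])
    exact h1.add h2

theorem winding_eq_of_isPreconnected (hZ : D.IsCycle Z) {S : Set ℂ} (hS : IsPreconnected S)
    (hoff : ∀ p ∈ S, ∀ A ∈ Z, p ∉ A.track D) {p q : ℂ} (hp : p ∈ S) (hq : q ∈ S) :
    D.winding Z p = D.winding Z q := by
  refine hS.constant ?_ hp hq
  rw [Int.isClosedEmbedding_coe_real.isInducing.continuousOn_iff]
  have h1 : ContinuousOn (fun p => (D.cycleIntegral Z p / (2 * Real.pi * Complex.I)).re) S :=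
    fun p hp => (Complex.continuous_re.continuousAt.comp
      ((continuousAt_cycleIntegral (hoff p hp)).div_const _)).continuousWithinAt
  refine h1.congr fun p hp => ?_
  simp only [Function.comp_apply]
  rw [← two_pi_I_mul_winding hZ (hoff p hp), mul_div_cancel_right₀ _ Complex.two_pi_I_ne_zero,
    Complex.intCast_re]

/-- Adding a closure point to a region keeps it preconnected. Hence a region can be compared with
points of the diagram that the cycle avoids, such as crossings. -/
theorem winding_eq_regionWinding (hZ : D.IsCycle Z) {R : D.Region} {p : ℂ}
    (hp : p ∈ closure R.toSet) (hoff : ∀ A ∈ Z, p ∉ A.track D) :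
    D.winding Z p = D.regionWinding Z R := by
  have hR : R.2.choose ∈ R.toSet := by
    obtain ⟨h1, h2⟩ := R.2.choose_spec
    have h3 := mem_connectedComponentIn h1
    rw [← h2] at h3
    exact h3
  refine winding_eq_of_isPreconnected hZ (S := insert p R.toSet) ?_ ?_ (Set.mem_insert _ _)
    (Set.mem_insert_of_mem _ hR)
  · exact R.isPreconnected.subset_closure (Set.subset_insert _ _)
      (Set.insert_subset hp subset_closure)
  · rintro q (rfl | hq) A hA
    · exact hoff A hA
    · exact fun h => R.subset_compl hq (A.track_subset_image D h)

/-- The number of times that the cycle passes through a point of the link. -/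
noncomputable def cycleMult (Z : List (Arc l)) (j : Fin l) (t : ℝ) : ℤ :=
  (Z.map fun A => A.mult j t).sum

/-- The difference of the integrals on the two sides is eventually constant and tends to the sum of
the jumps of the arcs; the two limits agree. -/
theorem regionWinding_sub (hZ : D.IsCycle Z) {j : Fin l} {t : ℝ}
    (hs : D.IsSimplePoint (D.pt j t))
    (h1 : ∀ A ∈ Z, D.pt A.comp A.start ≠ D.pt j t) (h2 : ∀ A ∈ Z, D.pt A.comp A.finish ≠ D.pt j t)
    {R R' : D.Region} (hR : R.Faces (D.curve j t) (Complex.I * deriv (D.curve j) t))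
    (hR' : R'.Faces (D.curve j t) (-(Complex.I * deriv (D.curve j) t))) :
    D.regionWinding Z R - D.regionWinding Z R' = cycleMult Z j t := by
  set v := Complex.I * deriv (D.curve j) t with hv
  have hR'' : ∀ᶠ r : ℝ in 𝓝[>] 0, D.curve j t - (r : ℂ) * v ∈ R'.toSet := by
    filter_upwards [hR'] with r hr
    rwa [mul_neg, ← sub_eq_add_neg] at hr
  have hoff : ∀ᶠ r : ℝ in 𝓝[>] 0,
      D.curve j t + (r : ℂ) * v ∉ D.image ∧ D.curve j t - (r : ℂ) * v ∉ D.image := by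
    filter_upwards [hR, hR''] with r h1 h2
    exact ⟨R.subset_compl h1, R'.subset_compl h2⟩
  have hlim : Filter.Tendsto (fun r : ℝ => D.cycleIntegral Z (D.curve j t + (r : ℂ) * v) -
      D.cycleIntegral Z (D.curve j t - (r : ℂ) * v))
      (𝓝[>] 0) (𝓝 ((cycleMult Z j t : ℂ) * (2 * Real.pi * Complex.I))) := by
    -- A tail of a cycle need not be a cycle, so the induction over the arcs has to forget this
    -- hypothesis.
    clear hZ
    induction Z with
    | nil => simp [cycleIntegral, cycleMult]
    | cons A Z ih =>
      have k1 := Arc.tendsto_kernelIntegral_jump hs (h1 A (by simp)) (h2 A (by simp)) hoff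
      have k2 := ih (fun B hB => h1 B (by simp [hB])) (fun B hB => h2 B (by simp [hB]))
      have k3 := k1.add k2
      rw [← add_mul] at k3
      have : ((cycleMult (A :: Z) j t : ℤ) : ℂ) = (A.mult j t : ℂ) + (cycleMult Z j t : ℂ) := by
        simp [cycleMult]
      rw [this]
      refine k3.congr fun r => ?_
      simp only [cycleIntegral, List.map_cons, List.sum_cons]
      ring
  have hconst : Filter.Tendsto (fun r : ℝ => D.cycleIntegral Z (D.curve j t + (r : ℂ) * v) -
      D.cycleIntegral Z (D.curve j t - (r : ℂ) * v)) (𝓝[>] 0)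
      (𝓝 (((D.regionWinding Z R - D.regionWinding Z R' : ℤ) : ℂ) *
        (2 * Real.pi * Complex.I))) := by
    refine tendsto_const_nhds.congr' ?_
    have key : ∀ (R : D.Region) p, p ∈ R.toSet → D.cycleIntegral Z p =
        (D.regionWinding Z R : ℂ) * (2 * Real.pi * Complex.I) := by
      intro R p hp
      have ho : ∀ A ∈ Z, p ∉ A.track D := fun A _ h =>
        R.subset_compl hp (A.track_subset_image D h)
      rw [← two_pi_I_mul_winding hZ ho, winding_eq_regionWinding hZ (subset_closure hp) ho]
    filter_upwards [hR, hR''] with r k1 k2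
    rw [key R _ k1, key R' _ k2]
    push_cast
    ring
  have := tendsto_nhds_unique hconst hlim
  exact_mod_cast mul_right_cancel₀ Complex.two_pi_I_ne_zero this

end LinkDiagram

namespace LinkDiagram

variable {l : ℕ} {D : LinkDiagram l}

/-! ### The corners at a crossing -/

namespace Crossing

/-- The point of the link on the overpass (`true`) or on the underpass (`false`). -/
def strand (c : D.Crossing) (b : Bool) : CirclePoint l := bif b then c.overPt else c.underPt

open Classical in
/-- The sign of the crossing as a unit. -/
noncomputable def eps (c : D.Crossing) : ℤˣ :=
  if 0 < planeCross (D.tangent c.overPt) (D.tangent c.underPt) then 1 else -1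

/-- The sign with which the other strand crosses the given one. -/
noncomputable def strandEps (c : D.Crossing) (b : Bool) : ℤˣ := bif b then c.eps else -c.eps

variable (c : D.Crossing)

theorem sign_eq_eps : c.sign = c.eps := by
  unfold sign eps
  split_ifs <;> rfl

theorem overPt_ne_underPt : c.overPt ≠ c.underPt := fun h => by
  have := c.ht_lt
  rw [h] at this
  exact lt_irrefl _ this

theorem strand_ne (b : Bool) : c.strand b ≠ c.strand !b := by
  cases b
  · exact c.overPt_ne_underPt.symm
  · exact c.overPt_ne_underPt

theorem pos_strand (b : Bool) : D.pos (c.strand b) = c.point := by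
  cases b
  · exact c.pos_eq.symm
  · rfl

theorem cross_ne_zero : planeCross (D.tangent c.overPt) (D.tangent c.underPt) ≠ 0 :=
  D.transverse _ _ c.overPt_ne_underPt c.pos_eq

theorem eps_mul_cross_pos :
    0 < ((c.eps : ℤ) : ℝ) * planeCross (D.tangent c.overPt) (D.tangent c.underPt) := by
  unfold eps
  split_ifs with h
  · simpa using h
  · have := lt_of_le_of_ne (not_lt.1 h) c.cross_ne_zero
    simpa using this

theorem strandEps_mul_cross_pos (b : Bool) : 0 < ((c.strandEps b : ℤ) : ℝ) *
    planeCross (D.tangent (c.strand b)) (D.tangent (c.strand !b)) := by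
  have := c.eps_mul_cross_pos
  cases b
  · simp only [strandEps, strand, cond_false, cond_true, Bool.not_false, Units.val_neg,
      Int.cast_neg]
    unfold planeCross at *
    linarith
  · exact this

theorem exists_strand_regions (b : Bool) :
    ∃ reg : ℤˣ → ℤˣ → D.Region,
      (∀ σ τ, (reg σ τ).Faces c.point (((σ : ℤ) : ℂ) * D.tangent (c.strand b) +
        ((τ : ℤ) : ℂ) * D.tangent (c.strand !b))) ∧
      (∃ ε > 0, ∀ (σ : ℤˣ) (h : ℝ), 0 < h → h < ε →
        D.IsSimplePoint (D.pt (c.strand b).1 ((c.strand b).2 + (σ : ℤ) * h)) ∧ ∀ ρ : ℤˣ,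
        (reg σ (ρ * c.strandEps b)).Faces (D.curve (c.strand b).1 ((c.strand b).2 + (σ : ℤ) * h))
          (((ρ : ℤ) : ℂ) * (Complex.I *
            deriv (D.curve (c.strand b).1) ((c.strand b).2 + (σ : ℤ) * h)))) ∧
      ∀ R : D.Region, c.point ∈ frontier R.toSet ↔ ∃ σ τ, R = reg σ τ := by
  have hp : D.curve (c.strand b).1 (c.strand b).2 = D.curve (c.strand !b).1 (c.strand !b).2 :=
    (c.pos_strand b).trans (c.pos_strand !b).symm
  have h := exists_corner_regions (i := (c.strand b).1) (j := (c.strand !b).1)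
    (t := (c.strand b).2) (s := (c.strand !b).2) hp (by
      rw [pt_coe, pt_coe]; exact c.strand_ne b) (c.strandEps_mul_cross_pos b)
  have hpt : D.curve (c.strand b).1 (c.strand b).2 = c.point := c.pos_strand b
  rw [hpt] at h
  exact h

/-- The region at a corner, given by the signs of the half-tangents of the overpass and of the
underpass. -/
noncomputable def corner (σ τ : ℤˣ) : D.Region := (c.exists_strand_regions true).choose σ τ

/-- The region at a corner, given by the signs of the half-tangents of a strand and of the other
strand. -/
noncomputable def strandCorner (b : Bool) (σ τ : ℤˣ) : D.Region :=
  bif b then c.corner σ τ else c.corner τ σ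

theorem corner_faces (σ τ : ℤˣ) : (c.corner σ τ).Faces c.point
    (((σ : ℤ) : ℂ) * D.tangent c.overPt + ((τ : ℤ) : ℂ) * D.tangent c.underPt) :=
  (c.exists_strand_regions true).choose_spec.1 σ τ

theorem touchesAt_iff {R : D.Region} {κ : Corner} :
    c.TouchesAt R κ ↔ R = c.corner κ.1 κ.2 := by
  constructor
  · intro h
    exact Region.Faces.unique (d := c.cornerDir κ) h (c.corner_faces κ.1 κ.2)
  · rintro rfl
    exact c.corner_faces κ.1 κ.2

theorem point_mem_frontier_iff {R : D.Region} :
    c.point ∈ frontier R.toSet ↔ ∃ κ : Corner, R = c.corner κ.1 κ.2 := by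
  rw [(c.exists_strand_regions true).choose_spec.2.2 R, Prod.exists]
  rfl

theorem corner_mem_closure (σ τ : ℤˣ) : c.point ∈ closure (c.corner σ τ).toSet :=
  (c.corner_faces σ τ).mem_closure

/-- The charts built from the two orderings of the strands name the same regions, since a ray faces
at most one region. So one family of corners serves both strands. -/
theorem exists_strandCorner_faces (b : Bool) :
    ∃ ε > 0, ∀ (σ : ℤˣ) (h : ℝ), 0 < h → h < ε →
      D.IsSimplePoint (D.pt (c.strand b).1 ((c.strand b).2 + (σ : ℤ) * h)) ∧ ∀ ρ : ℤˣ,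
      (c.strandCorner b σ (ρ * c.strandEps b)).Faces
        (D.curve (c.strand b).1 ((c.strand b).2 + (σ : ℤ) * h))
        (((ρ : ℤ) : ℂ) * (Complex.I *
          deriv (D.curve (c.strand b).1) ((c.strand b).2 + (σ : ℤ) * h))) := by
  obtain ⟨reg, h1, h2, -⟩ := c.exists_strand_regions b
  have : reg = c.strandCorner b := by
    funext σ τ
    refine (h1 σ τ).unique ?_
    cases b
    · have := c.corner_faces τ σ
      rw [add_comm] at this
      exact this
    · exact c.corner_faces σ τ
  rw [← this]
  exact h2

end Crossing

theorem exists_strand_eq {s : CirclePoint l} (hs : ¬ D.IsSimplePoint s) :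
    ∃ (c : D.Crossing) (b : Bool), c.strand b = s := by
  unfold IsSimplePoint at hs
  push Not at hs
  obtain ⟨t, hpos, hne⟩ := hs
  rcases lt_trichotomy (D.ht t) (D.ht s) with h | h | h
  · exact ⟨⟨s, t, hpos.symm, h⟩, true, rfl⟩
  · exact absurd (D.embedded t s hpos h) hne
  · exact ⟨⟨t, s, hpos, h⟩, false, rfl⟩

theorem Crossing.not_isSimplePoint_strand (c : D.Crossing) (b : Bool) :
    ¬ D.IsSimplePoint (c.strand b) := fun h =>
  c.strand_ne b (h _ ((c.pos_strand !b).trans (c.pos_strand b).symm)).symm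

theorem Crossing.eq_strand_of_pos_eq (c : D.Crossing) {s : CirclePoint l}
    (h : D.pos s = c.point) : s = c.overPt ∨ s = c.underPt := by
  rcases D.no_triple_pt h c.pos_eq with h | h | h
  · exact Or.inl h
  · exact absurd h c.overPt_ne_underPt
  · exact Or.inr h

theorem Crossing.eq_of_point_eq {c c' : D.Crossing} (h : c.point = c'.point) : c = c' := by
  have h1 : c.overPt = c'.overPt ∨ c.overPt = c'.underPt := c'.eq_strand_of_pos_eq h
  have h2 : c.underPt = c'.overPt ∨ c.underPt = c'.underPt :=
    c'.eq_strand_of_pos_eq (c.pos_eq.symm.trans h)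
  have h3 := c.overPt_ne_underPt
  have h4 := c.ht_lt
  have h5 := c'.ht_lt
  rcases c with ⟨o, u, p, q⟩
  rcases c' with ⟨o', u', p', q'⟩
  simp only at h1 h2 h3 h4 h5
  rcases h1 with rfl | rfl <;> rcases h2 with rfl | rfl
  · exact absurd rfl h3
  · rfl
  · exact absurd h4 h5.not_gt
  · exact absurd rfl h3

theorem Crossing.strand_injective {c c' : D.Crossing} {b b' : Bool}
    (h : c.strand b = c'.strand b') : c = c' ∧ b = b' := by
  have hc : c = c' := Crossing.eq_of_point_eq (by rw [← c.pos_strand b, h, c'.pos_strand])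
  subst hc
  refine ⟨rfl, ?_⟩
  by_contra hb
  have : b' = !b := by cases b <;> cases b' <;> simp_all
  exact c.strand_ne b (this ▸ h)

/-! ### Multiplicities of cycles on the sides of a crossing -/

namespace Arc

open Classical in
/-- The number of times that the arc passes through the points just after (`1`) or just before
(`-1`) a given one. -/
noncomputable def multDir (A : Arc l) (j : Fin l) (t : ℝ) (σ : ℤˣ) : ℤ :=
  if A.comp = j ∧ ∃ n : ℤ, if σ = 1 then A.start ≤ t + n ∧ t + n < A.finish
    else A.start < t + n ∧ t + n ≤ A.finish then 1 else 0

theorem int_eq_of_abs_sub_lt_one {m n : ℤ} {t : ℝ} {x y a : ℝ} (hx : a ≤ x ∧ x ≤ a + 1)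
    (hy : a ≤ y ∧ y ≤ a + 1) (hne : ¬ (x = a ∧ y = a + 1) ∧ ¬ (x = a + 1 ∧ y = a))
    (hm : x = t + m) (hn : y = t + n) : m = n := by
  have h : |x - y| < 1 := by
    rw [abs_lt]
    constructor
    · by_contra! hcon
      exact hne.1 ⟨by linarith, by linarith⟩
    · by_contra! hcon
      exact hne.2 ⟨by linarith, by linarith⟩
  have h2 : |((m - n : ℤ) : ℝ)| < 1 := by
    have : ((m - n : ℤ) : ℝ) = x - y := by push_cast; linarith
    rwa [this]
  have h3 : |m - n| < 1 := by exact_mod_cast h2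
  have := Int.abs_lt_one_iff.1 h3
  omega

theorem exists_int_mem_Ico (a t : ℝ) : ∃ n : ℤ, a ≤ t + n ∧ t + n < a + 1 := by
  obtain ⟨n, hn, -⟩ := existsUnique_add_zsmul_mem_Ico (zero_lt_one' ℝ) t a
  exact ⟨n, by simpa using hn⟩

theorem exists_int_mem_Ioc (a t : ℝ) : ∃ n : ℤ, a < t + n ∧ t + n ≤ a + 1 := by
  obtain ⟨n, hn, -⟩ := existsUnique_add_zsmul_mem_Ioc (zero_lt_one' ℝ) t a
  exact ⟨n, by simpa using hn⟩

variable (A : Arc l)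

theorem after_iff {t : ℝ} {n : ℤ} (h1 : A.start ≤ t + n) (h2 : t + n < A.start + 1) :
    (∃ k : ℤ, A.start ≤ t + k ∧ t + k < A.finish) ↔ t + n < A.finish := by
  refine ⟨fun ⟨k, hk1, hk2⟩ => ?_, fun h => ⟨n, h1, h⟩⟩
  have := A.finish_le
  have hk : k = n := int_eq_of_abs_sub_lt_one (a := A.start) (t := t) ⟨hk1, by linarith⟩
    ⟨h1, h2.le⟩ ⟨fun h => by linarith [h.2], fun h => by linarith [h.1]⟩ rfl rfl
  rwa [← hk]

theorem before_iff {t : ℝ} {n : ℤ} (h1 : A.start < t + n) (h2 : t + n ≤ A.start + 1) :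
    (∃ k : ℤ, A.start < t + k ∧ t + k ≤ A.finish) ↔ t + n ≤ A.finish := by
  refine ⟨fun ⟨k, hk1, hk2⟩ => ?_, fun h => ⟨n, h1, h⟩⟩
  have := A.finish_le
  have hk : k = n := int_eq_of_abs_sub_lt_one (a := A.start) (t := t) ⟨hk1.le, by linarith⟩
    ⟨h1.le, h2⟩ ⟨fun h => by linarith [h.1], fun h => by linarith [h.2]⟩ rfl rfl
  rwa [← hk]

theorem inside_iff {t : ℝ} {n : ℤ} (h1 : A.start < t + n) (h2 : t + n < A.start + 1) :
    (∃ k : ℤ, A.start < t + k ∧ t + k < A.finish) ↔ t + n < A.finish := by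
  refine ⟨fun ⟨k, hk1, hk2⟩ => (A.after_iff h1.le h2).1 ⟨k, hk1.le, hk2⟩, fun h => ⟨n, h1, h⟩⟩

theorem eventually_mult_eq (j : Fin l) (t : ℝ) (σ : ℤˣ) :
    ∀ᶠ h : ℝ in 𝓝[>] 0, A.mult j (t + (σ : ℤ) * h) = A.multDir j t σ := by
  have hsmall : ∀ x : ℝ, 0 < x → ∀ᶠ h : ℝ in 𝓝[>] 0, h < x := fun x hx =>
    (gt_mem_nhds hx).filter_mono nhdsWithin_le_nhds
  unfold mult multDir
  rcases Int.units_eq_one_or σ with rfl | rfl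
  · obtain ⟨n, h1, h2⟩ := exists_int_mem_Ico A.start t
    simp only [if_true, A.after_iff h1 h2]
    have hev : ∀ᶠ h : ℝ in 𝓝[>] 0, (t + h + n < A.finish ↔ t + n < A.finish) := by
      by_cases hlt : t + n < A.finish
      · filter_upwards [hsmall _ (sub_pos.2 hlt)] with h hh
        exact ⟨fun _ => hlt, fun _ => by linarith⟩
      · filter_upwards [self_mem_nhdsWithin] with h hh
        have hh : 0 < h := hh
        exact ⟨fun h' => by linarith, fun h' => absurd h' hlt⟩
    filter_upwards [hev, hsmall _ (sub_pos.2 h2), self_mem_nhdsWithin] with h hh1 hh2 hh3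
    have hh3 : 0 < h := hh3
    have e : t + (((1 : ℤˣ) : ℤ) : ℝ) * h = t + h := by simp
    rw [e, A.inside_iff (t := t + h) (n := n) (by linarith) (by linarith), hh1]
  · obtain ⟨n, h1, h2⟩ := exists_int_mem_Ioc A.start t
    have hne : (-1 : ℤˣ) ≠ 1 := by decide
    simp only [hne, if_false, A.before_iff h1 h2]
    have hev : ∀ᶠ h : ℝ in 𝓝[>] 0, (t + -h + n < A.finish ↔ t + n ≤ A.finish) := by
      by_cases hlt : t + n ≤ A.finish
      · filter_upwards [self_mem_nhdsWithin] with h hh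
        have hh : 0 < h := hh
        exact ⟨fun _ => hlt, fun _ => by linarith⟩
      · rw [not_le] at hlt
        filter_upwards [hsmall _ (sub_pos.2 hlt)] with h hh
        exact ⟨fun h' => by linarith, fun h' => by linarith⟩
    filter_upwards [hev, hsmall _ (sub_pos.2 h1), self_mem_nhdsWithin] with h hh1 hh2 hh3
    have hh3 : 0 < h := hh3
    have e : t + (((-1 : ℤˣ) : ℤ) : ℝ) * h = t + -h := by simp
    rw [e, A.inside_iff (t := t + -h) (n := n) (by linarith) (by linarith), hh1]

-- Passing a point along the component, an arc is lost exactly if it ends there and gained exactly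
-- if it starts there. For a full turn both happen at once and cancel.
open Classical in
theorem multDir_sub (D : LinkDiagram l) (j : Fin l) (t : ℝ) :
    A.multDir j t (-1) - A.multDir j t 1 =
      (if D.pt j t = D.pt A.comp A.finish then 1 else 0) -
      (if D.pt j t = D.pt A.comp A.start then 1 else 0) := by
  have hne : (-1 : ℤˣ) ≠ 1 := by decide
  have hlt := A.start_lt
  have hle := A.finish_le
  unfold multDir
  by_cases hj : A.comp = j
  swap
  · simp [hj, pt_eq_iff, Ne.symm hj]
  obtain ⟨n, h1, h2⟩ := exists_int_mem_Ico A.start t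
  simp only [hj, true_and, if_true, A.after_iff h1 h2, hne, if_false, pt_eq_iff]
  -- At the starting point the representative for the half-open interval on the other side is
  -- shifted by one, and it lies on the arc only if the arc is a full turn.
  rcases eq_or_lt_of_le h1 with h0 | h0
  · rw [A.before_iff (t := t) (n := n + 1) (by push_cast; linarith) (by push_cast; linarith)]
    have e1 : t + n < A.finish := by linarith
    have e2 : ∃ m : ℤ, t = A.start + m := ⟨-n, by push_cast; linarith⟩
    have e3 : t + (n + 1 : ℤ) ≤ A.finish ↔ ∃ m : ℤ, t = A.finish + m := by
      constructor
      · intro h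
        push_cast at h
        exact ⟨-(n + 1), by push_cast; linarith⟩
      · rintro ⟨m, hm⟩
        have : n + 1 = -m := int_eq_of_abs_sub_lt_one (a := A.start) (t := t)
          (x := t + (n + 1 : ℤ)) (y := A.finish) (by push_cast; constructor <;> linarith)
          ⟨hlt.le, hle⟩ ⟨fun h => by have := h.1; push_cast at this; linarith,
            fun h => by linarith [h.2]⟩ rfl (by push_cast; linarith)
        rw [this]; push_cast; linarith
    simp only [e1, e2, e3, if_true]
  · rw [A.before_iff h0 h2.le]
    have e2 : ¬ ∃ m : ℤ, t = A.start + m := by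
      rintro ⟨m, hm⟩
      have : n = -m := int_eq_of_abs_sub_lt_one (a := A.start) (t := t)
          (x := t + n) (y := A.start) ⟨h1, h2.le⟩ ⟨le_rfl, by linarith⟩
          ⟨fun h => by linarith [h.2], fun h => by linarith [h.1]⟩ rfl (by push_cast; linarith)
      rw [this] at h0; push_cast at h0; linarith
    have e3 : t + n = A.finish ↔ ∃ m : ℤ, t = A.finish + m := by
      constructor
      · intro h
        exact ⟨-n, by push_cast; linarith⟩
      · rintro ⟨m, hm⟩
        have : n = -m := int_eq_of_abs_sub_lt_one (a := A.start) (t := t)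
          (x := t + n) (y := A.finish) ⟨h1, h2.le⟩ ⟨hlt.le, hle⟩
          ⟨fun h => by linarith [h.1], fun h => by linarith [h.1]⟩ rfl (by push_cast; linarith)
        rw [this]; push_cast; linarith
    simp only [e2, ← e3, if_false]
    rcases lt_trichotomy (t + n) A.finish with h | h | h
    · simp [h, h.le, h.ne]
    · simp [h]
    · simp [h.not_gt, h.not_ge, h.ne']

end Arc

/-- The number of times that the cycle passes through the points just after (`1`) or just before
(`-1`) a given one. -/
noncomputable def cycleMultDir (Z : List (Arc l)) (j : Fin l) (t : ℝ) (σ : ℤˣ) : ℤ :=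
  (Z.map fun A => A.multDir j t σ).sum

theorem eventually_cycleMult_eq (Z : List (Arc l)) (j : Fin l) (t : ℝ) (σ : ℤˣ) :
    ∀ᶠ h : ℝ in 𝓝[>] 0, cycleMult Z j (t + (σ : ℤ) * h) = cycleMultDir Z j t σ := by
  induction Z with
  | nil => exact Filter.Eventually.of_forall fun _ => rfl
  | cons A Z ih =>
    filter_upwards [ih, A.eventually_mult_eq j t σ] with h h1 h2
    simp only [cycleMult, cycleMultDir, List.map_cons, List.sum_cons] at *
    rw [h1, h2]

/-- The arcs of the list start and end at crossings. -/
def EndsAtCrossings (D : LinkDiagram l) (Z : List (Arc l)) : Prop :=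
  ∀ A ∈ Z, ¬ D.IsSimplePoint (D.pt A.comp A.start) ∧ ¬ D.IsSimplePoint (D.pt A.comp A.finish)

theorem regionWinding_sub_of_faces {Z : List (Arc l)} (hZ : D.IsCycle Z)
    (hE : D.EndsAtCrossings Z) {j : Fin l} {t : ℝ} (hs : D.IsSimplePoint (D.pt j t))
    {R R' : D.Region} (hR : R.Faces (D.curve j t) (Complex.I * deriv (D.curve j) t))
    (hR' : R'.Faces (D.curve j t) (-(Complex.I * deriv (D.curve j) t))) :
    D.regionWinding Z R - D.regionWinding Z R' = cycleMult Z j t :=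
  regionWinding_sub hZ hs (fun A hA h => (hE A hA).1 (h ▸ hs)) (fun A hA h => (hE A hA).2 (h ▸ hs))
    hR hR'

/-- The two corners along a half-strand are the regions on the left and on the right of nearby
simple points of that strand, where the jump formula applies. -/
theorem regionWinding_strandCorner_sub {Z : List (Arc l)} (hZ : D.IsCycle Z)
    (hE : D.EndsAtCrossings Z) (c : D.Crossing) (b : Bool) (σ : ℤˣ) :
    D.regionWinding Z (c.strandCorner b σ (c.strandEps b)) -
      D.regionWinding Z (c.strandCorner b σ (-c.strandEps b)) =
      cycleMultDir Z (c.strand b).1 (c.strand b).2 σ := by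
  obtain ⟨ε, hε, hf⟩ := c.exists_strandCorner_faces b
  obtain ⟨h, ⟨h1, h2⟩, h3⟩ := (((eventually_cycleMult_eq Z (c.strand b).1 (c.strand b).2 σ).and
    ((gt_mem_nhds hε).filter_mono nhdsWithin_le_nhds)).and
    (self_mem_nhdsWithin (s := Set.Ioi (0 : ℝ)))).exists
  obtain ⟨k1, k2⟩ := hf σ h h3 h2
  rw [← h1]
  refine regionWinding_sub_of_faces hZ hE k1 ?_ ?_
  · have := k2 1
    simpa using this
  · have := k2 (-1)
    simpa using this

end LinkDiagram

/-! ### Periodic step functions -/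

-- The left limit minus the jumps already passed is a continuous integer-valued function on `[0,
-- 1]`, hence constant. Its values at the ends are compared by periodicity. Using left limits makes
-- the values of `g` at the jump points irrelevant.
open Classical in
theorem sum_jumps_eq_zero {ι : Type*} [Fintype ι] {g : ℝ → ℤ} (hg : Function.Periodic g 1)
    {J : ℝ → ℤ}
    (hJ : ∀ t, ∃ x, (∀ᶠ s in 𝓝[<] t, g s = x) ∧ ∀ᶠ s in 𝓝[>] t, g s = x + J t)
    (τ : ι → ℝ) (hτ : ∀ k, τ k ∈ Set.Ico (0 : ℝ) 1) (jump : ι → ℤ)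
    (hsum : ∀ t ∈ Set.Ico (0 : ℝ) 1, J t = ∑ k with τ k = t, jump k) : ∑ k, jump k = 0 := by
  choose gl hl hr using hJ
  have hper : gl 1 = gl 0 := by
    have h0 : Filter.Tendsto (fun s : ℝ => s - 1) (𝓝[<] 1) (𝓝[<] 0) := by
      refine tendsto_nhdsWithin_of_tendsto_nhds_of_eventually_within _ ?_ ?_
      · have : Continuous fun s : ℝ => s - 1 := by fun_prop
        simpa using (this.tendsto 1).mono_left nhdsWithin_le_nhds
      · filter_upwards [self_mem_nhdsWithin] with s hs
        have hs : s < 1 := hs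
        exact sub_neg.2 hs
    obtain ⟨s, h1, h2⟩ := ((hl 1).and (h0.eventually (hl 0))).exists
    rw [← h1, ← h2, hg.sub_eq]
  have hleft : ∀ t, ∀ᶠ s in 𝓝[<] t, gl s = gl t := by
    intro t
    obtain ⟨a, ha, hat⟩ := (mem_nhdsLT_iff_exists_Ioo_subset).1 (hl t)
    filter_upwards [Ioo_mem_nhdsLT ha] with s hs
    obtain ⟨r, h1, h2⟩ := ((hl s).and (Ioo_mem_nhdsLT hs.1)).exists
    rw [← h1]
    exact hat ⟨h2.1, h2.2.trans hs.2⟩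
  have hright : ∀ t, ∀ᶠ s in 𝓝[>] t, gl s = gl t + J t := by
    intro t
    obtain ⟨b, hb, hbt⟩ := (mem_nhdsGT_iff_exists_Ioo_subset).1 (hr t)
    filter_upwards [Ioo_mem_nhdsGT hb] with s hs
    obtain ⟨r, h1, h2⟩ := ((hl s).and (Ioo_mem_nhdsLT hs.1)).exists
    rw [← h1]
    exact hbt ⟨h2.1, h2.2.trans hs.2⟩
  let F : ℝ → ℤ := fun t => gl t - ∑ k with τ k < t, jump k
  have hF : ContinuousOn F (Set.Icc 0 1) := by
    intro t ht
    rw [ContinuousWithinAt, nhds_discrete, Filter.tendsto_pure]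
    have hL : ∀ᶠ s in 𝓝[<] t, F s = F t := by
      have : ∀ᶠ s in 𝓝[<] t, ∀ k, (τ k < s ↔ τ k < t) := by
        rw [Filter.eventually_all]
        intro k
        by_cases hk : τ k < t
        · filter_upwards [Ioo_mem_nhdsLT hk] with s hs
          exact ⟨fun _ => hk, fun _ => hs.1⟩
        · filter_upwards [self_mem_nhdsWithin] with s hs
          have hs : s < t := hs
          exact ⟨fun h => h.trans hs, fun h => absurd h hk⟩
      filter_upwards [this, hleft t] with s h1 h2
      simp only [F, h1, h2]
    rcases eq_or_lt_of_le ht.2 with rfl | hlt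
    · have hsub : 𝓝[Set.Icc 0 1] (1 : ℝ) ≤ 𝓝[≤] 1 := nhdsWithin_mono _ fun s hs => hs.2
      refine Filter.Eventually.filter_mono hsub ?_
      rw [← Set.Iio_insert (a := (1 : ℝ)), nhdsWithin_insert, Filter.eventually_sup]
      exact ⟨Filter.eventually_pure.2 rfl, hL⟩
    · have hR : ∀ᶠ s in 𝓝[>] t, F s = F t := by
        have : ∀ᶠ s in 𝓝[>] t, ∀ k, (τ k < s ↔ τ k < t ∨ τ k = t) := by
          rw [Filter.eventually_all]
          intro k
          by_cases hk : t < τ k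
          · filter_upwards [Ioo_mem_nhdsGT hk] with s hs
            constructor
            · intro h; exact absurd h hs.2.not_gt
            · rintro (h | h) <;> linarith
          · filter_upwards [self_mem_nhdsWithin] with s hs
            have hs : t < s := hs
            exact ⟨fun _ => lt_or_eq_of_le (not_lt.1 hk), fun _ => (not_lt.1 hk).trans_lt hs⟩
        filter_upwards [this, hright t] with s h1 h2
        simp only [F, h1, h2, hsum t ⟨ht.1, hlt⟩]
        rw [Finset.filter_or, Finset.sum_union]
        · ring
        · rw [Finset.disjoint_filter]
          intro k _ h h'
          exact h.ne h'
      refine Filter.Eventually.filter_mono nhdsWithin_le_nhds ?_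
      rw [← nhdsLT_sup_nhdsGE, Filter.eventually_sup]
      refine ⟨hL, ?_⟩
      rw [← Set.Ioi_insert, nhdsWithin_insert, Filter.eventually_sup]
      exact ⟨Filter.eventually_pure.2 rfl, hR⟩
  have h01 := isPreconnected_Icc.constant hF (Set.left_mem_Icc.2 zero_le_one)
    (Set.right_mem_Icc.2 zero_le_one)
  have e0 : (Finset.univ.filter fun k => τ k < 0) = ∅ :=
    Finset.filter_false_of_mem fun k _ => not_lt.2 (hτ k).1
  have e1 : (Finset.univ.filter fun k => τ k < 1) = Finset.univ :=
    Finset.filter_true_of_mem fun k _ => (hτ k).2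
  simp only [F, e0, e1, hper, Finset.sum_empty] at h01
  linarith

namespace LinkDiagram

variable {l : ℕ} {D : LinkDiagram l}

/-! ### Sums over the crossings along a component -/

open Classical in
/-- The difference of the values of a function at the regions faced in opposite directions. -/
noncomputable def faceDiff (u : D.Region → ℤ) (p d : ℂ) : ℤ :=
  if h : ∃ P : D.Region × D.Region, P.1.Faces p d ∧ P.2.Faces p (-d)
  then u h.choose.1 - u h.choose.2 else 0

/-- The difference of the values of a function at the left and at the right region along a
component. -/
noncomputable def sideDiff (u : D.Region → ℤ) (i : Fin l) (t : ℝ) : ℤ :=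
  faceDiff u (D.curve i t) (Complex.I * D.tangent (D.pt i t))

theorem sideDiff_eq (u : D.Region → ℤ) {i : Fin l} {t : ℝ} {R R' : D.Region}
    (hR : R.Faces (D.curve i t) (Complex.I * deriv (D.curve i) t))
    (hR' : R'.Faces (D.curve i t) (-(Complex.I * deriv (D.curve i) t))) :
    sideDiff u i t = u R - u R' := by
  rw [← tangent_pt] at hR hR'
  have h : ∃ P : D.Region × D.Region,
      P.1.Faces (D.curve i t) (Complex.I * D.tangent (D.pt i t)) ∧
      P.2.Faces (D.curve i t) (-(Complex.I * D.tangent (D.pt i t))) := ⟨(R, R'), hR, hR'⟩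
  rw [sideDiff, faceDiff, dif_pos h, h.choose_spec.1.unique hR, h.choose_spec.2.unique hR']

theorem sideDiff_congr (u : D.Region → ℤ) {i j : Fin l} {t s : ℝ} (h : D.pt i t = D.pt j s) :
    sideDiff u i t = sideDiff u j s := by
  rw [sideDiff, sideDiff, curve_eq_of_pt_eq h, h]

/-- The change of the side difference when passing a crossing on one of its strands. -/
noncomputable def Crossing.strandJump (c : D.Crossing) (b : Bool) (u : D.Region → ℤ) : ℤ :=
  (u (c.strandCorner b 1 (c.strandEps b)) - u (c.strandCorner b 1 (-c.strandEps b))) -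
  (u (c.strandCorner b (-1) (c.strandEps b)) - u (c.strandCorner b (-1) (-c.strandEps b)))

theorem eventually_nhdsGT_of_add {P : ℝ → Prop} {t : ℝ} (h : ∀ᶠ x : ℝ in 𝓝[>] 0, P (t + x)) :
    ∀ᶠ s in 𝓝[>] t, P s := by
  have h0 : Filter.Tendsto (fun s : ℝ => s - t) (𝓝[>] t) (𝓝[>] 0) := by
    refine tendsto_nhdsWithin_of_tendsto_nhds_of_eventually_within _ ?_ ?_
    · have : Continuous fun s : ℝ => s - t := by fun_prop
      simpa using (this.tendsto t).mono_left nhdsWithin_le_nhds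
    · filter_upwards [self_mem_nhdsWithin] with s hs
      exact Set.mem_Ioi.2 (sub_pos.2 hs)
  filter_upwards [h0.eventually h] with s hs
  simpa using hs

theorem eventually_nhdsLT_of_sub {P : ℝ → Prop} {t : ℝ} (h : ∀ᶠ x : ℝ in 𝓝[>] 0, P (t - x)) :
    ∀ᶠ s in 𝓝[<] t, P s := by
  have h0 : Filter.Tendsto (fun s : ℝ => t - s) (𝓝[<] t) (𝓝[>] 0) := by
    refine tendsto_nhdsWithin_of_tendsto_nhds_of_eventually_within _ ?_ ?_
    · have : Continuous fun s : ℝ => t - s := by fun_prop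
      simpa using (this.tendsto t).mono_left nhdsWithin_le_nhds
    · filter_upwards [self_mem_nhdsWithin] with s hs
      exact Set.mem_Ioi.2 (sub_pos.2 hs)
  filter_upwards [h0.eventually h] with s hs
  simpa using hs

theorem Crossing.eventually_sideDiff (c : D.Crossing) (b : Bool) (u : D.Region → ℤ) (σ : ℤˣ) :
    ∀ᶠ h : ℝ in 𝓝[>] 0, sideDiff u (c.strand b).1 ((c.strand b).2 + (σ : ℤ) * h) =
      u (c.strandCorner b σ (c.strandEps b)) - u (c.strandCorner b σ (-c.strandEps b)) := by
  obtain ⟨ε, hε, hf⟩ := c.exists_strandCorner_faces b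
  filter_upwards [(gt_mem_nhds hε).filter_mono nhdsWithin_le_nhds, self_mem_nhdsWithin]
    with h h1 h2
  have k2 := (hf σ h h2 h1).2
  apply sideDiff_eq
  · simpa using k2 1
  · simpa using k2 (-1)

-- The step function is the left value minus the right value along the component. It is locally
-- constant at simple points, and at other points it changes by the jump of the unique strand there.
open Classical in
theorem sum_strandJump_eq_zero [Fintype D.Crossing] (i : Fin l) (u : D.Region → ℤ) :
    ∑ k : D.Crossing × Bool with (k.1.strand k.2).1 = i, k.1.strandJump k.2 u = 0 := by
  rw [← Finset.sum_coe_sort]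
  set S := Finset.univ.filter fun k : D.Crossing × Bool => (k.1.strand k.2).1 = i with hS
  let J : ℝ → ℤ := fun t =>
    if h : ∃ k : D.Crossing × Bool, k.1.strand k.2 = D.pt i t then
      h.choose.1.strandJump h.choose.2 u else 0
  have hJval : ∀ t (c : D.Crossing) b, c.strand b = D.pt i t → J t = c.strandJump b u := by
    intro t c b hcb
    have h : ∃ k : D.Crossing × Bool, k.1.strand k.2 = D.pt i t := ⟨(c, b), hcb⟩
    have h2 := Crossing.strand_injective (h.choose_spec.trans hcb.symm)
    simp only [J, dif_pos h]
    rw [h2.1, h2.2]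
  refine sum_jumps_eq_zero (g := sideDiff u i) (J := J)
    (fun t => sideDiff_congr u (pt_add_one i t)) (fun t => ?_)
    (fun k : S => ((k.1.1.strand k.1.2).2 : ℝ)) (fun k => (k.1.1.strand k.1.2).2.2)
    (fun k => k.1.1.strandJump k.1.2 u) (fun t ht => ?_)
  · by_cases hs : D.IsSimplePoint (D.pt i t)
    · obtain ⟨reg, ε, hε, hreg⟩ := exists_side_regions hs
      have hJ0 : J t = 0 := by
        refine dif_neg ?_
        rintro ⟨k, hk⟩
        exact k.1.not_isSimplePoint_strand k.2 (hk ▸ hs)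
      have hval : ∀ h : ℝ, |h| < ε → sideDiff u i (t + h) = u (reg 1) - u (reg (-1)) := by
        intro h hh
        have k2 := (hreg h hh).2
        apply sideDiff_eq
        · simpa using k2 1
        · simpa using k2 (-1)
      have hsmall : ∀ᶠ x : ℝ in 𝓝[>] 0, x < ε ∧ 0 < x :=
        ((gt_mem_nhds hε).filter_mono nhdsWithin_le_nhds).and self_mem_nhdsWithin
      refine ⟨u (reg 1) - u (reg (-1)), eventually_nhdsLT_of_sub ?_, eventually_nhdsGT_of_add ?_⟩
      · filter_upwards [hsmall] with x hx
        rw [sub_eq_add_neg, hval]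
        rw [abs_neg, abs_of_pos hx.2]; exact hx.1
      · filter_upwards [hsmall] with x hx
        rw [hJ0, add_zero, hval]
        rw [abs_of_pos hx.2]; exact hx.1
    · obtain ⟨c, b, hcb⟩ := exists_strand_eq hs
      have hpt : D.pt (c.strand b).1 (c.strand b).2 = D.pt i t := by rw [pt_coe, hcb]
      have hsd : ∀ x : ℝ, sideDiff u i (t + x) =
          sideDiff u (c.strand b).1 ((c.strand b).2 + x) := fun x =>
        sideDiff_congr u (pt_add_eq hpt x).symm
      refine ⟨u (c.strandCorner b (-1) (c.strandEps b)) -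
        u (c.strandCorner b (-1) (-c.strandEps b)), eventually_nhdsLT_of_sub ?_,
        eventually_nhdsGT_of_add ?_⟩
      · filter_upwards [c.eventually_sideDiff b u (-1)] with x hx
        rw [sub_eq_add_neg, hsd, ← hx]
        simp
      · filter_upwards [c.eventually_sideDiff b u 1] with x hx
        rw [hsd, hJval t c b hcb, Crossing.strandJump, add_sub_cancel, ← hx]
        simp
  · by_cases h : ∃ k : D.Crossing × Bool, k.1.strand k.2 = D.pt i t
    · obtain ⟨⟨c, b⟩, hcb⟩ := h
      simp only at hcb
      have ht' : D.pt i t = (i, ⟨t, ht⟩) := pt_coe (D := D) (i, ⟨t, ht⟩)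
      rw [hJval t c b hcb]
      symm
      have hmem : ((c, b) : D.Crossing × Bool) ∈
          S := by
        simp [hS, hcb, pt]
      rw [Finset.sum_eq_single (⟨(c, b), hmem⟩ : S)]
      · rintro ⟨⟨c', b'⟩, hk⟩ hk1 hk2
        exfalso
        apply hk2
        rw [hS, Finset.mem_filter] at hk
        rw [Finset.mem_filter] at hk1
        have h3 : c'.strand b' = c.strand b := by
          rw [hcb, ht']
          exact Prod.ext hk.2 (Subtype.ext hk1.2)
        obtain ⟨rfl, rfl⟩ := Crossing.strand_injective h3
        rfl
      · intro hn
        exfalso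
        apply hn
        rw [Finset.mem_filter]
        refine ⟨Finset.mem_univ _, ?_⟩
        simp only [hcb, ht']
    · rw [Finset.sum_eq_zero]
      · exact dif_neg h
      · rintro ⟨⟨c', b'⟩, hk⟩ hk1
        exfalso
        rw [hS, Finset.mem_filter] at hk
        rw [Finset.mem_filter] at hk1
        have ht' : D.pt i t = (i, ⟨t, ht⟩) := pt_coe (D := D) (i, ⟨t, ht⟩)
        exact h ⟨(c', b'), by rw [ht']; exact Prod.ext hk.2 (Subtype.ext hk1.2)⟩

end LinkDiagram

namespace LinkDiagram

variable {l : ℕ} {D : LinkDiagram l}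

/-! ### The winding number about a component -/

theorem isCycle_singleton {A : Arc l} (h : D.curve A.comp A.start = D.curve A.comp A.finish) :
    D.IsCycle [A] := by
  intro p hp
  have hne : D.curve A.comp A.start - p ≠ 0 := fun h0 =>
    hp A (by simp) ⟨A.start, ⟨le_rfl, A.start_lt.le⟩, sub_eq_zero.1 h0⟩
  simp [← h, div_self hne]

/-- The full turn around a component. -/
def fullArc (i : Fin l) (q : ℝ) : Arc l := ⟨i, q, q + 1, by linarith, le_rfl⟩

theorem isCycle_fullArc (i : Fin l) (q : ℝ) : D.IsCycle [fullArc i q] :=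
  isCycle_singleton (D.periodic_curve i q).symm

theorem endsAtCrossings_fullArc {i : Fin l} {q : ℝ} (hq : ¬ D.IsSimplePoint (D.pt i q)) :
    D.EndsAtCrossings [fullArc i q] := by
  intro A hA
  rw [List.mem_singleton] at hA
  subst hA
  exact ⟨hq, by simpa [fullArc, pt_add_one] using hq⟩

theorem cycleMult_fullArc {i j : Fin l} {q t : ℝ} (hq : ¬ D.IsSimplePoint (D.pt i q))
    (ht : D.IsSimplePoint (D.pt j t)) : cycleMult [fullArc i q] j t = if i = j then 1 else 0 := by
  classical
  simp only [cycleMult, List.map_cons, List.map_nil, List.sum_cons, List.sum_nil, add_zero,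
    Arc.mult, fullArc]
  refine if_congr (and_iff_left_iff_imp.2 ?_) rfl rfl
  rintro rfl
  obtain ⟨n, h1, h2⟩ := Arc.exists_int_mem_Ico q t
  refine ⟨n, lt_of_le_of_ne h1 fun h => hq ?_, h2⟩
  rw [h, pt_add_int]
  exact ht

theorem cycleMultDir_fullArc (i j : Fin l) (q t : ℝ) (σ : ℤˣ) :
    cycleMultDir [fullArc i q] j t σ = if i = j then 1 else 0 := by
  classical
  simp only [cycleMultDir, List.map_cons, List.map_nil, List.sum_cons, List.sum_nil, add_zero,
    Arc.multDir, fullArc]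
  refine if_congr (and_iff_left_iff_imp.2 fun _ => ?_) rfl rfl
  split_ifs
  · exact Arc.exists_int_mem_Ico q t
  · exact Arc.exists_int_mem_Ioc q t

/-- The winding number of one full turn around the component. The turn starts at a crossing, so
every simple point is interior to it and the jump formula applies at all of them. -/
theorem exists_component_winding {i : Fin l} {q : ℝ} (hq : ¬ D.IsSimplePoint (D.pt i q)) :
    ∃ N : D.Region → ℤ,
      (∀ j t, D.IsSimplePoint (D.pt j t) → ∀ R R' : D.Region,
        R.Faces (D.curve j t) (Complex.I * deriv (D.curve j) t) →
        R'.Faces (D.curve j t) (-(Complex.I * deriv (D.curve j) t)) →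
        N R - N R' = if i = j then 1 else 0) ∧
      ∀ (c : D.Crossing) b σ, N (c.strandCorner b σ (c.strandEps b)) -
        N (c.strandCorner b σ (-c.strandEps b)) = if i = (c.strand b).1 then 1 else 0 := by
  refine ⟨D.regionWinding [fullArc i q], fun j t ht R R' hR hR' => ?_, fun c b σ => ?_⟩
  · rw [regionWinding_sub_of_faces (isCycle_fullArc i q) (endsAtCrossings_fullArc hq) ht hR hR',
      cycleMult_fullArc hq ht]
  · rw [regionWinding_strandCorner_sub (isCycle_fullArc i q) (endsAtCrossings_fullArc hq),
      cycleMultDir_fullArc]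

/-! ### Sums over the corners of a crossing -/

theorem sum_corner {M : Type*} [AddCommMonoid M] (f : Corner → M) :
    ∑ κ, f κ = f (1, 1) + f (1, -1) + (f (-1, 1) + f (-1, -1)) := by
  have h : ∀ g : ℤˣ → M, ∑ σ, g σ = g 1 + g (-1) := fun g => by
    rw [UnitsInt.univ, Finset.sum_pair (by decide)]
  rw [Fintype.sum_prod_type, h, h, h]

theorem exists_corner {P : Corner → Prop} :
    (∃ κ, P κ) ↔ (P (1, 1) ∨ P (1, -1)) ∨ (P (-1, 1) ∨ P (-1, -1)) := by
  constructor
  · rintro ⟨⟨σ, τ⟩, h⟩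
    rcases Int.units_eq_one_or σ with rfl | rfl <;> rcases Int.units_eq_one_or τ with rfl | rfl <;>
      simp [h]
  · rintro ((h | h) | (h | h)) <;> exact ⟨_, h⟩

namespace Crossing

variable (c : D.Crossing)

/-- The sum of a function over the four corners. -/
noncomputable def cornerSum (u : D.Region → ℤ) : ℤ :=
  ∑ κ : Corner, u (c.corner κ.1 κ.2)

/-- The alternating sum of a function over the four corners. -/
noncomputable def altSum (u : D.Region → ℤ) : ℤ :=
  ∑ κ : Corner, -((κ.1 * κ.2 : ℤˣ) : ℤ) * u (c.corner κ.1 κ.2)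

theorem altSum_eq (u : D.Region → ℤ) : c.altSum u =
    u (c.corner 1 (-1)) + u (c.corner (-1) 1) - u (c.corner 1 1) - u (c.corner (-1) (-1)) := by
  rw [altSum, sum_corner]
  simp
  ring

theorem cornerSum_eq (u : D.Region → ℤ) : c.cornerSum u =
    u (c.corner 1 1) + u (c.corner 1 (-1)) + (u (c.corner (-1) 1) + u (c.corner (-1) (-1))) :=
  sum_corner _

theorem strandJump_eq (b : Bool) (u : D.Region → ℤ) :
    c.strandJump b u = -((c.strandEps b : ℤ) * c.altSum u) := by
  rw [altSum_eq]
  cases b <;> simp only [strandJump, strandCorner, strandEps, cond_true, cond_false] <;>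
    rcases Int.units_eq_one_or c.eps with h | h <;> rw [h] <;> simp <;> ring

/-- The two corners are separated by a half-strand of the overpass, across which the winding number
of its component changes by one. -/
theorem corner_ne_right (σ τ : ℤˣ) : c.corner σ τ ≠ c.corner σ (-τ) := by
  obtain ⟨N, -, hN⟩ := exists_component_winding (D := D) (i := (c.strand true).1)
    (q := (c.strand true).2) (by rw [pt_coe]; exact c.not_isSimplePoint_strand true)
  have h := hN c true σ
  simp only [strandCorner, cond_true, if_true] at h
  intro heq
  rcases Int.units_eq_one_or (c.strandEps true) with h1 | h1 <;>
    rcases Int.units_eq_one_or τ with rfl | rfl <;>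
    simp_all

theorem corner_ne_left (σ τ : ℤˣ) : c.corner σ τ ≠ c.corner (-σ) τ := by
  obtain ⟨N, -, hN⟩ := exists_component_winding (D := D) (i := (c.strand false).1)
    (q := (c.strand false).2) (by rw [pt_coe]; exact c.not_isSimplePoint_strand false)
  have h := hN c false τ
  simp only [strandCorner, cond_false, if_true] at h
  intro heq
  rcases Int.units_eq_one_or (c.strandEps false) with h1 | h1 <;>
    rcases Int.units_eq_one_or σ with rfl | rfl <;>
    simp_all

theorem touchesTwice_iff {R : D.Region} : c.TouchesTwice R ↔
    ∃ σ τ, R = c.corner σ τ ∧ R = c.corner (-σ) (-τ) := by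
  constructor
  · rintro ⟨⟨σ, τ⟩, ⟨σ', τ'⟩, hne, h1, h2⟩
    rw [touchesAt_iff] at h1 h2
    simp only at h1 h2
    refine ⟨σ, τ, h1, ?_⟩
    have hu : ∀ x y : ℤˣ, y = x ∨ y = -x := fun x y => by
      rcases Int.units_eq_one_or x with rfl | rfl <;>
        rcases Int.units_eq_one_or y with rfl | rfl <;> simp
    rcases hu σ σ' with rfl | rfl <;> rcases hu τ τ' with rfl | rfl
    · exact absurd rfl hne
    · exact absurd (h1.symm.trans h2) (c.corner_ne_right _ _)
    · exact absurd (h1.symm.trans h2) (c.corner_ne_left _ _)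
    · exact h2
  · rintro ⟨σ, τ, h1, h2⟩
    refine ⟨(σ, τ), (-σ, -τ), ?_, c.touchesAt_iff.2 h1, c.touchesAt_iff.2 h2⟩
    rcases Int.units_eq_one_or σ with rfl | rfl <;> simp

/-- Going to the opposite corner crosses each strand once. If the strands belong to different
components, the winding number about the component of the overpass changes by one in total. -/
theorem not_touchesTwice_of_not_isSelf (hc : ¬ c.IsSelf) (R : D.Region) : ¬ c.TouchesTwice R := by
  rw [touchesTwice_iff]
  rintro ⟨σ, τ, h1, h2⟩
  obtain ⟨N, -, hN⟩ := exists_component_winding (D := D) (i := (c.strand true).1)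
    (q := (c.strand true).2) (by rw [pt_coe]; exact c.not_isSimplePoint_strand true)
  have hne : (c.strand true).1 ≠ (c.strand false).1 := hc
  have e1 := hN c true
  have e2 := hN c false
  simp only [strandCorner, cond_true, cond_false, if_true, hne, if_false, strandEps] at e1 e2
  have e1a := e1 1
  have e1b := e1 (-1)
  have e2a := e2 1
  have e2b := e2 (-1)
  have h3 : N (c.corner σ τ) = N (c.corner (-σ) (-τ)) := by rw [← h1, ← h2]
  rcases Int.units_eq_one_or c.eps with h | h <;> rw [h] at e1a e1b e2a e2b <;>
    rcases Int.units_eq_one_or σ with rfl | rfl <;> rcases Int.units_eq_one_or τ with rfl | rfl <;>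
    simp only [neg_neg] at * <;> omega

theorem planeCross_rays (κ : Corner) : planeCross (c.underRay κ) (c.overRay κ) =
    -((((κ.1 * κ.2 : ℤˣ) : ℤ) : ℝ) * planeCross (D.tangent c.overPt) (D.tangent c.underPt)) := by
  simp only [underRay, overRay, planeCross]
  push_cast
  simp
  ring

theorem isCounterclockwise_iff (κ : Corner) : c.IsCounterclockwise κ ↔ κ.1 * κ.2 = -c.eps := by
  have h := c.eps_mul_cross_pos
  rw [IsCounterclockwise, planeCross_rays]
  rcases Int.units_eq_one_or c.eps with h1 | h1 <;>
    rcases Int.units_eq_one_or (κ.1 * κ.2) with h2 | h2 <;> rw [h1] at h <;> rw [h1, h2] <;>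
    simp at h ⊢ <;> first | exact h | exact h.le

theorem isClockwise_iff (κ : Corner) : c.IsClockwise κ ↔ κ.1 * κ.2 = c.eps := by
  have h := c.eps_mul_cross_pos
  rw [IsClockwise, planeCross_rays]
  rcases Int.units_eq_one_or c.eps with h1 | h1 <;>
    rcases Int.units_eq_one_or (κ.1 * κ.2) with h2 | h2 <;> rw [h1] at h <;> rw [h1, h2] <;>
    simp at h ⊢ <;> first | exact h | exact h.le

theorem isSideCorner_iff (κ : Corner) : c.IsSideCorner κ ↔ κ.1 * κ.2 = -1 := by
  have h := c.cross_ne_zero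
  have h1 : planeCross (D.tangent c.overPt) (c.cornerDir κ) =
      ((κ.2 : ℤ) : ℝ) * planeCross (D.tangent c.overPt) (D.tangent c.underPt) := by
    simp only [cornerDir, underRay, overRay, planeCross]
    simp
    ring
  have h2 : planeCross (D.tangent c.underPt) (c.cornerDir κ) =
      -(((κ.1 : ℤ) : ℝ) * planeCross (D.tangent c.overPt) (D.tangent c.underPt)) := by
    simp only [cornerDir, underRay, overRay, planeCross]
    simp
    ring
  obtain ⟨σ, τ⟩ := κ
  have hne : (1 : ℤˣ) ≠ -1 := by decide
  rw [IsSideCorner, h1, h2]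
  rcases Int.units_eq_one_or σ with rfl | rfl <;> rcases Int.units_eq_one_or τ with rfl | rfl <;>
    rcases lt_or_gt_of_ne h with h | h <;> simp [h, h.not_gt, hne]

end Crossing

end LinkDiagram

namespace LinkDiagram

variable {l : ℕ} {D : LinkDiagram l}

/-! ### The region choice matrices in terms of corners -/

open Classical in
theorem finsum_sum_ite_mul {α κ : Type*} [Fintype κ] (r : κ → α) (a : κ → ℤ) (u : α → ℤ) :
    ∑ᶠ R, (∑ k, if R = r k then a k else 0) * u R = ∑ k, a k * u (r k) := by
  rw [finsum_eq_sum_of_support_subset (s := Finset.univ.image r)]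
  · simp only [Finset.sum_mul]
    rw [Finset.sum_comm]
    refine Finset.sum_congr rfl fun k _ => ?_
    simp only [ite_mul, zero_mul]
    rw [Finset.sum_ite_eq']
    simp
  · intro R hR
    rw [Function.mem_support] at hR
    by_contra hn
    apply hR
    rw [Finset.sum_eq_zero, zero_mul]
    intro k _
    refine if_neg ?_
    rintro rfl
    exact hn (by simp)

-- The double counting rule counts corners. Adjacent corners lie in different regions, so a region
-- has at most two corners, and two only if they are opposite.
open Classical in
theorem definiteDouble_eq (c : D.Crossing) (R : D.Region) :
    D.definiteDouble c R = ∑ κ : Corner, if R = c.corner κ.1 κ.2 then 1 else 0 := by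
  have h1 := c.corner_ne_right 1 1
  have h2 := c.corner_ne_right (-1) 1
  have h3 := c.corner_ne_left 1 1
  have h4 := c.corner_ne_left 1 (-1)
  have hs : D.definiteSingle c R = if ∃ κ : Corner, R = c.corner κ.1 κ.2 then 1 else 0 :=
    if_congr c.point_mem_frontier_iff rfl rfl
  have ht : c.TouchesTwice R ↔ ∃ κ : Corner, R = c.corner κ.1 κ.2 ∧ R = c.corner (-κ.1) (-κ.2) := by
    rw [c.touchesTwice_iff, Prod.exists]
  simp only [definiteDouble, hs, ht, exists_corner, sum_corner, neg_neg]
  by_cases k1 : R = c.corner 1 1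
  · subst k1
    simp [h1, h3]
    split_ifs <;> simp
  · by_cases k2 : R = c.corner 1 (-1)
    · subst k2
      simp [h4, h1.symm]
      split_ifs <;> simp
    · by_cases k3 : R = c.corner (-1) 1 <;> by_cases k4 : R = c.corner (-1) (-1) <;> simp_all

-- Opposite corners have the same value of `κ.1 * κ.2` and so the same sign. A region touching twice
-- never mixes the two signs, and doubling its entry is the sum over its corners.
open Classical in
theorem alternatingDouble_eq (c : D.Crossing) (R : D.Region) :
    D.alternatingDouble c R = ∑ κ : Corner,
      if R = c.corner κ.1 κ.2 then -((κ.1 * κ.2 * c.eps : ℤˣ) : ℤ) else 0 := by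
  have h1 := c.corner_ne_right 1 1
  have h2 := c.corner_ne_right (-1) 1
  have h3 := c.corner_ne_left 1 1
  have h4 := c.corner_ne_left 1 (-1)
  have hne : (1 : ℤˣ) ≠ -1 := by decide
  have ht : c.TouchesTwice R ↔ ∃ κ : Corner, R = c.corner κ.1 κ.2 ∧ R = c.corner (-κ.1) (-κ.2) := by
    rw [c.touchesTwice_iff, Prod.exists]
  simp only [alternatingDouble, alternatingSingle, ht, exists_corner, sum_corner, neg_neg,
    c.touchesAt_iff, c.isCounterclockwise_iff, c.isClockwise_iff]
  rcases Int.units_eq_one_or c.eps with he | he <;> rw [he] <;>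
  · by_cases k1 : R = c.corner 1 1
    · subst k1
      simp [h1, h3, hne, hne.symm]
      split_ifs <;> simp
    · by_cases k2 : R = c.corner 1 (-1)
      · subst k2
        simp [h4, h1.symm, hne, hne.symm]
        split_ifs <;> simp
      · by_cases k3 : R = c.corner (-1) 1 <;> by_cases k4 : R = c.corner (-1) (-1) <;>
          simp_all

theorem choiceMap_definiteDouble {n : ℕ} (x : Fin n ≃ D.Crossing) (u : D.Region → ℤ) (i : Fin n) :
    choiceMap x D.definiteDouble u i = (x i).cornerSum u := by
  simp only [choiceMap, definiteDouble_eq, finsum_sum_ite_mul, one_mul, Crossing.cornerSum]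

theorem choiceMap_alternatingDouble {n : ℕ} (x : Fin n ≃ D.Crossing) (u : D.Region → ℤ)
    (i : Fin n) : choiceMap x D.alternatingDouble u i = (x i).sign * (x i).altSum u := by
  simp only [choiceMap, alternatingDouble_eq, finsum_sum_ite_mul, Crossing.altSum,
    Crossing.sign_eq_eps, Finset.mul_sum]
  refine Finset.sum_congr rfl fun κ _ => ?_
  push_cast
  ring

/-- The sum of a function over the regions that touch the crossing twice. -/
noncomputable def Crossing.doubleSum (c : D.Crossing) (u : D.Region → ℤ) : ℤ :=
  ∑ᶠ R ∈ {R | c.TouchesTwice R}, u R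

theorem Crossing.finite_touchesTwice (c : D.Crossing) : {R | c.TouchesTwice R}.Finite := by
  refine (Set.finite_range fun κ : Corner => c.corner κ.1 κ.2).subset ?_
  rintro R ⟨κ, -, -, h, -⟩
  exact ⟨κ, (c.touchesAt_iff.1 h).symm⟩

theorem choiceMap_definiteSingle {n : ℕ} (x : Fin n ≃ D.Crossing) (u : D.Region → ℤ) (i : Fin n) :
    choiceMap x D.definiteSingle u i = (x i).cornerSum u - (x i).doubleSum u := by
  classical
  rw [← choiceMap_definiteDouble, eq_sub_iff_add_eq, choiceMap, choiceMap, Crossing.doubleSum]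
  have h1 : ∀ c : D.Crossing, (Function.support fun R => D.definiteSingle c R * u R).Finite := by
    intro c
    refine (Set.finite_range fun κ : Corner => c.corner κ.1 κ.2).subset fun R hR => ?_
    have hR : D.definiteSingle c R ≠ 0 := left_ne_zero_of_mul hR
    have : c.point ∈ frontier R.toSet := by
      by_contra hn
      exact hR (if_neg hn)
    obtain ⟨κ, hκ⟩ := c.point_mem_frontier_iff.1 this
    exact ⟨κ, hκ.symm⟩
  simp only [finsum_mem_def]
  rw [← finsum_add_distrib (h1 _)]
  · refine finsum_congr fun R => ?_
    simp only [definiteDouble, Set.indicator_apply, Set.mem_ofPred_eq]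
    split_ifs with h
    · obtain ⟨κ, -, -, hκ, -⟩ := h
      have : (x i).point ∈ frontier R.toSet :=
        (x i).point_mem_frontier_iff.2 ⟨κ, (x i).touchesAt_iff.1 hκ⟩
      rw [definiteSingle, if_pos this]
      ring
    · simp
  · exact (x i).finite_touchesTwice.subset Set.support_indicator_subset

theorem Crossing.cornerSum_add (c : D.Crossing) (u v : D.Region → ℤ) :
    c.cornerSum (u + v) = c.cornerSum u + c.cornerSum v :=
  Finset.sum_add_distrib

theorem Crossing.cornerSum_smul (c : D.Crossing) (a : ℤ) (u : D.Region → ℤ) :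
    c.cornerSum (a • u) = a * c.cornerSum u := by
  rw [cornerSum, cornerSum, Finset.mul_sum]
  rfl

theorem Crossing.doubleSum_add (c : D.Crossing) (u v : D.Region → ℤ) :
    c.doubleSum (u + v) = c.doubleSum u + c.doubleSum v :=
  finsum_mem_add_distrib c.finite_touchesTwice

theorem Crossing.doubleSum_smul (c : D.Crossing) (a : ℤ) (u : D.Region → ℤ) :
    c.doubleSum (a • u) = a * c.doubleSum u := by
  simp only [doubleSum, Pi.smul_apply, smul_eq_mul]
  exact (mul_finsum_mem _ _).symm

theorem Crossing.doubleSum_eq_zero (c : D.Crossing) {u : D.Region → ℤ}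
    (h : ∀ R, c.TouchesTwice R → u R = 0) : c.doubleSum u = 0 :=
  finsum_mem_eq_zero_of_forall_eq_zero h

/-- The linear map of the definite problem with the double counting rule. -/
noncomputable def doubleMap {n : ℕ} (x : Fin n ≃ D.Crossing) : (D.Region → ℤ) →ₗ[ℤ] (Fin n → ℤ) where
  toFun := choiceMap x D.definiteDouble
  map_add' u v := by
    funext i
    simp only [Pi.add_apply, choiceMap_definiteDouble, Crossing.cornerSum_add]
  map_smul' a u := by
    funext i
    simp only [Pi.smul_apply, choiceMap_definiteDouble, Crossing.cornerSum_smul, smul_eq_mul,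
      RingHom.id_apply]

/-- The linear map of the definite problem with the single counting rule. -/
noncomputable def singleMap {n : ℕ} (x : Fin n ≃ D.Crossing) : (D.Region → ℤ) →ₗ[ℤ] (Fin n → ℤ) where
  toFun := choiceMap x D.definiteSingle
  map_add' u v := by
    funext i
    simp only [Pi.add_apply, choiceMap_definiteSingle, Crossing.cornerSum_add,
      Crossing.doubleSum_add]
    ring
  map_smul' a u := by
    funext i
    simp only [Pi.smul_apply, choiceMap_definiteSingle, Crossing.cornerSum_smul,
      Crossing.doubleSum_smul, smul_eq_mul, RingHom.id_apply]
    ring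

/-! ### Checkerboard colorings -/

theorem IsCheckerboardColoring.strandCorner {χ : D.Region → ZMod 2}
    (hχ : D.IsCheckerboardColoring χ) (c : D.Crossing) (b : Bool) (σ : ℤˣ) :
    χ (c.strandCorner b σ (c.strandEps b)) = χ (c.strandCorner b σ (-c.strandEps b)) + 1 := by
  obtain ⟨ε, hε, hf⟩ := c.exists_strandCorner_faces b
  obtain ⟨k1, k2⟩ := hf σ (ε / 2) (by linarith) (by linarith)
  refine hχ _ k1 _ _ ?_ ?_
  · have := k2 1
    rw [← tangent_pt] at this
    simpa [IsLeftRegion, Region.Faces, pos_pt] using this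
  · have := k2 (-1)
    rw [← tangent_pt] at this
    simpa [IsRightRegion, Region.Faces, pos_pt, sub_eq_add_neg] using this

theorem IsCheckerboardColoring.corner_neg {χ : D.Region → ZMod 2}
    (hχ : D.IsCheckerboardColoring χ) (c : D.Crossing) (σ τ : ℤˣ) :
    χ (c.corner σ (-τ)) = χ (c.corner σ τ) + 1 ∧ χ (c.corner (-σ) τ) = χ (c.corner σ τ) + 1 := by
  have h1 := hχ.strandCorner c true σ
  have h2 := hχ.strandCorner c false τ
  have hz : ∀ a b : ZMod 2, a = b + 1 → b = a + 1 := by decide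
  simp only [Crossing.strandCorner, cond_true, cond_false] at h1 h2
  constructor
  · rcases Int.units_eq_one_or (c.strandEps true) with h | h <;> rw [h] at h1 <;>
      (rcases Int.units_eq_one_or τ with rfl | rfl <;> try simp only [neg_neg] at h1 ⊢) <;>
      first | exact h1 | exact hz _ _ h1
  · rcases Int.units_eq_one_or (c.strandEps false) with h | h <;> rw [h] at h2 <;>
      (rcases Int.units_eq_one_or σ with rfl | rfl <;> try simp only [neg_neg] at h2 ⊢) <;>
      first | exact h2 | exact hz _ _ h2

/-- The sign relating the definite and the alternating corner sums for a coloring. -/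
noncomputable def Crossing.colorSign (c : D.Crossing) (χ : D.Region → ZMod 2) : ℤˣ :=
  if χ (c.corner 1 (-1)) = 0 then 1 else -1

/-- Colors alternate around the crossing, so the twist puts the signs of the alternating sum on the
corners. The color of one corner decides the overall sign. -/
theorem Crossing.cornerSum_twist (c : D.Crossing) {χ : D.Region → ZMod 2}
    (hχ : D.IsCheckerboardColoring χ) (u : D.Region → ℤ) :
    c.cornerSum (checkerboardTwist χ u) = (c.colorSign χ : ℤ) * c.altSum u := by
  have h1 := (hχ.corner_neg c 1 (-1)).1
  have h2 := (hχ.corner_neg c 1 (-1)).2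
  have h3 := (hχ.corner_neg c (-1) (-1)).1
  rw [neg_neg] at h1 h3
  rw [cornerSum_eq, altSum_eq, colorSign]
  simp only [checkerboardTwist, h1, h3, h2]
  generalize χ (c.corner 1 (-1)) = a
  have h01 : ∀ a : ZMod 2, a = 0 ∨ a = 1 := by decide
  have e1 : (0 : ZMod 2) ≠ 1 := by decide
  have e2 : (1 : ZMod 2) + 1 = 0 := by decide
  rcases h01 a with rfl | rfl
  · simp [e1, e2]; ring
  · simp [e1, e2, e1.symm]; ring

theorem Crossing.altSum_eq_cornerSum_twist (c : D.Crossing) {χ : D.Region → ZMod 2}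
    (hχ : D.IsCheckerboardColoring χ) (u : D.Region → ℤ) :
    c.altSum (checkerboardTwist χ u) = (c.colorSign χ : ℤ) * c.cornerSum u := by
  have h := c.cornerSum_twist hχ (checkerboardTwist χ u)
  have h2 : checkerboardTwist χ (checkerboardTwist χ u) = u := by
    funext R
    simp only [checkerboardTwist]
    split_ifs <;> simp
  rw [h2] at h
  rw [h, ← mul_assoc, ← Units.val_mul, Int.units_mul_self, Units.val_one, one_mul]

theorem IsCheckerboardColoringAt.colorSign_eq {χ : D.Region → ZMod 2} {c : D.Crossing}
    (hχ : D.IsCheckerboardColoringAt c χ) : c.colorSign χ = 1 :=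
  if_pos (hχ.2 _ (1, -1) (c.touchesAt_iff.2 rfl) ((c.isSideCorner_iff _).2 (by simp)))

/-- The sum of the winding numbers of all components is an Alexander numbering; reduce it modulo
`2`. Adding its value at one side corner normalises it to zero there, and hence also at the opposite
one. -/
theorem exists_isCheckerboardColoringAt (c : D.Crossing)
    (hD : ∀ i, ∃ q, ¬ D.IsSimplePoint (D.pt i q)) : ∃ χ, D.IsCheckerboardColoringAt c χ := by
  choose q hq using hD
  choose N hN _ using fun i => exists_component_winding (hq i)
  let χ₀ : D.Region → ZMod 2 := fun R => ((∑ i, N i R : ℤ) : ZMod 2)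
  have hχ₀ : D.IsCheckerboardColoring χ₀ := by
    intro s hs R R' hR hR'
    have h1 : ∀ i, N i R - N i R' = if i = s.1 then 1 else 0 := fun i => by
      refine hN i s.1 s.2 (by rwa [pt_coe]) R R' hR ?_
      have : ∀ᶠ r : ℝ in 𝓝[>] 0, D.pos s + (r : ℂ) * -(Complex.I * D.tangent s) ∈ R'.toSet := by
        filter_upwards [hR'] with r hr
        rwa [mul_neg, ← sub_eq_add_neg]
      exact this
    have h2 : ∑ i, N i R - ∑ i, N i R' = 1 := by
      rw [← Finset.sum_sub_distrib]
      simp [h1]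
    have h3 : ∑ i, N i R = ∑ i, N i R' + 1 := by linarith
    simp only [χ₀, h3]
    push_cast
    ring
  let χ : D.Region → ZMod 2 := fun R => χ₀ R + χ₀ (c.corner 1 (-1))
  have h0 : ∀ a : ZMod 2, a + a = 0 := by decide
  refine ⟨χ, fun s hs R R' hR hR' => ?_, fun R κ hκ hside => ?_⟩
  · simp only [χ, hχ₀ s hs R R' hR hR']
    ring
  · rw [c.touchesAt_iff.1 hκ]
    rw [c.isSideCorner_iff] at hside
    obtain ⟨σ, τ⟩ := κ
    rcases Int.units_eq_one_or σ with rfl | rfl <;> rcases Int.units_eq_one_or τ with rfl | rfl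
    · exact absurd hside (by decide)
    · exact h0 _
    · have h1 := (hχ₀.corner_neg c 1 (-1)).2
      have h2 := (hχ₀.corner_neg c (-1) (-1)).1
      rw [neg_neg] at h2
      simp only [χ, h2, h1]
      generalize χ₀ (c.corner 1 (-1)) = a
      revert a
      decide
    · exact absurd hside (by decide)

/-! ### The linear relation along a component -/

-- The jumps of the over and under strands carry opposite signs, so a self-crossing of the component
-- cancels and only crossings with other components survive.
open Classical in
theorem sum_eps_mul_altSum_eq_zero [Fintype D.Crossing] (i : Fin l) (u : D.Region → ℤ) :
    ∑ c : D.Crossing, (c.eps : ℤ) * c.altSum u *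
      ((if c.overPt.1 = i then 1 else 0) - (if c.underPt.1 = i then 1 else 0)) = 0 := by
  have h := sum_strandJump_eq_zero i u
  rw [Finset.sum_filter, Fintype.sum_prod_type] at h
  simp only [Fintype.sum_bool, Crossing.strandJump_eq, Crossing.strand, Crossing.strandEps,
    cond_true, cond_false] at h
  rw [← neg_eq_zero, ← Finset.sum_neg_distrib]
  refine Eq.trans (Finset.sum_congr rfl fun c _ => ?_) h
  push_cast
  split_ifs <;> ring

end LinkDiagram

namespace LinkDiagram

section

variable {l : ℕ} {D : LinkDiagram l}

/-! ### Alternating sums of winding numbers -/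

-- By `strandJump_eq` the alternating sum is the change, along the overpass, of the number of times
-- the cycle passes; each arc changes this number only at its two ends. Looking at the overpass
-- alone is enough.
open Classical in
theorem eps_mul_altSum_regionWinding {Z : List (Arc l)} (hZ : D.IsCycle Z)
    (hE : D.EndsAtCrossings Z) (c : D.Crossing) :
    (c.eps : ℤ) * c.altSum (D.regionWinding Z) = (Z.map fun A =>
      (if c.overPt = D.pt A.comp A.finish then 1 else 0) -
      (if c.overPt = D.pt A.comp A.start then (1 : ℤ) else 0)).sum := by
  have h := c.strandJump_eq true (D.regionWinding Z)
  rw [Crossing.strandJump, regionWinding_strandCorner_sub hZ hE,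
    regionWinding_strandCorner_sub hZ hE] at h
  have h1 : (c.eps : ℤ) * c.altSum (D.regionWinding Z) =
      cycleMultDir Z c.overPt.1 c.overPt.2 (-1) - cycleMultDir Z c.overPt.1 c.overPt.2 1 := by
    simp only [Crossing.strand, Crossing.strandEps, cond_true] at h
    linarith
  rw [h1]
  clear h h1 hZ hE
  induction Z with
  | nil => rfl
  | cons A Z ih =>
    have h2 := A.multDir_sub D c.overPt.1 c.overPt.2
    rw [pt_coe] at h2
    simp only [cycleMultDir, List.map_cons, List.sum_cons] at ih ⊢
    rw [← h2, ← ih]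
    ring

theorem isCycle_pair {A B : Arc l} (h1 : D.curve A.comp A.finish = D.curve B.comp B.start)
    (h2 : D.curve B.comp B.finish = D.curve A.comp A.start) : D.IsCycle [A, B] := by
  intro p hp
  have hA : D.curve A.comp A.start - p ≠ 0 := fun h0 =>
    hp A (by simp) ⟨A.start, ⟨le_rfl, A.start_lt.le⟩, sub_eq_zero.1 h0⟩
  have hB : D.curve B.comp B.start - p ≠ 0 := fun h0 =>
    hp B (by simp) ⟨B.start, ⟨le_rfl, B.start_lt.le⟩, sub_eq_zero.1 h0⟩
  simp only [List.map_cons, List.map_nil, List.prod_cons, List.prod_nil, mul_one, h1, h2]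
  field_simp

theorem isCycle_triple {A B C : Arc l} (h1 : D.curve A.comp A.finish = D.curve B.comp B.start)
    (h2 : D.curve B.comp B.finish = D.curve C.comp C.start)
    (h3 : D.curve C.comp C.finish = D.curve A.comp A.start) : D.IsCycle [A, B, C] := by
  intro p hp
  have hA : D.curve A.comp A.start - p ≠ 0 := fun h0 =>
    hp A (by simp) ⟨A.start, ⟨le_rfl, A.start_lt.le⟩, sub_eq_zero.1 h0⟩
  have hB : D.curve B.comp B.start - p ≠ 0 := fun h0 =>
    hp B (by simp) ⟨B.start, ⟨le_rfl, B.start_lt.le⟩, sub_eq_zero.1 h0⟩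
  have hC : D.curve C.comp C.start - p ≠ 0 := fun h0 =>
    hp C (by simp) ⟨C.start, ⟨le_rfl, C.start_lt.le⟩, sub_eq_zero.1 h0⟩
  simp only [List.map_cons, List.map_nil, List.prod_cons, List.prod_nil, mul_one, h1, h2, h3]
  field_simp

theorem exists_param_mem_Ico (s : CirclePoint l) (q : ℝ) :
    ∃ t, D.pt s.1 t = s ∧ q ≤ t ∧ t < q + 1 := by
  obtain ⟨n, h1, h2⟩ := Arc.exists_int_mem_Ico q s.2
  exact ⟨_, by rw [pt_add_int, pt_coe], h1, h2⟩

theorem exists_param_mem_Ioc (s : CirclePoint l) (q : ℝ) :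
    ∃ t, D.pt s.1 t = s ∧ q < t ∧ t ≤ q + 1 := by
  obtain ⟨n, h1, h2⟩ := Arc.exists_int_mem_Ioc q s.2
  exact ⟨_, by rw [pt_add_int, pt_coe], h1, h2⟩

theorem exists_param_mem_Ioo {i : Fin l} {s : CirclePoint l} (hs : s.1 = i) {q : ℝ}
    (hq : D.pt i q ≠ s) : ∃ t, D.pt i t = s ∧ q < t ∧ t < q + 1 := by
  subst hs
  obtain ⟨t, h1, h2, h3⟩ := exists_param_mem_Ico s q
  refine ⟨t, h1, lt_of_le_of_ne h2 ?_, h3⟩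
  rintro rfl
  exact hq h1

theorem pt_injOn {i : Fin l} {q t s : ℝ} (ht : q ≤ t ∧ t < q + 1) (hs : q ≤ s ∧ s < q + 1)
    (h : D.pt i t = D.pt i s) : t = s := by
  obtain ⟨-, n, hn⟩ := pt_eq_iff.1 h
  have h1 : (0 : ℤ) = n := Arc.int_eq_of_abs_sub_lt_one (a := q) (t := s) (x := s) (y := t)
    ⟨hs.1, hs.2.le⟩ ⟨ht.1, ht.2.le⟩ ⟨fun h => by linarith [h.2, ht.2], fun h => by linarith [h.1, hs.2]⟩
    (by simp) hn
  rw [hn, ← h1]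
  simp

namespace Crossing

/-- The two parameters of a self-crossing, in an interval of length one. -/
theorem exists_params (c : D.Crossing) {i : Fin l} (ho : c.overPt.1 = i) (hu : c.underPt.1 = i)
    {q : ℝ} (h1 : D.pt i q ≠ c.overPt) (h2 : D.pt i q ≠ c.underPt) :
    ∃ (a b : ℝ) (s : Bool), q < a ∧ a < b ∧ b < q + 1 ∧ c.strand s = D.pt i a ∧
      c.strand (!s) = D.pt i b := by
  obtain ⟨t, ht, ht1, ht2⟩ := exists_param_mem_Ioo ho h1
  obtain ⟨t', ht', ht1', ht2'⟩ := exists_param_mem_Ioo hu h2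
  rcases lt_trichotomy t t' with h | h | h
  · exact ⟨t, t', true, ht1, h, ht2', ht.symm, ht'.symm⟩
  · exact absurd (ht.symm.trans (h ▸ ht')) c.overPt_ne_underPt
  · exact ⟨t', t, false, ht1', h, ht2, ht'.symm, ht.symm⟩

end Crossing

/-! ### Loops cut off at a self-crossing -/

/-- The loop cut out of a component between two parameters less than one apart. -/
def loopArc (i : Fin l) (a b q : ℝ) (h : q < a ∧ a < b ∧ b < q + 1) : Arc l :=
  ⟨i, a, b, h.2.1, by linarith⟩

section Loop

variable {c : D.Crossing} {i : Fin l} {a b q : ℝ} {s : Bool} (h : q < a ∧ a < b ∧ b < q + 1)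

theorem isCycle_loopArc (ha : c.strand s = D.pt i a) (hb : c.strand (!s) = D.pt i b) :
    D.IsCycle [loopArc i a b q h] := by
  apply isCycle_singleton
  change D.curve i a = D.curve i b
  rw [← pos_pt, ← pos_pt, ← ha, ← hb, c.pos_strand, c.pos_strand]

theorem endsAtCrossings_loopArc (ha : c.strand s = D.pt i a) (hb : c.strand (!s) = D.pt i b) :
    D.EndsAtCrossings [loopArc i a b q h] := by
  intro A hA
  rw [List.mem_singleton] at hA
  subst hA
  exact ⟨by rw [loopArc, ← ha]; exact c.not_isSimplePoint_strand _,
    by rw [loopArc, ← hb]; exact c.not_isSimplePoint_strand _⟩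

open Classical in
theorem eps_mul_altSum_loopArc (ha : c.strand s = D.pt i a) (hb : c.strand (!s) = D.pt i b)
    (c' : D.Crossing) : (c'.eps : ℤ) * c'.altSum (D.regionWinding [loopArc i a b q h]) =
      if c' = c then (bif s then -1 else 1) else 0 := by
  rw [eps_mul_altSum_regionWinding (isCycle_loopArc h ha hb) (endsAtCrossings_loopArc h ha hb)]
  simp only [List.map_cons, List.map_nil, List.sum_cons, List.sum_nil, add_zero, loopArc,
    ← ha, ← hb]
  by_cases hc : c' = c
  · subst hc
    cases s <;> simp [Crossing.strand, c'.overPt_ne_underPt]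
  · have hne : ∀ r, c'.overPt ≠ c.strand r := fun r hr =>
      hc (Crossing.strand_injective (b := true) (show c'.strand true = c.strand r from hr)).1
    simp [hne, hc]

end Loop

end

/-! ### Crossings of the two components -/

section TwoComponents

variable {D : LinkDiagram 2}

namespace Crossing

variable (c : D.Crossing)

/-- The strand that belongs to the first component, at a crossing of the two components. -/
def zeroStrand : Bool := decide (c.overPt.1 = 0)

/-- The sign with which the second component crosses the first one. -/
noncomputable def zeroEps : ℤˣ := c.strandEps c.zeroStrand

theorem strand_zeroStrand {c : D.Crossing} (hc : ¬ c.IsSelf) :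
    (c.strand c.zeroStrand).1 = 0 ∧ (c.strand !c.zeroStrand).1 = 1 := by
  unfold IsSelf at hc
  unfold zeroStrand
  by_cases h : c.overPt.1 = 0
  · simp only [h, decide_true, strand, cond_true, Bool.not_true, cond_false, true_and]
    omega
  · simp only [h, decide_false, strand, cond_true, Bool.not_false, cond_false]
    omega

theorem crossesRightToLeft_iff : c.CrossesRightToLeft ↔ ¬ c.IsSelf ∧ c.zeroEps = 1 := by
  have hlt : (0 < planeCross (D.tangent c.underPt) (D.tangent c.overPt)) ↔
      ¬ 0 < planeCross (D.tangent c.overPt) (D.tangent c.underPt) := by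
    have h := c.cross_ne_zero
    have h2 : planeCross (D.tangent c.underPt) (D.tangent c.overPt) =
      -planeCross (D.tangent c.overPt) (D.tangent c.underPt) := by unfold planeCross; ring
    rw [h2, neg_pos, not_lt]
    exact ⟨fun h => h.le, fun h' => lt_of_le_of_ne h' h⟩
  have h01 : ∀ i : Fin 2, i = 0 ∨ i = 1 := by omega
  have hne : (-1 : ℤˣ) ≠ 1 := by decide
  unfold CrossesRightToLeft IsSelf zeroEps zeroStrand strandEps eps
  rw [hlt]
  rcases h01 c.overPt.1 with ho | ho <;> rcases h01 c.underPt.1 with hu | hu <;> rw [ho, hu] <;>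
    by_cases hp : 0 < planeCross (D.tangent c.overPt) (D.tangent c.underPt) <;> simp [hp, hne]

theorem crossesLeftToRight_iff : c.CrossesLeftToRight ↔ ¬ c.IsSelf ∧ c.zeroEps = -1 := by
  have hlt : planeCross (D.tangent c.underPt) (D.tangent c.overPt) < 0 ↔
      0 < planeCross (D.tangent c.overPt) (D.tangent c.underPt) := by
    have h2 : planeCross (D.tangent c.underPt) (D.tangent c.overPt) =
      -planeCross (D.tangent c.overPt) (D.tangent c.underPt) := by unfold planeCross; ring
    rw [h2, neg_lt_zero]
  have hlt2 : planeCross (D.tangent c.overPt) (D.tangent c.underPt) < 0 ↔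
      ¬ 0 < planeCross (D.tangent c.overPt) (D.tangent c.underPt) := by
    rw [not_lt]
    exact ⟨fun h => h.le, fun h' => lt_of_le_of_ne h' c.cross_ne_zero⟩
  have h01 : ∀ i : Fin 2, i = 0 ∨ i = 1 := by omega
  have hne : (1 : ℤˣ) ≠ -1 := by decide
  unfold CrossesLeftToRight IsSelf zeroEps zeroStrand strandEps eps
  rw [hlt, hlt2]
  rcases h01 c.overPt.1 with ho | ho <;> rcases h01 c.underPt.1 with hu | hu <;> rw [ho, hu] <;>
    by_cases hp : 0 < planeCross (D.tangent c.overPt) (D.tangent c.underPt) <;> simp [hp, hne]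

end Crossing

-- The relation along the first component. The sign `zeroEps` absorbs whether that component passes
-- over or under.
open Classical in
theorem sum_zeroEps_mul_altSum_eq_zero [Fintype D.Crossing] (u : D.Region → ℤ) :
    ∑ c : D.Crossing, (if c.IsSelf then 0 else (c.zeroEps : ℤ) * c.altSum u) = 0 := by
  refine Eq.trans (Finset.sum_congr rfl fun c _ => ?_) (sum_eps_mul_altSum_eq_zero 0 u)
  have h01 : ∀ i : Fin 2, i = 0 ∨ i = 1 := by omega
  unfold Crossing.IsSelf Crossing.zeroEps Crossing.zeroStrand Crossing.strandEps
  rcases h01 c.overPt.1 with ho | ho <;> rcases h01 c.underPt.1 with hu | hu <;> rw [ho, hu] <;>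
    simp

/-- The images of the two components are closed and nonempty and cover a connected set, so they
meet; a common point is a crossing of the two. -/
theorem exists_not_isSelf (hD : IsConnected D.image) : ∃ c : D.Crossing, ¬ c.IsSelf := by
  have hcl : ∀ i, IsClosed (Set.range (D.curve i)) := fun i => (D.isCompact_range_curve i).isClosed
  have hsub : D.image ⊆ Set.range (D.curve 0) ∪ Set.range (D.curve 1) := by
    intro p hp
    obtain ⟨i, t, rfl⟩ := Set.mem_iUnion.1 hp
    have h01 : ∀ i : Fin 2, i = 0 ∨ i = 1 := by omega
    rcases h01 i with rfl | rfl
    · exact Or.inl ⟨t, rfl⟩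
    · exact Or.inr ⟨t, rfl⟩
  obtain ⟨p, -, ⟨t, ht⟩, ⟨s, hs⟩⟩ := isPreconnected_closed_iff.1 hD.isPreconnected _ _ (hcl 0)
    (hcl 1) hsub ⟨_, D.curve_mem_image 0 0, 0, rfl⟩ ⟨_, D.curve_mem_image 1 0, 0, rfl⟩
  have hns : ¬ D.IsSimplePoint (D.pt 0 t) := by
    intro h
    have := isSimplePoint_pt_iff.1 h 1 s (hs.trans ht.symm)
    exact absurd (pt_eq_iff.1 this).1 (by decide)
  obtain ⟨c, b, hcb⟩ := exists_strand_eq hns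
  have hpos : D.pos (D.pt 1 s) = c.point := by
    rw [← c.pos_strand b, hcb, pos_pt, pos_pt, hs, ht]
  have h2 := c.eq_strand_of_pos_eq hpos
  refine ⟨c, fun hself => ?_⟩
  unfold Crossing.IsSelf at hself
  have h3 : c.overPt.1 = 0 ∨ c.underPt.1 = 0 := by
    cases b
    · right; have := congrArg Prod.fst hcb; exact this
    · left; have := congrArg Prod.fst hcb; exact this
  have h4 : c.overPt.1 = 1 ∨ c.underPt.1 = 1 := by
    rcases h2 with h | h
    · left; rw [← h]; rfl
    · right; rw [← h]; rfl
  omega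

theorem Crossing.exists_strand_fst_eq {c : D.Crossing} (hc : ¬ c.IsSelf) (i : Fin 2) :
    ∃ s, (c.strand s).1 = i := by
  have h01 : ∀ i : Fin 2, i = 0 ∨ i = 1 := by omega
  have h := Crossing.strand_zeroStrand hc
  rcases h01 i with rfl | rfl
  · exact ⟨_, h.1⟩
  · exact ⟨_, h.2⟩

theorem exists_not_isSimplePoint {c : D.Crossing} (hc : ¬ c.IsSelf) (i : Fin 2) :
    ∃ q, ¬ D.IsSimplePoint (D.pt i q) := by
  obtain ⟨s, rfl⟩ := Crossing.exists_strand_fst_eq hc i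
  exact ⟨(c.strand s).2, by rw [pt_coe]; exact c.not_isSimplePoint_strand s⟩

/-- If the winding numbers on the right of both strands are `x` and `y`, the alternating sum is `(x
+ 1)(y + 1) + x y - (x + 1) y - x (y + 1) = 1`. -/
theorem Crossing.altSum_mul_eq_one {c : D.Crossing} (hc : ¬ c.IsSelf) {N : Fin 2 → D.Region → ℤ}
    (hN : ∀ i b σ, N i (c.strandCorner b σ (c.strandEps b)) -
        N i (c.strandCorner b σ (-c.strandEps b)) = if i = (c.strand b).1 then 1 else 0) :
    c.altSum (N 0 * N 1) = 1 := by
  unfold Crossing.IsSelf at hc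
  have h01 : ∀ i : Fin 2, i = 0 ∨ i = 1 := by omega
  have a0 := hN 0 true 1
  have a1 := hN 0 true (-1)
  have a2 := hN 0 false 1
  have a3 := hN 0 false (-1)
  have b0 := hN 1 true 1
  have b1 := hN 1 true (-1)
  have b2 := hN 1 false 1
  have b3 := hN 1 false (-1)
  rw [altSum_eq]
  simp only [Pi.mul_apply]
  simp only [strandCorner, strandEps, strand, cond_true, cond_false] at a0 a1 a2 a3 b0 b1 b2 b3
  clear hN
  rcases Int.units_eq_one_or c.eps with h | h <;> rw [h] at a0 a1 a2 a3 b0 b1 b2 b3 <;>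
    rcases h01 c.overPt.1 with ho | ho <;> rcases h01 c.underPt.1 with hu | hu <;>
    simp [ho, hu] at a0 a1 a2 a3 b0 b1 b2 b3 <;> first
    | exact absurd (ho.trans hu.symm) hc
    | (clear hc h01 h ho hu
       generalize N 1 (c.corner 1 1) = y1 at a0 a1 a2 a3 b0 b1 b2 b3 ⊢
       generalize N 1 (c.corner 1 (-1)) = y2 at a0 a1 a2 a3 b0 b1 b2 b3 ⊢
       generalize N 1 (c.corner (-1) 1) = y3 at a0 a1 a2 a3 b0 b1 b2 b3 ⊢
       generalize N 1 (c.corner (-1) (-1)) = y4 at a0 a1 a2 a3 b0 b1 b2 b3 ⊢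
       generalize N 0 (c.corner 1 1) = x1 at a0 a1 a2 a3 b0 b1 b2 b3 ⊢
       generalize N 0 (c.corner 1 (-1)) = x2 at a0 a1 a2 a3 b0 b1 b2 b3 ⊢
       generalize N 0 (c.corner (-1) 1) = x3 at a0 a1 a2 a3 b0 b1 b2 b3 ⊢
       generalize N 0 (c.corner (-1) (-1)) = x4 at a0 a1 a2 a3 b0 b1 b2 b3 ⊢
       grind)

end TwoComponents

end LinkDiagram

namespace LinkDiagram

/-! ### Solutions of the alternating problem -/

section

variable {D : LinkDiagram 2}

/-- The relation applied to the product of the two winding numbers says that the signs `zeroEps` of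
the mixed crossings add up to zero. There is at least one mixed crossing, so these signs cannot all
be `-1`. -/
theorem exists_crossesRightToLeft (hD : IsConnected D.image) [Fintype D.Crossing] :
    ∃ c : D.Crossing, c.CrossesRightToLeft := by
  classical
  obtain ⟨c₀, hc₀⟩ := exists_not_isSelf hD
  choose q hq using fun i => exists_not_isSimplePoint hc₀ i
  choose N hN using fun i => exists_component_winding (hq i)
  have h := sum_zeroEps_mul_altSum_eq_zero (N 0 * N 1)
  by_contra! hcon
  have hlt : ∑ c : D.Crossing, (if c.IsSelf then 0 else (c.zeroEps : ℤ) * c.altSum (N 0 * N 1)) <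
      ∑ c : D.Crossing, (0 : ℤ) := by
    have hval : ∀ c : D.Crossing, ¬ c.IsSelf →
        (if c.IsSelf then 0 else (c.zeroEps : ℤ) * c.altSum (N 0 * N 1)) = -1 := by
      intro c hc
      have h1 : c.zeroEps = -1 := by
        rcases Int.units_eq_one_or c.zeroEps with h1 | h1
        · exact absurd (c.crossesRightToLeft_iff.2 ⟨hc, h1⟩) (hcon c)
        · exact h1
      rw [if_neg hc, Crossing.altSum_mul_eq_one hc, h1]
      · rfl
      · intro i b σ
        exact (hN i).2 c b σ
    refine Finset.sum_lt_sum (fun c _ => ?_) ⟨c₀, Finset.mem_univ _, by rw [hval c₀ hc₀]; norm_num⟩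
    by_cases hc : c.IsSelf
    · simp [hc]
    · rw [hval c hc]; norm_num
  simp [h] at hlt

-- The solution is minus the winding number of the cycle from `m` to `c` along the first component
-- and back along the second; it turns only at these two crossings. A check of which strand is on
-- top turns the endpoint contributions into the stated signs.
open Classical in
theorem exists_alternating {m c : D.Crossing} (hm : m.CrossesRightToLeft) (hc : ¬ c.IsSelf)
    (hne : c ≠ m) : ∃ v : D.Region → ℤ, ∀ j : D.Crossing, j.sign * j.altSum v =
      if j = m then m.sign else
        if j = c then (if c.CrossesLeftToRight then c.sign else -c.sign) else 0 := by
  obtain ⟨hms, hme⟩ := m.crossesRightToLeft_iff.1 hm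
  obtain ⟨hm0, hm1⟩ := Crossing.strand_zeroStrand hms
  obtain ⟨hc0, hc1⟩ := Crossing.strand_zeroStrand hc
  obtain ⟨t, ht, ht1, ht2⟩ := exists_param_mem_Ioc (D := D) (c.strand c.zeroStrand)
    (m.strand m.zeroStrand).2
  obtain ⟨s, hs, hs1, hs2⟩ := exists_param_mem_Ioc (D := D) (m.strand !m.zeroStrand)
    (c.strand !c.zeroStrand).2
  let A : Arc 2 := ⟨0, (m.strand m.zeroStrand).2, t, ht1, ht2⟩
  let B : Arc 2 := ⟨1, (c.strand !c.zeroStrand).2, s, hs1, hs2⟩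
  rw [hc0] at ht
  rw [hm1] at hs
  have hA : D.pt A.comp A.start = m.strand m.zeroStrand := by
    change D.pt 0 _ = _
    rw [← hm0, pt_coe]
  have hB : D.pt B.comp B.start = c.strand !c.zeroStrand := by
    change D.pt 1 _ = _
    rw [← hc1, pt_coe]
  have hA' : D.pt A.comp A.finish = c.strand c.zeroStrand := ht
  have hB' : D.pt B.comp B.finish = m.strand !m.zeroStrand := hs
  have hZ : D.IsCycle [A, B] := by
    apply isCycle_pair
    · rw [← pos_pt, ← pos_pt, hA', hB, c.pos_strand, c.pos_strand]
    · rw [← pos_pt, ← pos_pt, hA, hB', m.pos_strand, m.pos_strand]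
  have hE : D.EndsAtCrossings [A, B] := by
    intro C hC
    simp only [List.mem_cons, List.not_mem_nil, or_false] at hC
    rcases hC with rfl | rfl
    · rw [hA, hA']; exact ⟨m.not_isSimplePoint_strand _, c.not_isSimplePoint_strand _⟩
    · rw [hB, hB']; exact ⟨c.not_isSimplePoint_strand _, m.not_isSimplePoint_strand _⟩
  refine ⟨(-1 : ℤ) • D.regionWinding [A, B], fun j => ?_⟩
  have h := eps_mul_altSum_regionWinding hZ hE j
  have hsm : j.altSum ((-1 : ℤ) • D.regionWinding [A, B]) = -j.altSum (D.regionWinding [A, B]) := by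
    simp only [Crossing.altSum_eq, Pi.smul_apply, smul_eq_mul]
    ring
  rw [hsm, mul_neg, Crossing.sign_eq_eps, h]
  simp only [List.map_cons, List.map_nil, List.sum_cons, List.sum_nil, add_zero, hA, hA', hB, hB',
    c.crossesLeftToRight_iff, Crossing.sign_eq_eps]
  have hov : ∀ (c' : D.Crossing) b, j.overPt = c'.strand b ↔ j = c' ∧ b = true := by
    intro c' b
    constructor
    · intro h'
      have := Crossing.strand_injective (b := true) (show j.strand true = c'.strand b from h')
      exact ⟨this.1, this.2.symm⟩
    · rintro ⟨rfl, rfl⟩; rfl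
  simp only [hov]
  by_cases h1 : j = m
  · subst h1
    unfold Crossing.zeroEps at hme
    cases hz : j.zeroStrand <;> rw [hz] at hme <;> simp [Crossing.strandEps] at hme <;>
      simp [hne.symm, hme]
    rw [neg_eq_iff_eq_neg.1 hme]; rfl
  · by_cases h2 : j = c
    · subst h2
      have hze : j.zeroEps = j.strandEps j.zeroStrand := rfl
      rcases Int.units_eq_one_or j.eps with he | he <;>
      cases hz : j.zeroStrand <;> rw [hz] at hze <;>
        simp [Crossing.strandEps, he] at hze <;> simp [h1, hc, hze, he]
    · simp [h1, h2]

end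

end LinkDiagram

namespace LinkDiagram

section

variable {l : ℕ} {D : LinkDiagram l}

/-! ### Crossings that a region touches twice -/

open Classical in
theorem Arc.multDir_add_int (A : Arc l) (j : Fin l) (t : ℝ) (n : ℤ) (σ : ℤˣ) :
    A.multDir j (t + n) σ = A.multDir j t σ := by
  unfold multDir
  refine if_congr (and_congr_right fun _ => ⟨fun ⟨k, hk⟩ => ⟨n + k, ?_⟩,
    fun ⟨k, hk⟩ => ⟨k - n, ?_⟩⟩) rfl rfl
  · push_cast; rwa [← add_assoc]
  · push_cast; rwa [add_assoc, add_sub_cancel]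

theorem cycleMultDir_strand {c : D.Crossing} {b : Bool} {j : Fin l} {t : ℝ}
    (h : c.strand b = D.pt j t) (Z : List (Arc l)) (σ : ℤˣ) :
    cycleMultDir Z (c.strand b).1 (c.strand b).2 σ = cycleMultDir Z j t σ := by
  have h1 : D.pt (c.strand b).1 (c.strand b).2 = D.pt j t := by rw [pt_coe, h]
  obtain ⟨h2, n, hn⟩ := pt_eq_iff.1 h1
  rw [h2, hn]
  unfold cycleMultDir
  simp only [Arc.multDir_add_int]

/-- A cycle that passes straight through the crossing on one strand and avoids the other strand
separates opposite corners: its winding numbers there differ by one. -/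
theorem Crossing.not_touchesTwice_of_cycleMultDir {c : D.Crossing} {Z : List (Arc l)}
    (hZ : D.IsCycle Z) (hE : D.EndsAtCrossings Z) {s : Bool}
    (h1 : ∀ σ, cycleMultDir Z (c.strand s).1 (c.strand s).2 σ = 1)
    (h0 : ∀ σ, cycleMultDir Z (c.strand !s).1 (c.strand !s).2 σ = 0) (R : D.Region) :
    ¬ c.TouchesTwice R := by
  intro hR
  obtain ⟨σ, τ, e1, e2⟩ := c.touchesTwice_iff.1 hR
  have a1 := fun σ => (regionWinding_strandCorner_sub hZ hE c s σ).trans (h1 σ)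
  have a0 := fun σ => (regionWinding_strandCorner_sub hZ hE c (!s) σ).trans (h0 σ)
  have e3 := e1.symm.trans e2
  have p1 := a1 1
  have p2 := a1 (-1)
  have p3 := a0 1
  have p4 := a0 (-1)
  clear a1 a0 h1 h0 e1 e2
  cases s <;> rcases Int.units_eq_one_or c.eps with he | he <;>
    simp only [strandCorner, strandEps, he, Bool.not_true, Bool.not_false, cond_true, cond_false,
      neg_neg] at p1 p2 p3 p4 <;>
    rcases Int.units_eq_one_or σ with rfl | rfl <;> rcases Int.units_eq_one_or τ with rfl | rfl <;>
    have e4 := congrArg (D.regionWinding Z) e3 <;> try simp only [neg_neg] at e4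
  all_goals linarith

/-- The two arcs on the component `i` join at `a` and leave out the parameters from `y` to `z`,
among them `b`. The remaining arcs of the cycle run on other components. -/
theorem cycleMultDir_through {i : Fin l} {a b y z : ℝ} (h1 : a < y) (h2 : y < b) (h3 : b < z)
    (h4 : z < a + 1) {Z : List (Arc l)} (hZ : ∀ A ∈ Z, A.comp ≠ i) (σ : ℤˣ) :
    cycleMultDir (⟨i, z, a + 1, h4, by linarith⟩ :: ⟨i, a, y, h1, by linarith⟩ :: Z) i a σ = 1 ∧
    cycleMultDir (⟨i, z, a + 1, h4, by linarith⟩ :: ⟨i, a, y, h1, by linarith⟩ :: Z) i b σ = 0 := by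
  have hne : (-1 : ℤˣ) ≠ 1 := by decide
  have h0 : ∀ t, cycleMultDir Z i t σ = 0 := by
    intro t
    apply List.sum_eq_zero
    simp only [List.mem_map]
    rintro _ ⟨A, hA, rfl⟩
    exact if_neg fun h => hZ A hA h.1
  have hcons : ∀ (A B : Arc l) t, cycleMultDir (A :: B :: Z) i t σ =
      A.multDir i t σ + (B.multDir i t σ + 0) := by
    intro A B t
    rw [← h0 t]
    rfl
  have hint : ∀ n : ℤ, n ≤ -1 ∨ n = 0 ∨ 1 ≤ n := by omega
  have hcast : ∀ n : ℤ, (n : ℝ) ≤ -1 ∨ n = 0 ∨ (1 : ℝ) ≤ n := by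
    intro n
    rcases hint n with h | h | h
    · left; exact_mod_cast h
    · exact Or.inr (Or.inl h)
    · right; right; exact_mod_cast h
  simp only [hcons]
  unfold Arc.multDir
  rcases Int.units_eq_one_or σ with rfl | rfl <;> simp only [hne, if_true, if_false]
  · rw [if_neg, if_pos ⟨rfl, 0, by simp, by simpa using h1⟩, if_neg, if_neg]
    · simp
    all_goals
      rintro ⟨-, n, k1, k2⟩
      rcases hcast n with h | rfl | h <;> [skip; simp at k1 k2; skip] <;> linarith
  · rw [if_pos ⟨rfl, 1, by push_cast; exact h4, by simp⟩, if_neg, if_neg, if_neg]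
    · simp
    all_goals
      rintro ⟨-, n, k1, k2⟩
      rcases hcast n with h | rfl | h <;> [skip; simp at k1 k2; skip] <;> linarith

section Loop

variable {c : D.Crossing} {i j : Fin l} {a b q q' : ℝ} {s : Bool}

theorem not_isSimplePoint_of_curve_eq {t t' : ℝ} (h : D.curve i t = D.curve j t')
    (hne : D.pt i t ≠ D.pt j t') : ¬ D.IsSimplePoint (D.pt i t) ∧ ¬ D.IsSimplePoint (D.pt j t') :=
  ⟨fun hs => hne (isSimplePoint_pt_iff.1 hs j t' h.symm).symm,
    fun hs => hne (isSimplePoint_pt_iff.1 hs i t h)⟩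

/-- A common point of the loop and the rest of the diagram would allow a shortcut: a cycle going
straight through the crossing on the strand at `a` without using the strand at `b`. Such a cycle
separates opposite corners, contrary to a region touching twice. The base point `q` joins the two
components outside the loop. -/
theorem disjoint_loop_of_touchesTwice (hij : i ≠ j) (hq : D.curve i q = D.curve j q')
    (h : q < a ∧ a < b ∧ b < q + 1) (ha : c.strand s = D.pt i a) (hb : c.strand (!s) = D.pt i b)
    {R : D.Region} (hR : c.TouchesTwice R) :
    Disjoint (D.curve i '' Set.Icc a b)
      (D.curve i '' Set.Ioo b (a + 1) ∪ Set.range (D.curve j)) := by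
  obtain ⟨hqa, hab, hbq⟩ := h
  have hapt : D.pt i (a + 1) = D.pt i a := pt_add_one i a
  have hcl : ∀ k t, D.curve k t = c.point → D.pt k t = D.pt i a ∨ D.pt k t = D.pt i b := by
    intro k t hkt
    rw [← ha, ← hb]
    have := c.eq_strand_of_pos_eq (s := D.pt k t) (by rw [pos_pt, hkt])
    cases s
    · exact this.symm
    · exact this
  have hpa : D.curve i a = c.point := by rw [← pos_pt, ← ha, c.pos_strand]
  have hpb : D.curve i b = c.point := by rw [← pos_pt, ← hb, c.pos_strand]
  have hpa' : D.curve i (a + 1) = D.curve i a := curve_eq_of_pt_eq hapt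
  have hnsa : ¬ D.IsSimplePoint (D.pt i a) := by rw [← ha]; exact c.not_isSimplePoint_strand s
  have hjne : ∀ t t', D.pt i t ≠ D.pt j t' := fun t t' h => hij (pt_eq_iff.1 h).1
  have hoff : ∀ z ∈ Set.Ioo b (a + 1), D.pt i z ≠ D.pt i a ∧ D.pt i z ≠ D.pt i b := by
    rintro z ⟨hz1, hz2⟩
    constructor
    · intro hz
      have := pt_injOn (q := a) ⟨by linarith, hz2⟩ ⟨le_rfl, by linarith⟩ hz
      linarith
    · intro hz
      have := pt_injOn (q := a) ⟨by linarith, hz2⟩ ⟨hab.le, by linarith⟩ hz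
      linarith
  rw [Set.disjoint_left]
  rintro _ ⟨y, ⟨hy1, hy2⟩, rfl⟩ hM
  have hyc : D.curve i y ≠ c.point := by
    intro hyc
    rcases hM with ⟨z, hz, hzy⟩ | ⟨t, ht⟩
    · rcases hcl i z (hzy.trans hyc) with h | h
      · exact (hoff z hz).1 h
      · exact (hoff z hz).2 h
    · rcases hcl j t (ht.trans hyc) with h | h
      · exact hjne _ _ h.symm
      · exact hjne _ _ h.symm
  have hy1 : a < y := lt_of_le_of_ne hy1 (by rintro rfl; exact hyc hpa)
  have hy2 : y < b := lt_of_le_of_ne hy2 (by rintro rfl; exact hyc hpb)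
  rcases hM with ⟨z, ⟨hz1, hz2⟩, hzy⟩ | ⟨t, ht⟩
  -- The component meets itself: run from `z` to `a + 1`, continue from `a` to `y`, and the cycle
  -- closes because the two ends have the same image.
  · have hne : D.pt i z ≠ D.pt i y := by
      intro hz
      have := pt_injOn (q := a) ⟨by linarith, hz2⟩ ⟨hy1.le, by linarith⟩ hz
      linarith
    obtain ⟨n1, n2⟩ := not_isSimplePoint_of_curve_eq hzy hne
    have hZ := fun σ => cycleMultDir_through hy1 hy2 hz1 hz2 (i := i) (Z := []) (by simp) σ
    refine c.not_touchesTwice_of_cycleMultDir (s := s) (isCycle_pair ?_ ?_) ?_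
      (fun σ => (cycleMultDir_strand ha _ σ).trans (hZ σ).1)
      (fun σ => (cycleMultDir_strand hb _ σ).trans (hZ σ).2) R hR
    · exact hpa'
    · exact hzy.symm
    · intro A hA
      simp only [List.mem_cons, List.not_mem_nil, or_false] at hA
      rcases hA with rfl | rfl
      · exact ⟨n1, by rw [hapt]; exact hnsa⟩
      · exact ⟨hnsa, n2⟩
  -- The other component meets the loop at `y`: follow it from there to the base point, then return
  -- along the first component from `q + 1` to `a + 1`.
  · obtain ⟨t', ht', ht1, ht2⟩ := exists_param_mem_Ioc (D := D) (D.pt j q') t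
    have ht' : D.pt j t' = D.pt j q' := ht'
    have hq1 : D.curve i (q + 1) = D.curve i q := curve_eq_of_pt_eq (pt_add_one i q)
    obtain ⟨n1, n2⟩ := not_isSimplePoint_of_curve_eq ht.symm (hjne _ _)
    obtain ⟨n3, n4⟩ := not_isSimplePoint_of_curve_eq hq (hjne _ _)
    have hZ := fun σ => cycleMultDir_through hy1 hy2 hbq (by linarith : q + 1 < a + 1) (i := i)
      (Z := [⟨j, t, t', ht1, ht2⟩]) (by simpa using hij.symm) σ
    refine c.not_touchesTwice_of_cycleMultDir (s := s) (isCycle_triple ?_ ?_ ?_) ?_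
      (fun σ => (cycleMultDir_strand ha _ σ).trans (hZ σ).1)
      (fun σ => (cycleMultDir_strand hb _ σ).trans (hZ σ).2) R hR
    · exact hpa'
    · exact ht.symm
    · exact (curve_eq_of_pt_eq ht').trans (hq.symm.trans hq1.symm)
    · intro A hA
      simp only [List.mem_cons, List.not_mem_nil, or_false] at hA
      rcases hA with rfl | rfl | rfl
      · exact ⟨by rw [pt_add_one]; exact n3, by rw [hapt]; exact hnsa⟩
      · exact ⟨hnsa, n1⟩
      · exact ⟨n2, by rw [ht']; exact n4⟩

theorem isPreconnected_loop_compl (hq : D.curve i q = D.curve j q')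
    (h : q < a ∧ a < b ∧ b < q + 1) :
    IsPreconnected (D.curve i '' Set.Ioo b (a + 1) ∪ Set.range (D.curve j)) := by
  refine IsPreconnected.union (D.curve j q') ⟨q + 1, ⟨h.2.2, by linarith⟩, ?_⟩ ⟨q', rfl⟩
    (isPreconnected_Ioo.image _ (D.continuous_curve i).continuousOn)
    (isPreconnected_range (D.continuous_curve j))
  rw [← hq]
  exact curve_eq_of_pt_eq (pt_add_one i q)

end Loop

end

end LinkDiagram

namespace LinkDiagram

section

variable {D : LinkDiagram 2}

/-! ### Unit vectors at self-crossings -/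

theorem Crossing.altSum_sub_const (c : D.Crossing) (u : D.Region → ℤ) (k : ℤ) :
    c.altSum (fun R => u R - k) = c.altSum u := by
  simp only [altSum_eq]
  ring

theorem point_eq_curve_of_strand_eq (c : D.Crossing) {s : Bool} {i : Fin 2} {t : ℝ}
    (h : c.strand s = D.pt i t) : c.point = D.curve i t := by
  rw [← c.pos_strand s, h, pos_pt]

open Classical in
/-- A loop at a crossing that a region touches twice solves the alternating problem for the
crossing, by a vector that is supported off the regions which touch twice any crossing outside
of the loop. -/
theorem exists_loop_solution {c : D.Crossing} {i j : Fin 2} {a b q q' : ℝ} {s : Bool}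
    (hij : i ≠ j) (hq : D.curve i q = D.curve j q') (h : q < a ∧ a < b ∧ b < q + 1)
    (ha : c.strand s = D.pt i a) (hb : c.strand (!s) = D.pt i b)
    {R₀ : D.Region} (hR₀ : c.TouchesTwice R₀) :
    ∃ u : D.Region → ℤ,
      (∀ c' : D.Crossing, (c'.eps : ℤ) * c'.altSum u =
        if c' = c then (bif s then -1 else 1) else 0) ∧
      ∀ (c' : D.Crossing) (R : D.Region), c'.TouchesTwice R → u R ≠ 0 →
        c'.overPt.1 = i ∧ c'.underPt.1 = i ∧ ∀ (s' : Bool) (a' b' : ℝ),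
          (q < a' ∧ a' < b' ∧ b' < q + 1) → c'.strand s' = D.pt i a' →
          c'.strand (!s') = D.pt i b' → a < a' ∧ b' < b := by
  have hZ := isCycle_loopArc h ha hb
  set Z := [loopArc i a b q h] with hZdef
  have hdisj := disjoint_loop_of_touchesTwice hij hq h ha hb hR₀
  have hpre := isPreconnected_loop_compl hq h
  obtain ⟨hqa, hab, hbq⟩ := id h
  set M := D.curve i '' Set.Ioo b (a + 1) ∪ Set.range (D.curve j) with hM
  have hoff : ∀ p ∈ M, ∀ A ∈ Z, p ∉ A.track D := by
    intro p hp A hA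
    rw [hZdef, List.mem_singleton] at hA
    subst hA
    exact fun hpL => Set.disjoint_left.1 hdisj hpL hp
  have hq' : D.curve j q' ∈ M := Or.inr ⟨q', rfl⟩
  -- The rest `M` of the diagram is connected and avoids the loop, so the winding number is constant
  -- along it. Subtracting this constant makes the solution vanish on all regions adherent to `M`;
  -- alternating sums do not see constants.
  have hzero : ∀ (R : D.Region) p, p ∈ M → p ∈ closure R.toSet →
      D.regionWinding Z R - D.winding Z (D.curve j q') = 0 := by
    intro R p hp hpR
    rw [← winding_eq_regionWinding hZ hpR (hoff p hp),
      winding_eq_of_isPreconnected hZ hpre hoff hp hq', sub_self]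
  refine ⟨fun R => D.regionWinding Z R - D.winding Z (D.curve j q'), fun c' => ?_, ?_⟩
  · rw [Crossing.altSum_sub_const]
    exact eps_mul_altSum_loopArc h ha hb c'
  intro c' R hR hu
  have hself : c'.overPt.1 = c'.underPt.1 := by
    by_contra hne
    exact c'.not_touchesTwice_of_not_isSelf hne R hR
  have hcl : c'.point ∈ closure R.toSet := by
    obtain ⟨σ, τ, rfl, -⟩ := c'.touchesTwice_iff.1 hR
    exact c'.corner_mem_closure σ τ
  have hpM : c'.point ∉ M := fun hp => hu (hzero R _ hp hcl)
  have hi : c'.overPt.1 = i := by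
    by_contra hne
    have hj : c'.overPt.1 = j := by omega
    refine hpM (Or.inr ⟨c'.overPt.2, ?_⟩)
    rw [← hj]
    rfl
  -- At `c` itself, both regions beside the strand just after `b` are adherent to `M`. One of any
  -- two opposite corners lies along that half-strand, so a region touching `c` twice has value
  -- zero.
  have hcc : c' ≠ c := by
    rintro rfl
    obtain ⟨ε, hε, hf⟩ := c'.exists_strandCorner_faces (!s)
    have hside : ∀ τ, D.regionWinding Z (c'.strandCorner (!s) 1 τ) -
        D.winding Z (D.curve j q') = 0 := by
      intro τ
      have hmin : 0 < min ε (a + 1 - b) := lt_min hε (by linarith)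
      obtain ⟨r, hr0, hr1⟩ := exists_between hmin
      rw [lt_min_iff] at hr1
      have hF := (hf 1 r hr0 hr1.1).2 (τ * c'.strandEps !s)
      rw [mul_assoc, Int.units_mul_self, mul_one] at hF
      have hpt : D.pt (c'.strand !s).1 ((c'.strand !s).2 + ((1 : ℤˣ) : ℤ) * r) = D.pt i (b + r) := by
        have := pt_add_eq ((D.pt_coe (c'.strand !s)).trans hb) r
        simpa using this
      refine hzero _ _ (Or.inl ⟨b + r, ⟨by linarith, by linarith⟩, ?_⟩) hF.mem_closure
      exact (curve_eq_of_pt_eq hpt).symm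
    obtain ⟨σ, τ, e1, e2⟩ := c'.touchesTwice_iff.1 hR
    apply hu
    cases s
    · rcases Int.units_eq_one_or σ with rfl | rfl
      · rw [e1]; exact hside τ
      · rw [e2]; exact hside (-τ)
    · rcases Int.units_eq_one_or τ with rfl | rfl
      · rw [e1]; exact hside σ
      · rw [e2]; exact hside (-σ)
  refine ⟨hi, hself ▸ hi, fun s' a' b' ⟨h1, h2, h3⟩ ha' hb' => ?_⟩
  have key : ∀ (r : Bool) (t : ℝ), c'.strand r = D.pt i t → q < t → t < q + 1 → a < t ∧ t < b := by
    intro r t ht ht1 ht2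
    have hpt := point_eq_curve_of_strand_eq c' ht
    have hta : t ≠ a := by
      rintro rfl
      exact hcc (Crossing.strand_injective (ht.trans ha.symm)).1
    have htb : t ≠ b := by
      rintro rfl
      exact hcc (Crossing.strand_injective (ht.trans hb.symm)).1
    constructor
    · by_contra! hle
      have hlt := lt_of_le_of_ne hle hta
      refine hpM (Or.inl ⟨t + 1, ⟨by linarith, by linarith⟩, ?_⟩)
      rw [hpt]
      exact curve_eq_of_pt_eq (pt_add_one i t)
    · by_contra! hle
      have hlt := lt_of_le_of_ne hle htb.symm
      exact hpM (Or.inl ⟨t, ⟨hlt, by linarith⟩, hpt.symm⟩)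
  exact ⟨(key s' a' ha' h1 (by linarith)).1, (key (!s') b' hb' (by linarith) h3).2⟩

/-- A submodule contains a vector as soon as it contains the unit vectors of its support. -/
theorem mem_of_forall_single_mem {n : ℕ} {S : Submodule ℤ (Fin n → ℤ)} {w : Fin n → ℤ}
    (h : ∀ k, w k ≠ 0 → Pi.single k 1 ∈ S) : w ∈ S := by
  rw [pi_eq_sum_univ' w]
  refine Submodule.sum_mem _ fun k _ => ?_
  by_cases hk : w k = 0
  · simp [hk]
  · exact S.smul_mem _ (h k hk)

theorem checkerboardTwist_ne_zero {χ : D.Region → ZMod 2} {u : D.Region → ℤ} {R : D.Region}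
    (h : checkerboardTwist χ u R ≠ 0) : u R ≠ 0 := by
  unfold checkerboardTwist at h
  split_ifs at h
  · exact neg_ne_zero.1 h
  · exact h

/-- A multiple by a unit of a solution of the alternating problem for the unit vector of a
crossing solves the definite problem with the double counting rule. -/
theorem single_mem_of_doubleMap_twist_mem {n : ℕ} (x : Fin n ≃ D.Crossing)
    {χ : D.Region → ZMod 2} (hχ : D.IsCheckerboardColoring χ) {S : Submodule ℤ (Fin n → ℤ)}
    {u : D.Region → ℤ} {k : Fin n} {r : Bool}
    (hu : ∀ c' : D.Crossing, (c'.eps : ℤ) * c'.altSum u =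
      open Classical in if c' = x k then (bif r then -1 else 1) else 0)
    (hS : doubleMap x (checkerboardTwist χ u) ∈ S) : Pi.single k 1 ∈ S := by
  let e : ℤˣ := (x k).colorSign χ * (x k).eps * (bif r then -1 else 1)
  have h : Pi.single k 1 = (e : ℤ) • doubleMap x (checkerboardTwist χ u) := by
    funext j
    have hj : (x j).altSum u = ((x j).eps : ℤ) * (((x j).eps : ℤ) * (x j).altSum u) := by
      rw [← mul_assoc, ← Units.val_mul, Int.units_mul_self, Units.val_one, one_mul]
    change _ = (e : ℤ) * choiceMap x D.definiteDouble _ j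
    rw [choiceMap_definiteDouble, Crossing.cornerSum_twist _ hχ, hj, hu]
    by_cases hjk : j = k
    · subst hjk
      simp only [Pi.single_eq_same, if_true, e]
      rcases Int.units_eq_one_or ((x j).colorSign χ) with h1 | h1 <;>
        rcases Int.units_eq_one_or (x j).eps with h2 | h2 <;> cases r <;> simp [h1, h2]
    · simp [hjk]
  rw [h]
  exact S.smul_mem _ hS

/-- The two counting rules differ only at crossings touched twice by a region on which `u` does not
vanish, and there the error is corrected by unit vectors. -/
theorem doubleMap_mem_range_singleMap {n : ℕ} (x : Fin n ≃ D.Crossing) {u : D.Region → ℤ}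
    (h : ∀ k, (∃ R, (x k).TouchesTwice R ∧ u R ≠ 0) →
      Pi.single k 1 ∈ LinearMap.range (singleMap x)) :
    doubleMap x u ∈ LinearMap.range (singleMap x) := by
  have hd : doubleMap x u - singleMap x u ∈ LinearMap.range (singleMap x) := by
    refine mem_of_forall_single_mem fun k hk => h k ?_
    by_contra! hcon
    apply hk
    change choiceMap x D.definiteDouble u k - choiceMap x D.definiteSingle u k = 0
    rw [choiceMap_definiteDouble, choiceMap_definiteSingle, Crossing.doubleSum_eq_zero _ hcon]
    ring
  have := Submodule.add_mem _ hd (LinearMap.mem_range_self (singleMap x) u)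
  rwa [sub_add_cancel] at this

/-! ### Self-crossings seen from a fixed crossing of the two components -/

section Base

variable {m : D.Crossing}

/-- A crossing of the two components seen from either component. -/
theorem Crossing.exists_base (hm : ¬ m.IsSelf) (i : Fin 2) : ∃ (j : Fin 2) (q q' : ℝ) (b : Bool),
    i ≠ j ∧ D.curve i q = D.curve j q' ∧ m.strand b = D.pt i q := by
  obtain ⟨b, hb⟩ := Crossing.exists_strand_fst_eq hm i
  refine ⟨(m.strand !b).1, (m.strand b).2, (m.strand !b).2, b, ?_, ?_, ?_⟩
  · rw [← hb]
    unfold Crossing.IsSelf at hm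
    cases b
    · exact fun h => hm h.symm
    · exact hm
  · rw [← pos_pt, ← pos_pt, ← hb, pt_coe, pt_coe, m.pos_strand, m.pos_strand]
  · rw [← hb, pt_coe]

theorem Crossing.exists_params_of_isSelf {c : D.Crossing} (hm : ¬ m.IsSelf) (hc : c.IsSelf)
    {i : Fin 2} {b : Bool} {q : ℝ} (hi : c.overPt.1 = i) (hq : m.strand b = D.pt i q) :
    ∃ (a b : ℝ) (s : Bool), (q < a ∧ a < b ∧ b < q + 1) ∧ c.strand s = D.pt i a ∧
      c.strand (!s) = D.pt i b := by
  have hne : ∀ s, D.pt i q ≠ c.strand s := by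
    intro s h
    have := (Crossing.strand_injective (hq.trans h)).1
    exact hm (this ▸ hc)
  obtain ⟨a, b, s, h1, h2, h3, h4, h5⟩ := c.exists_params hi (hc ▸ hi) (hne true) (hne false)
  exact ⟨a, b, s, ⟨h1, h2, h3⟩, h4, h5⟩

theorem single_mem_range_doubleMap (hm : ¬ m.IsSelf) {χ : D.Region → ZMod 2}
    (hχ : D.IsCheckerboardColoring χ) {n : ℕ} (x : Fin n ≃ D.Crossing) {k : Fin n}
    (hk : (x k).IsSelf) : Pi.single k 1 ∈ LinearMap.range (doubleMap x) := by
  obtain ⟨j, q, q', b₀, hij, hq, hb₀⟩ := Crossing.exists_base hm (x k).overPt.1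
  obtain ⟨a, b, s, h, ha, hb⟩ := Crossing.exists_params_of_isSelf hm hk rfl hb₀
  exact single_mem_of_doubleMap_twist_mem x hχ (fun c' => eps_mul_altSum_loopArc h ha hb c')
    (LinearMap.mem_range_self _ _)

/-- The loop solution solves the double counting problem; passing to single counting costs errors
only at crossings strictly inside the loop. -/
theorem single_mem_range_singleMap_of_touchesTwice (hm : ¬ m.IsSelf) {χ : D.Region → ZMod 2}
    (hχ : D.IsCheckerboardColoring χ) {n : ℕ} (x : Fin n ≃ D.Crossing) {k : Fin n}
    {R : D.Region} (hR : (x k).TouchesTwice R) :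
    Pi.single k 1 ∈ LinearMap.range (singleMap x) := by
  have hself : ∀ k, (∃ R, (x k).TouchesTwice R) → (x k).IsSelf := by
    rintro k ⟨R, hR⟩
    by_contra hne
    exact (x k).not_touchesTwice_of_not_isSelf hne R hR
  choose j q q' b₀ hij hq hb₀ using fun i => Crossing.exists_base hm i
  have hpar : ∀ k, (x k).IsSelf → ∃ (a b : ℝ) (s : Bool),
      (q (x k).overPt.1 < a ∧ a < b ∧ b < q (x k).overPt.1 + 1) ∧
      (x k).strand s = D.pt (x k).overPt.1 a ∧ (x k).strand (!s) = D.pt (x k).overPt.1 b :=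
    fun k hk => Crossing.exists_params_of_isSelf hm hk rfl (hb₀ _)
  choose! a b s hab ha hb using hpar
  by_contra hcon
  -- A counterexample with the shortest parameter interval of its loop. Base parameters are fixed
  -- once per component, so that nested loops are compared in the same unit interval.
  obtain ⟨k, ⟨⟨R, hR⟩, hk⟩, hmin⟩ := Set.exists_min_image
    {k | (∃ R, (x k).TouchesTwice R) ∧ Pi.single k 1 ∉ LinearMap.range (singleMap x)}
    (fun k => b k - a k) (Set.toFinite _) ⟨k, ⟨R, hR⟩, hcon⟩
  have hks := hself k ⟨R, hR⟩
  obtain ⟨u, hu1, hu2⟩ := exists_loop_solution (hij _) (hq _) (hab k hks) (ha k hks) (hb k hks) hR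
  refine hk (single_mem_of_doubleMap_twist_mem x hχ hu1 (doubleMap_mem_range_singleMap x ?_))
  rintro k' ⟨R', hR', hne⟩
  by_contra hk'
  have hk's := hself k' ⟨R', hR'⟩
  obtain ⟨e1, -, hlt⟩ := hu2 (x k') R' hR' (checkerboardTwist_ne_zero hne)
  have h1 := hab k' hk's
  have h2 := ha k' hk's
  have h3 := hb k' hk's
  rw [e1] at h1 h2 h3
  obtain ⟨l1, l2⟩ := hlt _ _ _ h1 h2 h3
  have := hmin k' ⟨⟨R', hR'⟩, hk'⟩
  linarith

theorem range_doubleMap_le (hm : ¬ m.IsSelf) {χ : D.Region → ZMod 2}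
    (hχ : D.IsCheckerboardColoring χ) {n : ℕ} (x : Fin n ≃ D.Crossing) :
    LinearMap.range (doubleMap x) ≤ LinearMap.range (singleMap x) := by
  rintro _ ⟨u, rfl⟩
  exact doubleMap_mem_range_singleMap x fun k ⟨R, hR, _⟩ =>
    single_mem_range_singleMap_of_touchesTwice hm hχ x hR

end Base

/-! ### The span of the definite vectors -/

/-- Off the coordinate `m` the family is diagonal with entries `±1`, which gives independence and
lets a combination match any vector there. For a vector in the kernel of `a`, the relation then
forces agreement at `m` too, because `a m ≠ 0`. -/
theorem linearIndependent_and_mem_span_iff {n : ℕ} {m : Fin n} {f : {i : Fin n // i ≠ m} → Fin n → ℤ}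
    (h1 : ∀ i, f i i = 1 ∨ f i i = -1) (h0 : ∀ i j, j ≠ m → j ≠ i.1 → f i j = 0) {a : Fin n → ℤ}
    (ha : a m ≠ 0) (haf : ∀ i, ∑ k, a k * f i k = 0) :
    LinearIndependent ℤ f ∧
      ∀ z, z ∈ Submodule.span ℤ (Set.range f) ↔ ∑ k, a k * z k = 0 := by
  have hcoord : ∀ (g : {i : Fin n // i ≠ m} → ℤ) (i : {i : Fin n // i ≠ m}),
      (∑ k, g k • f k) i = g i * f i i := by
    intro g i
    rw [Finset.sum_apply, Finset.sum_eq_single i]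
    · rfl
    · intro k _ hk
      rw [Pi.smul_apply, h0 k i i.2 (fun h => hk (Subtype.ext h.symm)), smul_zero]
    · simp
  have hspan : ∀ z, z ∈ Submodule.span ℤ (Set.range f) → ∑ k, a k * z k = 0 := by
    intro z hz
    induction hz using Submodule.span_induction with
    | mem z hz => obtain ⟨i, rfl⟩ := hz; exact haf i
    | zero => simp
    | add y z _ _ hy hz => simp only [Pi.add_apply, mul_add, Finset.sum_add_distrib, hy, hz, add_zero]
    | smul r z _ hz =>
      simp only [Pi.smul_apply, smul_eq_mul, mul_left_comm, ← Finset.mul_sum, hz, mul_zero]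
  refine ⟨Fintype.linearIndependent_iff.2 fun g hg i => ?_, fun z => ⟨hspan z, fun hz => ?_⟩⟩
  · have h := hcoord g i
    rw [hg] at h
    rcases h1 i with h2 | h2 <;> rw [h2] at h <;> simpa using h.symm
  -- The diagonal entries are their own inverses, so these coefficients reproduce `z` at every
  -- coordinate other than `m`.
  · have hy : ∑ i : {i : Fin n // i ≠ m}, (z i * f i i) • f i ∈ Submodule.span ℤ (Set.range f) :=
      Submodule.sum_mem _ fun i _ => Submodule.smul_mem _ _ (Submodule.subset_span ⟨i, rfl⟩)
    set y := ∑ i : {i : Fin n // i ≠ m}, (z i * f i i) • f i with hydef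
    have hyz : ∀ k, k ≠ m → z k - y k = 0 := by
      intro k hk
      have h := hcoord (fun i => z i * f i i) ⟨k, hk⟩
      have hsq : f ⟨k, hk⟩ k * f ⟨k, hk⟩ k = 1 := by
        rcases h1 ⟨k, hk⟩ with h2 | h2 <;> simp only at h2 <;> rw [h2] <;> norm_num
      rw [mul_assoc] at h
      simp only at h
      rw [hsq, mul_one] at h
      rw [hydef, h, sub_self]
    have hsum : ∑ k, a k * (z k - y k) = 0 := by
      simp only [mul_sub, Finset.sum_sub_distrib, hz, hspan y hy, sub_zero]
    rw [Finset.sum_eq_single m (fun k _ hk => by rw [hyz k hk, mul_zero]) (by simp)] at hsum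
    have hm0 := (mul_eq_zero.1 hsum).resolve_left ha
    have : z = y := by
      funext k
      by_cases hk : k = m
      · rw [hk]; linarith
      · linarith [hyz k hk]
    rw [this]
    exact hy

end

end LinkDiagram

/-! ### The linear relation and the image lattice -/

namespace LinkDiagram

section

variable {D : LinkDiagram 2}

open Classical in
/-- The coefficients of the linear relation between the components of the definite vectors. -/
noncomputable def relationCoeff (χ : D.Region → ZMod 2) (c : D.Crossing) : ℤ :=
  if c.IsSelf then 0 else (c.zeroEps : ℤ) * c.colorSign χ

variable {χ : D.Region → ZMod 2} {n : ℕ} (x : Fin n ≃ D.Crossing)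

theorem sum_relationCoeff_mul_doubleMap (hχ : D.IsCheckerboardColoring χ) (u : D.Region → ℤ) :
    ∑ k, relationCoeff χ (x k) * doubleMap x u k = 0 := by
  classical
  let _ : Fintype D.Crossing := Fintype.ofEquiv _ x
  have h := sum_zeroEps_mul_altSum_eq_zero (checkerboardTwist χ u)
  rw [← Equiv.sum_comp x] at h
  refine Eq.trans (Finset.sum_congr rfl fun k _ => ?_) h
  change relationCoeff χ (x k) * choiceMap x D.definiteDouble u k = _
  rw [choiceMap_definiteDouble, relationCoeff, Crossing.altSum_eq_cornerSum_twist _ hχ]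
  split_ifs
  · rw [zero_mul]
  · rw [mul_assoc]

/-- The coefficients vanish at self-crossings, and at mixed crossings no region touches twice, so
single and double counting agree wherever the relation looks. -/
theorem sum_relationCoeff_mul_singleMap (hχ : D.IsCheckerboardColoring χ) (u : D.Region → ℤ) :
    ∑ k, relationCoeff χ (x k) * singleMap x u k = 0 := by
  refine Eq.trans (Finset.sum_congr rfl fun k _ => ?_) (sum_relationCoeff_mul_doubleMap x hχ u)
  change relationCoeff χ (x k) * choiceMap x D.definiteSingle u k =
    relationCoeff χ (x k) * choiceMap x D.definiteDouble u k
  rw [choiceMap_definiteDouble, choiceMap_definiteSingle]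
  by_cases hk : (x k).IsSelf
  · rw [relationCoeff, if_pos hk, zero_mul, zero_mul]
  · rw [Crossing.doubleSum_eq_zero _ fun R hR =>
      absurd hR ((x k).not_touchesTwice_of_not_isSelf hk R), sub_zero]

theorem definiteVector_apply (hχ : D.IsCheckerboardColoring χ) {m i : Fin n}
    {v : D.Region → ℤ} (hv : choiceMap x D.alternatingDouble v = alternatingVector x m i)
    (j : Fin n) : definiteVector x χ v j =
      (x j).colorSign χ * (x j).sign * alternatingVector x m i j := by
  have h := congrFun hv j
  rw [choiceMap_alternatingDouble] at h
  rw [definiteVector, choiceMap_definiteDouble, Crossing.cornerSum_twist _ hχ, ← h,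
    Crossing.sign_eq_eps, mul_assoc, ← mul_assoc ((x j).eps : ℤ), ← Units.val_mul,
    Int.units_mul_self, Units.val_one, one_mul]

/-- Twisting multiplies each entry of `alternatingVector` by the crossing sign and the color sign.
At `m` the color sign is `1` by the choice of coloring, and the crossing sign appears squared. -/
theorem definiteVector_values {m i : Fin n} (hχ : D.IsCheckerboardColoringAt (x m) χ)
    (him : i ≠ m) {v : D.Region → ℤ}
    (hv : choiceMap x D.alternatingDouble v = alternatingVector x m i) :
    definiteVector x χ v m = 1 ∧ (definiteVector x χ v i = 1 ∨ definiteVector x χ v i = -1) ∧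
      ∀ j, j ≠ m → j ≠ i → definiteVector x χ v j = 0 := by
  have h := definiteVector_apply x hχ.1 hv
  refine ⟨?_, ?_, fun j hjm hji => ?_⟩
  · rw [h, hχ.colorSign_eq, Crossing.sign_eq_eps, alternatingVector, if_pos rfl,
      Crossing.sign_eq_eps, mul_assoc, ← Units.val_mul, Int.units_mul_self]
    rfl
  · rw [h, alternatingVector, if_neg him, if_pos rfl, Crossing.sign_eq_eps]
    rcases Int.units_eq_one_or ((x i).colorSign χ) with h1 | h1 <;>
      rcases Int.units_eq_one_or (x i).eps with h2 | h2 <;> rw [h1, h2] <;> split_ifs <;> simp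
  · rw [h, alternatingVector, if_neg hjm, if_neg hji, mul_zero]

theorem definiteFamily_mem_range_doubleMap {m : Fin n} (hm : ¬ (x m).IsSelf)
    (hχ : D.IsCheckerboardColoring χ) (v : Fin n → D.Region → ℤ) (i : {i : Fin n // i ≠ m}) :
    definiteFamily x m χ v i ∈ LinearMap.range (doubleMap x) := by
  unfold definiteFamily
  split_ifs with h
  · convert single_mem_range_doubleMap hm hχ x h
  · exact LinearMap.mem_range_self (doubleMap x) _

theorem definiteFamily_linearIndependent_and_mem_span_iff {m : Fin n}
    (hm : ¬ (x m).IsSelf) (hχ : D.IsCheckerboardColoringAt (x m) χ) {v : Fin n → D.Region → ℤ}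
    (hv : ∀ i, i ≠ m → ¬ (x i).IsSelf →
      choiceMap x D.alternatingDouble (v i) = alternatingVector x m i) :
    LinearIndependent ℤ (definiteFamily x m χ v) ∧
      ∀ z, z ∈ Submodule.span ℤ (Set.range (definiteFamily x m χ v)) ↔
        ∑ k, relationCoeff χ (x k) * z k = 0 := by
  refine linearIndependent_and_mem_span_iff (fun i => ?_) (fun i j hjm hji => ?_) ?_ (fun i => ?_)
  · unfold definiteFamily
    split_ifs with h
    · left; simp
    · exact (definiteVector_values x hχ i.2 (hv i i.2 h)).2.1
  · unfold definiteFamily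
    split_ifs with h
    · simp [hji]
    · exact (definiteVector_values x hχ i.2 (hv i i.2 h)).2.2 j hjm hji
  · rw [relationCoeff, if_neg hm, ← Units.val_mul]
    exact Units.ne_zero _
  · obtain ⟨u, hu⟩ := definiteFamily_mem_range_doubleMap x hm hχ.1 v i
    rw [← hu]
    exact sum_relationCoeff_mul_doubleMap x hχ.1 u

/-- The span lies in the double image, which lies in the single image; both images satisfy the
relation, and the span is all of its kernel. So all of them coincide. -/
theorem span_definiteFamily_eq {m : Fin n}
    (hm : ¬ (x m).IsSelf) (hχ : D.IsCheckerboardColoringAt (x m) χ) {v : Fin n → D.Region → ℤ}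
    (hv : ∀ i, i ≠ m → ¬ (x i).IsSelf →
      choiceMap x D.alternatingDouble (v i) = alternatingVector x m i) :
    Submodule.span ℤ (Set.range (definiteFamily x m χ v)) = LinearMap.range (singleMap x) ∧
    Submodule.span ℤ (Set.range (definiteFamily x m χ v)) = LinearMap.range (doubleMap x) := by
  have h := (definiteFamily_linearIndependent_and_mem_span_iff x hm hχ hv).2
  have h1 : Submodule.span ℤ (Set.range (definiteFamily x m χ v)) ≤
      LinearMap.range (doubleMap x) := by
    rw [Submodule.span_le]
    rintro _ ⟨i, rfl⟩
    exact definiteFamily_mem_range_doubleMap x hm hχ.1 v i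
  constructor
  · refine le_antisymm (h1.trans (range_doubleMap_le hm hχ.1 x)) ?_
    rintro _ ⟨u, rfl⟩
    exact (h _).2 (sum_relationCoeff_mul_singleMap x hχ.1 u)
  · refine le_antisymm h1 ?_
    rintro _ ⟨u, rfl⟩
    exact (h _).2 (sum_relationCoeff_mul_doubleMap x hχ.1 u)

theorem exists_map_add_eq_zero_iff {M N : Type*} [AddCommGroup M] [AddCommGroup N]
    (f : M →ₗ[ℤ] N) (c : N) : (∃ u, f u + c = 0) ↔ c ∈ LinearMap.range f := by
  constructor
  · rintro ⟨u, hu⟩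
    exact ⟨-u, by rw [map_neg, neg_eq_iff_add_eq_zero]; exact hu⟩
  · rintro ⟨u, rfl⟩
    exact ⟨-u, by rw [map_neg, neg_add_cancel]⟩

end

end LinkDiagram

theorem mainTheorem7 (D : LinkDiagram 2) (hD : IsConnected D.image)
    (n : ℕ) (x : Fin n ≃ D.Crossing) :
    (∃ m, (x m).CrossesRightToLeft) ∧
    ∀ m : Fin n, (x m).CrossesRightToLeft →
      (∃ χ, D.IsCheckerboardColoringAt (x m) χ) ∧
      (∀ i, i ≠ m → ¬ (x i).IsSelf →
        ∃ v, LinkDiagram.choiceMap x D.alternatingDouble v =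
          LinkDiagram.alternatingVector x m i) ∧
      ∀ χ, D.IsCheckerboardColoringAt (x m) χ →
      ∀ v : Fin n → D.Region → ℤ,
        (∀ i, i ≠ m → ¬ (x i).IsSelf →
          LinkDiagram.choiceMap x D.alternatingDouble (v i) =
            LinkDiagram.alternatingVector x m i) →
        (∀ i, i ≠ m → ¬ (x i).IsSelf →
          LinkDiagram.definiteVector x χ (v i) m = 1 ∧
          (LinkDiagram.definiteVector x χ (v i) i = 1 ∨
            LinkDiagram.definiteVector x χ (v i) i = -1) ∧
          ∀ j, j ≠ m → j ≠ i → LinkDiagram.definiteVector x χ (v i) j = 0) ∧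
        LinearIndependent ℤ (LinkDiagram.definiteFamily x m χ v) ∧
        ((Submodule.span ℤ (Set.range (LinkDiagram.definiteFamily x m χ v)) :
            Submodule ℤ (Fin n → ℤ)) : Set (Fin n → ℤ)) =
          Set.range (LinkDiagram.choiceMap x D.definiteSingle) ∧
        ((Submodule.span ℤ (Set.range (LinkDiagram.definiteFamily x m χ v)) :
            Submodule ℤ (Fin n → ℤ)) : Set (Fin n → ℤ)) =
          Set.range (LinkDiagram.choiceMap x D.definiteDouble) ∧
        ∀ c : Fin n → ℤ,
          ((∃ u, LinkDiagram.choiceMap x D.definiteSingle u + c = 0) ↔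
            c ∈ Submodule.span ℤ (Set.range (LinkDiagram.definiteFamily x m χ v))) ∧
          ((∃ w, LinkDiagram.choiceMap x D.definiteDouble w + c = 0) ↔
            c ∈ Submodule.span ℤ (Set.range (LinkDiagram.definiteFamily x m χ v))) := by
  let _ : Fintype D.Crossing := Fintype.ofEquiv _ x
  refine ⟨?_, fun m hm => ?_⟩
  · obtain ⟨c, hc⟩ := LinkDiagram.exists_crossesRightToLeft hD
    exact ⟨x.symm c, by rwa [x.apply_symm_apply]⟩
  have hms := ((x m).crossesRightToLeft_iff.1 hm).1
  refine ⟨LinkDiagram.exists_isCheckerboardColoringAt _ (LinkDiagram.exists_not_isSimplePoint hms),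
    fun i him hi => ?_, fun χ hχ v hv => ?_⟩
  · obtain ⟨v, h⟩ := LinkDiagram.exists_alternating hm hi (fun h => him (x.injective h))
    refine ⟨v, funext fun j => ?_⟩
    rw [LinkDiagram.choiceMap_alternatingDouble, h, LinkDiagram.alternatingVector]
    simp only [x.injective.eq_iff]
  obtain ⟨h1, h2⟩ := LinkDiagram.span_definiteFamily_eq x hms hχ hv
  refine ⟨fun i him hi => LinkDiagram.definiteVector_values x hχ him (hv i him hi),
    (LinkDiagram.definiteFamily_linearIndependent_and_mem_span_iff x hms hχ hv).1, ?_, ?_,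
    fun c => ⟨?_, ?_⟩⟩
  · rw [h1]; rfl
  · rw [h2]; rfl
  · rw [h1]
    exact LinkDiagram.exists_map_add_eq_zero_iff (LinkDiagram.singleMap x) c
  · rw [h2]
    exact LinkDiagram.exists_map_add_eq_zero_iff (LinkDiagram.doubleMap x) c
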